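/- Let $\mathbb{D}=\mathbb{R}^2\times\mathbb{T}^1$ with $\mathbb{T}^1=\mathbb{R}/\mathbb{Z}$, with points $(x,z)$, and let $\mathbb{P}$ be the Leray projector, i.e. the orthogonal projector in $L^2(\mathbb{D})^3$ (real vector fields) onto the closed subspace of fields $u$ with $\operatorname{div}u=0$ in the sense of distributions. Let $e_3=(0,0,1)$. For $f\in L^2(\mathbb{D})$ let $$f_n(k)=\frac1{2\pi}\int_{\mathbb{R}^2}\int_{\mathbb{T}^1}f(x,z)\,e^{-i(k\cdot x+2\pi nz)}\,dz\,dx,\qquad k\in\mathbb{R}^2,\ n\in\mathbb{Z},$$ be its Fourier transform (in the $L^2$ sense), applied to vector fields componentwise, and for $R>0$ let $\mathcal{B}_R=\{(k,n)\in\mathbb{R}^2\times\mathbb{Z} : \sqrt{|k|^2+4\pi^2n^2}\le R\}$. For every $R>0$ there exists $C_R>0$ such that the following holds for every $\Omega\in\mathbb{R}\setminus\{0\}$ and every $\tilde u_0\in L^2(\mathbb{D})^3$ which is divergence-free, has zero vertical average ($\int_{\mathbb{T}^1}\tilde u_0(x,z)\,dz=0$ for almost every $x\in\mathbb{R}^2$),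 and whose Fourier transform is supported in $\mathcal{B}_R$. The linear Rossby equation $$\partial_t\tilde u+\Omega\,\mathbb{P}(e_3\wedge\tilde u)=\Delta\tilde u,\qquad \operatorname{div}\tilde u=0,\qquad \tilde u(0)=\tilde u_0,$$ has a unique weak solution $\tilde u\in C([0,\infty),L^2(\mathbb{D})^3)$, that is, a unique such $\tilde u$ with $\tilde u(0)=\tilde u_0$, with $\operatorname{div}\tilde u(t)=0$ for all $t\ge0$, and with $$\frac{d}{dt}\int_{\mathbb{D}}\tilde u(t)\cdot\varphi=\int_{\mathbb{D}}\tilde u(t)\cdot\Delta\varphi-\Omega\int_{\mathbb{D}}\mathbb{P}(e_3\wedge\tilde u(t))\cdot\varphi$$ for all $t>0$ and all $\varphi\in C_c^\infty(\mathbb{D})^3$. This solution satisfies $$\|\tilde u\|_{L^1(\mathbb{R}_+,L^\infty(\mathbb{D}))}=\int_0^\infty\|\tilde u(t)\|_{L^\infty(\mathbb{D})}\,dt\ \le\ C_R\,|\Omega|^{-1/4}\,\|\tilde u_0\|_{L^2(\mathbb{D})}.$$ -/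

import Mathlib

open MeasureTheory Set
open scoped ContDiff ENNReal FourierTransform RealInnerProductSpace

noncomputable section

namespace Rossby

/-! ### The layer `ℝ² × 𝕋¹` and its vector fields -/

abbrev Plane : Type := EuclideanSpace ℝ (Fin 2)

/-- The layer `𝔻 = ℝ² × (ℝ/ℤ)`; `volume` is Lebesgue measure times the Haar measure of mass one. -/
abbrev Layer : Type := Plane × UnitAddCircle

abbrev Vec3 : Type := EuclideanSpace ℝ (Fin 3)

/-- The space `L²(𝔻)³` of real vector fields, with its usual Hilbert space structure. -/
abbrev L2Field : Type := Lp Vec3 2 (volume : Measure Layer)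

/-- The covering map `ℝ² × ℝ → ℝ² × (ℝ/ℤ)`. -/
def cover (q : Plane × ℝ) : Layer := (q.1, (q.2 : UnitAddCircle))

/-- The three coordinate directions. -/
def axis : Fin 3 → Plane × ℝ :=
  ![(EuclideanSpace.single 0 1, 0), (EuclideanSpace.single 1 1, 0), (0, 1)]

section Calculus

variable {F : Type*} [NormedAddCommGroup F] [NormedSpace ℝ F]

/-- The partial derivative `∂ᵢ f` of a function on the layer. -/
def partialD (i : Fin 3) (f : Layer → F) (p : Layer) : F :=
  deriv (fun s : ℝ => f (p + cover (s • axis i))) 0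

/-- The Laplacian in all three variables. -/
def laplacian (f : Layer → F) (p : Layer) : F :=
  ∑ i, partialD i (partialD i f) p

/-- Test functions: the class `C_c^∞(𝔻)`. Smoothness is smoothness of the lift to `ℝ² × ℝ`. -/
structure IsTest (f : Layer → F) : Prop where
  smooth : ContDiff ℝ ∞ (fun q : Plane × ℝ => f (cover q))
  compact : HasCompactSupport f

end Calculus

/-- The gradient of a scalar function on the layer. -/
def gradient (f : Layer → ℝ) (p : Layer) : Vec3 :=
  WithLp.toLp 2 fun i => partialD i f p

/-! ### Divergence-free fields and the Leray projector -/

/-- `div u = 0` in the sense of distributions. -/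
def IsDivFree (u : L2Field) : Prop :=
  ∀ f : Layer → ℝ, IsTest f → ∫ p, ⟪u p, gradient f p⟫ = 0

theorem cover_add (q r : Plane × ℝ) : cover (q + r) = cover q + cover r := by
  simp [cover]

theorem continuous_cover : Continuous cover :=
  continuous_fst.prodMk ((AddCircle.continuous_mk' 1).comp continuous_snd)

theorem isQuotientMap_cover : Topology.IsQuotientMap cover := by
  have h : IsOpenMap cover := IsOpenMap.id.prodMap QuotientAddGroup.isOpenMap_coe
  refine h.isQuotientMap continuous_cover ?_
  exact Function.surjective_id.prodMap QuotientAddGroup.mk_surjective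

theorem IsTest.continuous_partialD {f : Layer → ℝ} (hf : IsTest f) (i : Fin 3) :
    Continuous (partialD i f) := by
  rw [isQuotientMap_cover.continuous_iff]
  have h : partialD i f ∘ cover =
      fun q => fderiv ℝ (fun q : Plane × ℝ => f (cover q)) q (axis i) := by
    funext q
    have hd : DifferentiableAt ℝ (fun q : Plane × ℝ => f (cover q)) q :=
      (hf.smooth.differentiable (by simp)).differentiableAt
    have := hd.lineDeriv_eq_fderiv (v := axis i)
    simp only [lineDeriv, cover_add] at this
    exact this
  rw [h]
  exact (hf.smooth.continuous_fderiv (by simp)).clm_apply continuous_const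

theorem IsTest.hasCompactSupport_partialD {f : Layer → ℝ} (hf : IsTest f) (i : Fin 3) :
    HasCompactSupport (partialD i f) := by
  refine hf.compact.mono' fun p hp => ?_
  by_contra hq
  apply hp
  have h0 : f =ᶠ[nhds p] 0 := notMem_tsupport_iff_eventuallyEq.mp hq
  have hc : Continuous fun s : ℝ => p + cover (s • axis i) :=
    continuous_const.add (continuous_cover.comp (continuous_id.smul continuous_const))
  have ht : Filter.Tendsto (fun s : ℝ => p + cover (s • axis i)) (nhds 0) (nhds p) := by
    have := hc.tendsto 0
    simpa [cover, Prod.mk_zero_zero] using this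
  have h1 : (fun s : ℝ => f (p + cover (s • axis i))) =ᶠ[nhds 0] fun _ => 0 :=
    ht.eventually h0
  simp [partialD, h1.deriv_eq]

theorem IsTest.memLp_gradient {f : Layer → ℝ} (hf : IsTest f) :
    MemLp (gradient f) 2 (volume : Measure Layer) := by
  rw [memLp_piLp_iff]
  intro i
  exact (hf.continuous_partialD i).memLp_of_hasCompactSupport (hf.hasCompactSupport_partialD i)

theorem isDivFree_iff (u : L2Field) : IsDivFree u ↔
    ∀ (f : Layer → ℝ) (hf : IsTest f), ⟪u, hf.memLp_gradient.toLp (gradient f)⟫ = 0 := by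
  refine forall₂_congr fun f hf => ?_
  rw [L2.inner_def]
  have : (fun p => ⟪u p, hf.memLp_gradient.toLp (gradient f) p⟫) =ᵐ[volume]
      fun p => ⟪u p, gradient f p⟫ := by
    filter_upwards [hf.memLp_gradient.coeFn_toLp] with p hp
    rw [hp]
  rw [integral_congr_ae this]

/-- The closed subspace of divergence-free fields in `L²(𝔻)³`. -/
def divFree : ClosedSubmodule ℝ L2Field where
  carrier := {u | IsDivFree u}
  add_mem' {u v} hu hv := by
    simp only [mem_ofPred_eq, isDivFree_iff] at *
    intro f hf
    rw [inner_add_left, hu f hf, hv f hf, add_zero]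
  zero_mem' := by
    simp only [mem_ofPred_eq, isDivFree_iff]
    intro f hf
    rw [inner_zero_left]
  smul_mem' c u hu := by
    simp only [mem_ofPred_eq, isDivFree_iff] at *
    intro f hf
    rw [inner_smul_left, hu f hf, mul_zero]
  isClosed' := by
    have : {u : L2Field | IsDivFree u} = ⋂ (f : Layer → ℝ) (hf : IsTest f),
        {u | ⟪u, hf.memLp_gradient.toLp (gradient f)⟫ = 0} := by
      ext u
      simp [isDivFree_iff]
    show IsClosed {u : L2Field | IsDivFree u}
    rw [this]
    exact isClosed_iInter fun f => isClosed_iInter fun hf =>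
      isClosed_eq (continuous_id.inner continuous_const) continuous_const

/-- The Leray projector: the orthogonal projector in `L²(𝔻)³` onto divergence-free fields. -/
def leray : L2Field →L[ℝ] L2Field := divFree.toSubmodule.starProjection

/-! ### The linear Rossby equation -/

/-- The map `v ↦ e₃ ∧ v` on `ℝ³`. -/
def crossE3 : Vec3 →L[ℝ] Vec3 :=
  LinearMap.toContinuousLinearMap
    ((WithLp.linearEquiv 2 ℝ (Fin 3 → ℝ)).symm.toLinearMap ∘ₗ
      crossProduct ![0, 0, 1] ∘ₗ (WithLp.linearEquiv 2 ℝ (Fin 3 → ℝ)).toLinearMap)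

/-- The Coriolis term `ℙ(e₃ ∧ u)`. -/
def coriolis (u : L2Field) : L2Field := leray (crossE3.compLp u)

/-- `u ∈ C([0,∞), L²(𝔻)³)` is a weak solution of
`∂ₜu + Ω ℙ(e₃ ∧ u) = Δu`, `div u = 0`, `u(0) = u₀`. Only the values `u t` with `0 ≤ t` matter. -/
structure IsSolution (Ω : ℝ) (u₀ : L2Field) (u : ℝ → L2Field) : Prop where
  continuousOn : ContinuousOn u (Ici 0)
  initial : u 0 = u₀
  divFree : ∀ t, 0 ≤ t → IsDivFree (u t)
  equation : ∀ f : Layer → Vec3, IsTest f → ∀ t, 0 < t →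
    HasDerivAt (fun s => ∫ p, ⟪u s p, f p⟫)
      ((∫ p, ⟪u t p, laplacian f p⟫) - Ω * ∫ p, ⟪coriolis (u t) p, f p⟫) t

/-! ### Vertical average and Fourier support -/

/-- The vertical average `(Qu)(x) = ∫ u(x,z) dz`. -/
def verticalAverage (u : L2Field) (x : Plane) : Vec3 := ∫ z : UnitAddCircle, u (x, z)

/-- The `i`-th component of a real field, as an element of the complex space `L²(𝔻)`. -/
def component (i : Fin 3) (u : L2Field) : Lp ℂ 2 (volume : Measure Layer) :=
  (Complex.ofRealCLM ∘L (EuclideanSpace.proj i : Vec3 →L[ℝ] ℝ)).compLp u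

theorem memLp_fourierCoeff (f : Lp ℂ 2 (volume : Measure Layer)) (n : ℤ) :
    MemLp (fun x : Plane => fourierCoeff (fun z : UnitAddCircle => f (x, z)) n) 2 volume := by
  have hv : (volume : Measure UnitAddCircle) = AddCircle.haarAddCircle := by
    rw [AddCircle.volume_eq_smul_haarAddCircle]; simp
  have : IsProbabilityMeasure (volume : Measure UnitAddCircle) := by
    rw [hv]; infer_instance
  have hf := Lp.memLp f
  have hmeas : AEStronglyMeasurable (fun p : Layer => fourier (-n) p.2 • f p) volume :=
    ((map_continuous (fourier (-n))).comp continuous_snd).aestronglyMeasurable.smul hf.1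
  have hm : AEStronglyMeasurable
      (fun x : Plane => fourierCoeff (fun z : UnitAddCircle => f (x, z)) n) volume := by
    simp only [fourierCoeff, ← hv]
    exact hmeas.integral_prod_right'
  refine ⟨hm, ?_⟩
  have hfin := hf.2
  rw [eLpNorm_lt_top_iff_lintegral_rpow_enorm_lt_top (by simp) (by simp)] at hfin ⊢
  refine lt_of_le_of_lt ?_ hfin
  have hn : AEMeasurable (fun p : Layer => ‖f p‖ₑ ^ (2 : ℝ≥0∞).toReal)
      ((volume : Measure Plane).prod (volume : Measure UnitAddCircle)) :=
    (hf.1.enorm.pow_const _)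
  refine le_of_le_of_eq ?_ (lintegral_prod _ hn).symm
  have hsec : ∀ᵐ x : Plane, AEStronglyMeasurable (fun z : UnitAddCircle => f (x, z)) volume :=
    hf.1.prodMk_left
  refine lintegral_mono_ae ?_
  filter_upwards [hsec] with x hx
  have h1 : ‖fourierCoeff (fun z : UnitAddCircle => f (x, z)) n‖ₑ ≤
      eLpNorm (fun z : UnitAddCircle => f (x, z)) 1 volume := by
    rw [eLpNorm_one_eq_lintegral_enorm, fourierCoeff, ← hv]
    refine (enorm_integral_le_lintegral_enorm _).trans (lintegral_mono fun z => ?_)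
    rw [enorm_smul]
    have : ‖fourier (-n) z‖ₑ = 1 := by
      rw [← ofReal_norm, fourier_apply, Circle.norm_coe, ENNReal.ofReal_one]
    rw [this, one_mul]
  have h2 := h1.trans (eLpNorm_le_eLpNorm_of_exponent_le (by norm_num : (1 : ℝ≥0∞) ≤ 2) hx)
  rw [eLpNorm_eq_lintegral_rpow_enorm_toReal (by simp) (by simp)] at h2
  calc _ ≤ _ := ENNReal.rpow_le_rpow h2 (by simp)
    _ = _ := by rw [← ENNReal.rpow_mul]; simp

/-- The `n`-th vertical Fourier mode `x ↦ ∫ f(x,z) e^{-2πinz} dz`, an element of `L²(ℝ²)`. -/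
def verticalMode (f : Lp ℂ 2 (volume : Measure Layer)) (n : ℤ) :
    Lp ℂ 2 (volume : Measure Plane) :=
  (memLp_fourierCoeff f n).toLp _

/-- The Fourier transform on the layer, formally
`fₙ(k) = (2π)⁻¹ ∫∫ f(x,z) e^{-i(k·x + 2πnz)} dz dx`. Here `𝓕` is the Plancherel transform on
`L²(ℝ²)`, which in Mathlib has the kernel `e^{-2πi x·y}`; hence the rescaling `y = k/(2π)`. -/
def layerFourier (f : Lp ℂ 2 (volume : Measure Layer)) (n : ℤ) (k : Plane) : ℂ :=
  ((2 * Real.pi)⁻¹ : ℝ) * (𝓕 (verticalMode f n)) ((2 * Real.pi)⁻¹ • k)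

/-- The ball `{(k,n) ∈ ℝ² × ℤ : √(|k|² + 4π²n²) ≤ R}`. -/
def fourierBall (R : ℝ) : Set (Plane × ℤ) :=
  {q | Real.sqrt (‖q.1‖ ^ 2 + 4 * Real.pi ^ 2 * (q.2 : ℝ) ^ 2) ≤ R}

/-- The Fourier transform of `u` is supported in the (closed) ball of radius `R`, i.e. vanishes
almost everywhere outside of it. -/
def FourierSupportedIn (R : ℝ) (u : L2Field) : Prop :=
  ∀ (i : Fin 3) (n : ℤ), ∀ᵐ k : Plane, (k, n) ∉ fourierBall R →
    layerFourier (component i u) n k = 0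

end Rossby

end

open MeasureTheory Set
open scoped ContDiff ENNReal FourierTransform RealInnerProductSpace

noncomputable section

namespace Rossby

/-! ### The Fourier transform on `L¹ ∩ L²` -/

section Fourier

variable {V : Type*} [NormedAddCommGroup V] [InnerProductSpace ℝ V] [FiniteDimensional ℝ V]
  [MeasurableSpace V] [BorelSpace V]

/-! In Fourier variables the equation decouples over the frequencies `ξ = (y, n)`, with wave vector
`2πξ`. On vectors orthogonal to `ξ` the Coriolis term `ℙ(e₃ ∧ ·)` is `(n/|ξ|²) ξ × ·`. Its
eigenvectors there are the two circular polarizations `σ = ±1`, with eigenvalues `-iσn/|ξ|`. The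
solution is therefore a sum of waves `exp(t(iβ/|ξ| - 4π²|ξ|²))` with `β = σΩn` (`cross_polarVec`,
`sum_proj_crossHat`, `isSolution_polarWave`). The vanishing vertical average removes `n = 0`, and
the support condition leaves finitely many `n` and bounded `y`. Hence `|β| ≥ |Ω|`, and the damping
is at least exponential in time.

The decay comes from dispersion of the phase `τ(n² + |y|²)^{-1/2}`. For a given point `x`, rotate
the plane so that `y·x` depends on one coordinate only. The integral over the other coordinate has a
single nondegenerate stationary point and is `O(|τ|^{-1/2})`, uniformly in `x`
(`norm_integral_oscAmp_le`, `norm_integral_fourierChar_oscAmp_le`).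

To reach `L¹` in time and `L^∞` in space, the supremum over `x` is replaced by evaluation along an
arbitrary measurable path `t ↦ X(t)` (`lintegral_iSup_le_of_path`). A `TT*` argument
(`norm_integral_integral_le`) then needs only the double integral of `|β(t-s)|^{-1/2} e^{-(t+s)}`.
This is a finite multiple of `|β|^{-1/2}`, and the square root inherent in `TT*` produces the
exponent `-1/4` (`lintegral_waveAt_path_le`).

Uniqueness is a separate argument for `L²`-valued weak solutions. Test fields with one vertical mode
give the equation for each Fourier coefficient. A resolvent makes the Laplacian bounded, so that the
equation holds in integrated form in `L²`. After a cutoff in `y` it becomes a linear ODE with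
bounded generator, and zero data give the zero solution (`IsSolution.resolvent_hat_eq`,
`IsSolution.eq_zero`). -/

theorem integral_fourier_mul_eq_flip {f g : V → ℂ} (hf : Integrable f) (hg : Integrable g) :
    ∫ y, 𝓕 f y * g y = ∫ x, f x * 𝓕 g x := by
  have := VectorFourier.integral_fourierIntegral_smul_eq_flip (μ := (volume : Measure V))
    (ν := (volume : Measure V)) (L := innerₗ V) Real.continuous_fourierChar
    (by simpa using continuous_inner) hf hg
  rw [flip_innerₗ] at this
  exact this

theorem schwartz_integral_eq_zero_ae_eq_zero {H : V → ℂ} (hH : LocallyIntegrable H)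
    (h : ∀ φ : SchwartzMap V ℂ, ∫ y, φ y * H y = 0) : H =ᵐ[volume] 0 := by
  apply ae_eq_zero_of_integral_contDiff_smul_eq_zero hH
  intro g hg hc
  have hg₁ : HasCompactSupport (Complex.ofRealCLM ∘ g) := hc.comp_left rfl
  have hg₂ : ContDiff ℝ ∞ (Complex.ofRealCLM ∘ g) := by fun_prop
  have := h (hg₁.toSchwartzMap hg₂)
  simpa using this

/-- A function in `L¹` with zero Fourier transform vanishes. -/
theorem ae_eq_zero_of_fourier_eq_zero {H : V → ℂ} (hH : Integrable H) (h : ∀ x, 𝓕 H x = 0) :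
    H =ᵐ[volume] 0 := by
  refine schwartz_integral_eq_zero_ae_eq_zero hH.locallyIntegrable fun φ => ?_
  have h1 := integral_fourier_mul_eq_flip ((𝓕⁻ φ : SchwartzMap V ℂ).integrable) hH
  rw [← SchwartzMap.fourier_coe] at h1
  simpa [h] using h1

/-- Both transforms pass onto a Schwartz function under the integral sign, one by the distributional
definition and the other by Fubini. Their difference is thus locally integrable and annihilates
every Schwartz function. -/
theorem fourier_toLp_ae {f : V → ℂ} (h1 : Integrable f) (h2 : MemLp f 2) :
    (𝓕 (h2.toLp f) : Lp ℂ 2 (volume : Measure V)) =ᵐ[volume] 𝓕 f := by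
  have hc : Continuous (𝓕 f) :=
    VectorFourier.fourierIntegral_continuous Real.continuous_fourierChar
      (by simpa using continuous_inner) h1
  have hl : LocallyIntegrable (𝓕 (h2.toLp f) : Lp ℂ 2 (volume : Measure V)) :=
    (Lp.memLp _).locallyIntegrable (by norm_num)
  have hz : (fun y => (𝓕 (h2.toLp f) : Lp ℂ 2 (volume : Measure V)) y - 𝓕 f y) =ᵐ[volume] 0 := by
    refine schwartz_integral_eq_zero_ae_eq_zero (hl.sub hc.locallyIntegrable) fun φ => ?_
    have e1 : ∫ y, φ y * (𝓕 (h2.toLp f) : Lp ℂ 2 (volume : Measure V)) y =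
        ∫ y, 𝓕 (φ : V → ℂ) y * f y := by
      have := congrArg (fun T => T φ) (Lp.fourier_toTemperedDistribution_eq (h2.toLp f))
      simp only [TemperedDistribution.fourier_apply, Lp.toTemperedDistribution_apply,
        smul_eq_mul] at this
      rw [← this, SchwartzMap.fourier_coe]
      refine integral_congr_ae ?_
      filter_upwards [h2.coeFn_toLp] with y hy
      rw [hy]
    have e2 := integral_fourier_mul_eq_flip φ.integrable h1
    have i1 : Integrable (fun y => φ y * (𝓕 (h2.toLp f) : Lp ℂ 2 (volume : Measure V)) y) :=
      (Lp.memLp (𝓕 (h2.toLp f))).integrable_mul (φ.memLp 2)|>.congr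
        (Filter.Eventually.of_forall fun y => mul_comm _ _)
    have i2 : Integrable (fun y => φ y * 𝓕 f y) := by
      refine (φ.integrable).mul_bdd (c := ∫ x, ‖f x‖) hc.aestronglyMeasurable ?_
      exact Filter.Eventually.of_forall fun y =>
        VectorFourier.norm_fourierIntegral_le_integral_norm _ _ _ _ _
    simp_rw [mul_sub]
    rw [integral_sub i1 i2, e1, e2, sub_self]
  filter_upwards [hz] with y hy
  exact sub_eq_zero.mp (by simpa using hy)

theorem integral_fourierInv_mul_eq_flip {f g : V → ℂ} (hf : Integrable f) (hg : Integrable g) :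
    ∫ y, 𝓕⁻ f y * g y = ∫ x, f x * 𝓕⁻ g x := by
  rw [Real.fourierInv_eq_fourier_comp_neg g, ← integral_fourier_mul_eq_flip hf hg.comp_neg,
    ← integral_neg_eq_self]
  simp [Real.fourierInv_eq_fourier_neg]

theorem fourierInv_toLp_ae {f : V → ℂ} (h1 : Integrable f) (h2 : MemLp f 2) :
    (𝓕⁻ (h2.toLp f) : Lp ℂ 2 (volume : Measure V)) =ᵐ[volume] 𝓕⁻ f := by
  have hc : Continuous (𝓕⁻ f) := by
    rw [Real.fourierInv_eq_fourier_comp_neg]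
    exact VectorFourier.fourierIntegral_continuous Real.continuous_fourierChar
      (by simpa using continuous_inner) h1.comp_neg
  have hl : LocallyIntegrable (𝓕⁻ (h2.toLp f) : Lp ℂ 2 (volume : Measure V)) :=
    (Lp.memLp _).locallyIntegrable (by norm_num)
  have hz : (fun y => (𝓕⁻ (h2.toLp f) : Lp ℂ 2 (volume : Measure V)) y - 𝓕⁻ f y)
      =ᵐ[volume] 0 := by
    refine schwartz_integral_eq_zero_ae_eq_zero (hl.sub hc.locallyIntegrable) fun φ => ?_
    have e1 : ∫ y, φ y * (𝓕⁻ (h2.toLp f) : Lp ℂ 2 (volume : Measure V)) y =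
        ∫ y, 𝓕⁻ (φ : V → ℂ) y * f y := by
      have := congrArg (fun T => T φ) (Lp.fourierInv_toTemperedDistribution_eq (h2.toLp f))
      simp only [TemperedDistribution.fourierInv_apply, Lp.toTemperedDistribution_apply,
        smul_eq_mul] at this
      rw [← this, SchwartzMap.fourierInv_coe]
      refine integral_congr_ae ?_
      filter_upwards [h2.coeFn_toLp] with y hy
      rw [hy]
    have e2 := integral_fourierInv_mul_eq_flip φ.integrable h1
    have i1 : Integrable (fun y => φ y * (𝓕⁻ (h2.toLp f) : Lp ℂ 2 (volume : Measure V)) y) :=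
      (Lp.memLp (𝓕⁻ (h2.toLp f))).integrable_mul (φ.memLp 2)|>.congr
        (Filter.Eventually.of_forall fun y => mul_comm _ _)
    have i2 : Integrable (fun y => φ y * 𝓕⁻ f y) := by
      refine (φ.integrable).mul_bdd (c := ∫ x, ‖f x‖) hc.aestronglyMeasurable ?_
      refine Filter.Eventually.of_forall fun y => ?_
      rw [Real.fourierInv_eq_fourier_neg]
      exact VectorFourier.norm_fourierIntegral_le_integral_norm _ _ _ _ _
    simp_rw [mul_sub]
    rw [integral_sub i1 i2, e1, e2, sub_self]
  filter_upwards [hz] with y hy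
  exact sub_eq_zero.mp (by simpa using hy)

end Fourier

/-! ### Multiplication operators on `L²` -/

section Multiplication

variable {V : Type*} [MeasureSpace V]

/-- Bounded measurable symbols. -/
def IsSymbol (m : V → ℂ) : Prop := Measurable m ∧ ∃ C : ℝ, ∀ y, ‖m y‖ ≤ C

theorem IsSymbol.memLp_mul {m : V → ℂ} (hm : IsSymbol m) (g : Lp ℂ 2 (volume : Measure V)) :
    MemLp (fun y => m y * g y) 2 := by
  obtain ⟨hm, C, hC⟩ := hm
  exact (Lp.memLp g).of_le_mul (c := C) (hm.aestronglyMeasurable.mul (Lp.memLp g).1)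
    (Filter.Eventually.of_forall fun y => by
      rw [norm_mul]; exact mul_le_mul_of_nonneg_right (hC y) (norm_nonneg _))

theorem IsSymbol.norm_toLp_le {m : V → ℂ} (hm : IsSymbol m) (g : Lp ℂ 2 (volume : Measure V))
    {C : ℝ} (hC : ∀ y, ‖m y‖ ≤ C) : ‖(hm.memLp_mul g).toLp _‖ ≤ C * ‖g‖ := by
  refine Lp.norm_le_mul_norm_of_ae_le_mul ?_
  filter_upwards [(hm.memLp_mul g).coeFn_toLp] with y hy
  rw [hy, norm_mul]
  exact mul_le_mul_of_nonneg_right (hC y) (norm_nonneg _)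

open Classical in
/-- Multiplication by a bounded measurable symbol, as an operator on `L²`
(zero if `m` is not such a symbol). -/
def mulOp (m : V → ℂ) : Lp ℂ 2 (volume : Measure V) →L[ℂ] Lp ℂ 2 (volume : Measure V) :=
  if hm : IsSymbol m then
    LinearMap.mkContinuous
      { toFun := fun g => (hm.memLp_mul g).toLp _
        map_add' := fun f g => by
          ext1
          filter_upwards [(hm.memLp_mul f).coeFn_toLp, (hm.memLp_mul g).coeFn_toLp,
            (hm.memLp_mul (f + g)).coeFn_toLp, Lp.coeFn_add f g,
            Lp.coeFn_add ((hm.memLp_mul f).toLp _) ((hm.memLp_mul g).toLp _)] with y h1 h2 h3 h4 h5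
          rw [h3, h5, Pi.add_apply, h1, h2, h4, Pi.add_apply, mul_add]
        map_smul' := fun c f => by
          ext1
          filter_upwards [(hm.memLp_mul f).coeFn_toLp, (hm.memLp_mul (c • f)).coeFn_toLp,
            Lp.coeFn_smul c f, Lp.coeFn_smul c ((hm.memLp_mul f).toLp _)] with y h1 h2 h3 h4
          rw [h2, RingHom.id_apply, h4, Pi.smul_apply, h1, h3, Pi.smul_apply, smul_eq_mul,
            smul_eq_mul]
          ring }
      hm.2.choose (fun g => hm.norm_toLp_le g hm.2.choose_spec)
  else 0

theorem mulOp_ae {m : V → ℂ} (hm : IsSymbol m) (g : Lp ℂ 2 (volume : Measure V)) :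
    mulOp m g =ᵐ[volume] fun y => m y * g y := by
  rw [mulOp, dif_pos hm]
  exact (hm.memLp_mul g).coeFn_toLp

theorem norm_mulOp_le {m : V → ℂ} (hm : IsSymbol m) {C : ℝ} (h0 : 0 ≤ C) (hC : ∀ y, ‖m y‖ ≤ C) :
    ‖mulOp m‖ ≤ C := by
  refine ContinuousLinearMap.opNorm_le_bound _ h0 fun g => ?_
  rw [mulOp, dif_pos hm]
  exact hm.norm_toLp_le g hC

theorem inner_mulOp {m : V → ℂ} (hm : IsSymbol m) (f g : Lp ℂ 2 (volume : Measure V)) :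
    inner ℂ (mulOp m f) g = ∫ y, starRingEnd ℂ (m y) * inner ℂ (f y) (g y) := by
  rw [L2.inner_def]
  refine integral_congr_ae ?_
  filter_upwards [mulOp_ae hm f] with y hy
  rw [hy]
  simp only [RCLike.inner_apply, map_mul]
  ring

theorem IsSymbol.mul {m m' : V → ℂ} (hm : IsSymbol m) (hm' : IsSymbol m') :
    IsSymbol (fun y => m y * m' y) := by
  obtain ⟨h, C, hC⟩ := hm
  obtain ⟨h', C', hC'⟩ := hm'
  refine ⟨h.mul h', C * C', fun y => ?_⟩
  rw [norm_mul]
  exact mul_le_mul (hC y) (hC' y) (norm_nonneg _) ((norm_nonneg _).trans (hC y))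

theorem IsSymbol.conj {m : V → ℂ} (hm : IsSymbol m) :
    IsSymbol (fun y => starRingEnd ℂ (m y)) := by
  obtain ⟨h, C, hC⟩ := hm
  exact ⟨Complex.continuous_conj.measurable.comp h, C, fun y => by simpa using hC y⟩

theorem inner_mulOp_right {m : V → ℂ} (hm : IsSymbol m) (f g : Lp ℂ 2 (volume : Measure V)) :
    inner ℂ f (mulOp m g) = inner ℂ (mulOp (fun y => starRingEnd ℂ (m y)) f) g := by
  rw [inner_mulOp hm.conj, L2.inner_def]
  refine integral_congr_ae ?_
  filter_upwards [mulOp_ae hm g] with y hy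
  rw [hy]
  simp only [RCLike.inner_apply, Complex.conj_conj]
  ring

end Multiplication

/-! ### Vertical modes -/

theorem volume_unitAddCircle :
    (volume : Measure UnitAddCircle) = AddCircle.haarAddCircle := by
  rw [AddCircle.volume_eq_smul_haarAddCircle]; simp

instance isProbabilityMeasure_unitAddCircle :
    IsProbabilityMeasure (volume : Measure UnitAddCircle) := by
  rw [volume_unitAddCircle]; infer_instance

theorem norm_fourier_apply (n : ℤ) (z : UnitAddCircle) : ‖fourier n z‖ = 1 := by
  rw [fourier_apply, Circle.norm_coe]

theorem isSymbol_fourier (n : ℤ) : IsSymbol (fun p : Layer => fourier n p.2) :=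
  ⟨((map_continuous (fourier n)).comp continuous_snd).measurable, 1, fun p =>
    (norm_fourier_apply n p.2).le⟩

theorem measurePreserving_fst_layer :
    MeasurePreserving (Prod.fst : Layer → Plane) volume volume :=
  measurePreserving_fst (μ := (volume : Measure Plane)) (ν := (volume : Measure UnitAddCircle))

theorem integral_layer {F : Type*} [NormedAddCommGroup F] [NormedSpace ℝ F] {f : Layer → F}
    (hf : Integrable f) : ∫ p, f p = ∫ x, ∫ z, f (x, z) :=
  integral_prod f hf

theorem lintegral_layer {f : Layer → ℝ≥0∞} (hf : AEMeasurable f) :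
    ∫⁻ p, f p = ∫⁻ x, ∫⁻ z, f (x, z) :=
  lintegral_prod f hf

/-- The map `h ↦ h(x) e^{2πinz}`. -/
def modeLift (n : ℤ) : Lp ℂ 2 (volume : Measure Plane) →L[ℂ] Lp ℂ 2 (volume : Measure Layer) :=
  mulOp (fun p : Layer => fourier n p.2) ∘L
    (Lp.compMeasurePreservingₗᵢ ℂ Prod.fst measurePreserving_fst_layer).toContinuousLinearMap

theorem modeLift_ae (n : ℤ) (h : Lp ℂ 2 (volume : Measure Plane)) :
    modeLift n h =ᵐ[volume] fun p => fourier n p.2 * h p.1 := by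
  filter_upwards [mulOp_ae (isSymbol_fourier n)
    (Lp.compMeasurePreserving Prod.fst measurePreserving_fst_layer h),
    Lp.coeFn_compMeasurePreserving h measurePreserving_fst_layer] with p h1 h2
  refine h1.trans ?_
  rw [h2, Function.comp]

theorem norm_modeLift_le (n : ℤ) : ‖modeLift n‖ ≤ 1 := by
  refine (ContinuousLinearMap.opNorm_comp_le _ _).trans ?_
  refine mul_le_one₀ (norm_mulOp_le (isSymbol_fourier n) zero_le_one fun p =>
    (norm_fourier_apply n p.2).le) (norm_nonneg _) ?_
  exact LinearIsometry.norm_toContinuousLinearMap_le _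

theorem inner_modeLift (n : ℤ) (h : Lp ℂ 2 (volume : Measure Plane))
    (f : Lp ℂ 2 (volume : Measure Layer)) :
    inner ℂ (modeLift n h) f = inner ℂ h (verticalMode f n) := by
  have hi : Integrable (fun p : Layer => f p * starRingEnd ℂ (fourier n p.2 * h p.1)) := by
    refine (L2.integrable_inner (𝕜 := ℂ) (modeLift n h) f).congr ?_
    filter_upwards [modeLift_ae n h] with p hp
    rw [hp, RCLike.inner_apply]
  have e1 : inner ℂ (modeLift n h) f =
      ∫ p : Layer, f p * starRingEnd ℂ (fourier n p.2 * h p.1) := by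
    rw [L2.inner_def]
    refine integral_congr_ae ?_
    filter_upwards [modeLift_ae n h] with p hp
    rw [hp, RCLike.inner_apply]
  rw [e1, integral_layer hi, L2.inner_def]
  refine integral_congr_ae ?_
  filter_upwards [(memLp_fourierCoeff f n).coeFn_toLp] with x hx
  rw [verticalMode, hx, RCLike.inner_apply, fourierCoeff, ← volume_unitAddCircle,
    ← integral_mul_const]
  congr 1
  funext z
  simp only [map_mul, fourier_neg, smul_eq_mul]
  ring

/-- Seen as an adjoint, the mode is linear and bounded in `f` without any further work on integrals
over fibres. -/
theorem verticalMode_eq_adjoint (f : Lp ℂ 2 (volume : Measure Layer)) (n : ℤ) :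
    verticalMode f n = ContinuousLinearMap.adjoint (modeLift n) f := by
  refine ext_inner_left ℂ fun h => ?_
  rw [ContinuousLinearMap.adjoint_inner_right, inner_modeLift]

theorem integral_fourier_mul_conj (m n : ℤ) :
    ∫ z : UnitAddCircle, fourier n z * starRingEnd ℂ (fourier m z) = if n = m then 1 else 0 := by
  have h := fourierCoeff_fourier (T := 1) n
  have h1 := congrFun h m
  rw [fourierCoeff, ← volume_unitAddCircle] at h1
  simp only [fourier_neg, smul_eq_mul, Pi.single_apply] at h1
  simp_rw [eq_comm (a := n)]
  rw [← h1]
  congr 1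
  funext z
  ring

theorem verticalMode_modeLift (m n : ℤ) (h : Lp ℂ 2 (volume : Measure Plane)) :
    verticalMode (modeLift n h) m = if n = m then h else 0 := by
  refine ext_inner_left ℂ fun g => ?_
  rw [← inner_modeLift, L2.inner_def]
  have e : (∫ p, inner ℂ (modeLift m g p) (modeLift n h p)) = ∫ p : Layer,
      (h p.1 * starRingEnd ℂ (g p.1)) * (fourier n p.2 * starRingEnd ℂ (fourier m p.2)) := by
    refine integral_congr_ae ?_
    filter_upwards [modeLift_ae m g, modeLift_ae n h] with p h1 h2
    rw [h1, h2, RCLike.inner_apply, map_mul]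
    ring
  rw [e, Measure.volume_eq_prod]
  rw [integral_prod_mul (fun x : Plane => h x * starRingEnd ℂ (g x))
    (fun z : UnitAddCircle => fourier n z * starRingEnd ℂ (fourier m z)),
    integral_fourier_mul_conj]
  split_ifs with hnm
  · rw [L2.inner_def, mul_one]; rfl
  · simp

theorem ae_memLp_section {F : Type*} [NormedAddCommGroup F]
    {f : Layer → F} (hf : MemLp f 2) :
    ∀ᵐ x : Plane, MemLp (fun z : UnitAddCircle => f (x, z)) 2 := by
  have hsec : ∀ᵐ x : Plane, AEStronglyMeasurable (fun z : UnitAddCircle => f (x, z)) volume :=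
    hf.1.prodMk_left
  have hfin := hf.2
  rw [eLpNorm_lt_top_iff_lintegral_rpow_enorm_lt_top (by simp) (by simp)] at hfin
  have hn : AEMeasurable (fun p : Layer => ‖f p‖ₑ ^ (2 : ℝ≥0∞).toReal)
      ((volume : Measure Plane).prod (volume : Measure UnitAddCircle)) :=
    (hf.1.enorm.pow_const _)
  rw [Measure.volume_eq_prod, lintegral_prod _ hn] at hfin
  have := ae_lt_top' hn.lintegral_prod_right' hfin.ne
  filter_upwards [hsec, this] with x h1 h2
  refine ⟨h1, ?_⟩
  rw [eLpNorm_lt_top_iff_lintegral_rpow_enorm_lt_top (by simp) (by simp)]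
  exact h2

theorem ae_eq_zero_of_fourierCoeff_eq_zero {g : UnitAddCircle → ℂ} (hg : MemLp g 2)
    (h : ∀ n, fourierCoeff g n = 0) : g =ᵐ[volume] 0 := by
  rw [volume_unitAddCircle] at hg ⊢
  have h0 : hg.toLp g = 0 := by
    apply (fourierBasis (T := 1)).repr.injective
    rw [map_zero]
    ext n
    rw [fourierBasis_repr]
    exact (congrFun (fourierCoeff_congr_ae hg.coeFn_toLp) n).trans (h n)
  exact hg.coeFn_toLp.symm.trans (by rw [h0]; exact Lp.coeFn_zero _ _ _)

/-- Almost every vertical fibre is square integrable by Tonelli, and all its Fourier coefficients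
vanish because there are only countably many `n`. Completeness of the Fourier basis on the circle
kills each fibre. -/
theorem eq_zero_of_verticalMode_eq_zero {f : Lp ℂ 2 (volume : Measure Layer)}
    (h : ∀ n, verticalMode f n = 0) : f = 0 := by
  have h1 : ∀ᵐ x : Plane, ∀ n, fourierCoeff (fun z : UnitAddCircle => f (x, z)) n = 0 := by
    rw [ae_all_iff]
    intro n
    have := (memLp_fourierCoeff f n).coeFn_toLp
    change verticalMode f n =ᵐ[volume] _ at this
    rw [h n] at this
    filter_upwards [this, Lp.coeFn_zero ℂ 2 (volume : Measure Plane)] with x h1 h2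
    rw [← h1, h2]; rfl
  rw [Lp.eq_zero_iff_ae_eq_zero]
  have hn : AEMeasurable (fun p : Layer => ‖f p‖ₑ) := (Lp.memLp f).1.enorm
  have h2 : ∫⁻ p : Layer, ‖f p‖ₑ = 0 := by
    rw [lintegral_layer hn, lintegral_eq_zero_iff' (AEMeasurable.lintegral_prod_right'
      (μ := (volume : Measure Plane)) (ν := (volume : Measure UnitAddCircle)) hn)]
    filter_upwards [h1, ae_memLp_section (Lp.memLp f)] with x h3 h4
    have := ae_eq_zero_of_fourierCoeff_eq_zero h4 h3
    rw [lintegral_congr_ae (g := 0)]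
    · simp
    · filter_upwards [this] with z hz
      simp [hz]
  rw [lintegral_eq_zero_iff' hn] at h2
  filter_upwards [h2] with p hp
  simpa using hp

/-- A field with finitely many vertical modes is the sum of these modes. -/
theorem sum_modeLift_verticalMode {f : Lp ℂ 2 (volume : Measure Layer)} (s : Finset ℤ)
    (h : ∀ n ∉ s, verticalMode f n = 0) : ∑ n ∈ s, modeLift n (verticalMode f n) = f := by
  rw [eq_comm, ← sub_eq_zero]
  refine eq_zero_of_verticalMode_eq_zero fun m => ?_
  rw [verticalMode_eq_adjoint, map_sub, map_sum, ← verticalMode_eq_adjoint]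
  simp_rw [← verticalMode_eq_adjoint, verticalMode_modeLift]
  rw [Finset.sum_ite_eq']
  split_ifs with hm
  · simp
  · rw [h m hm, sub_zero]

/-! ### Fields from their Fourier coefficients, and back -/

/-- The Fourier coefficient `k ↦ (uᵢ)ₙ(2πk)` of a real field. -/
def hat (n : ℤ) (i : Fin 3) (u : L2Field) : Lp ℂ 2 (volume : Measure Plane) :=
  𝓕 (verticalMode (component i u) n)

/-- The real field `Re (e^{2πinz} 𝓕⁻h(x))` in direction `i`. -/
def embed (n : ℤ) (i : Fin 3) : Lp ℂ 2 (volume : Measure Plane) →L[ℝ] L2Field :=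
  ((Complex.reCLM.smulRight (EuclideanSpace.single i (1 : ℝ) : Vec3)).compLpL 2 volume) ∘L
    ((modeLift n ∘L FourierTransform.fourierInvCLM ℂ
      (Lp ℂ 2 (volume : Measure Plane))).restrictScalars ℝ)

theorem embed_apply (n : ℤ) (i : Fin 3) (h : Lp ℂ 2 (volume : Measure Plane)) :
    embed n i h = (Complex.reCLM.smulRight (EuclideanSpace.single i (1 : ℝ) : Vec3)).compLp
      (modeLift n (𝓕⁻ h)) := rfl

theorem embed_ae (n : ℤ) (i : Fin 3) (h : Lp ℂ 2 (volume : Measure Plane)) :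
    embed n i h =ᵐ[volume] fun p =>
      (fourier n p.2 * (𝓕⁻ h : Lp ℂ 2 (volume : Measure Plane)) p.1).re •
        (EuclideanSpace.single i (1 : ℝ) : Vec3) := by
  filter_upwards [modeLift_ae n (𝓕⁻ h), ContinuousLinearMap.coeFn_compLp
    (Complex.reCLM.smulRight (EuclideanSpace.single i (1 : ℝ) : Vec3))
      (modeLift n (𝓕⁻ h))] with p h1 h2
  rw [embed_apply, h2, h1]
  simp

theorem component_ae (i : Fin 3) (u : L2Field) :
    component i u =ᵐ[volume] fun p => ((u p i : ℝ) : ℂ) := by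
  filter_upwards [ContinuousLinearMap.coeFn_compLp
    (Complex.ofRealCLM ∘L (EuclideanSpace.proj i : Vec3 →L[ℝ] ℝ)) u] with p hp
  rw [component, hp]
  simp

/-- `hat` as a continuous real-linear map. -/
def hatL (n : ℤ) (i : Fin 3) : L2Field →L[ℝ] Lp ℂ 2 (volume : Measure Plane) :=
  ((FourierTransform.fourierCLM ℂ (Lp ℂ 2 (volume : Measure Plane)) ∘L
      ContinuousLinearMap.adjoint (modeLift n)).restrictScalars ℝ) ∘L
    ((Complex.ofRealCLM ∘L (EuclideanSpace.proj i : Vec3 →L[ℝ] ℝ)).compLpL 2 volume)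

theorem hatL_apply (n : ℤ) (i : Fin 3) (u : L2Field) : hatL n i u = hat n i u := by
  rw [hat, verticalMode_eq_adjoint]; rfl

theorem inner_single_compLp (i : Fin 3) (F : Lp ℂ 2 (volume : Measure Layer)) (v : L2Field) :
    ⟪(Complex.reCLM.smulRight (EuclideanSpace.single i (1 : ℝ) : Vec3)).compLp F, v⟫ =
      (inner ℂ F (component i v)).re := by
  rw [L2.inner_def, L2.inner_def]
  have := integral_re (𝕜 := ℂ) (L2.integrable_inner (𝕜 := ℂ) F (component i v))
  refine Eq.trans ?_ this
  refine integral_congr_ae ?_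
  filter_upwards [component_ae i v, ContinuousLinearMap.coeFn_compLp
    (Complex.reCLM.smulRight (EuclideanSpace.single i (1 : ℝ) : Vec3)) F] with p h1 h2
  rw [h1, h2]
  simp [inner_smul_left, EuclideanSpace.inner_single_left, RCLike.inner_apply]
  ring

/-- By Plancherel, `embed` is the real adjoint of `hat`. Statements about divergence, the Leray
projector and the weak equation pass to Fourier variables through this identity. -/
theorem inner_embed (n : ℤ) (i : Fin 3) (h : Lp ℂ 2 (volume : Measure Plane)) (v : L2Field) :
    ⟪embed n i h, v⟫ = (inner ℂ h (hat n i v)).re := by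
  rw [embed_apply, inner_single_compLp, inner_modeLift, hat,
    ← Lp.inner_fourier_eq (𝓕⁻ h), FourierTransform.fourier_fourierInv_eq]

theorem norm_hat_le (n : ℤ) (i : Fin 3) (u : L2Field) : ‖hat n i u‖ ≤ ‖u‖ := by
  rw [hat, Lp.norm_fourier_eq, verticalMode_eq_adjoint]
  have h1 : ‖ContinuousLinearMap.adjoint (modeLift n)‖ ≤ 1 := by
    rw [LinearIsometryEquiv.norm_map]; exact norm_modeLift_le n
  refine (ContinuousLinearMap.le_of_opNorm_le _ h1 _).trans ?_
  rw [one_mul]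
  refine Lp.norm_le_norm_of_ae_le ?_
  filter_upwards [component_ae i u] with p hp
  rw [hp, Complex.norm_real]
  exact PiLp.norm_apply_le _ _

theorem eq_zero_of_component_eq_zero {u : L2Field} (h : ∀ i, component i u = 0) : u = 0 := by
  rw [Lp.eq_zero_iff_ae_eq_zero]
  have : ∀ᵐ p : Layer, ∀ i, ((u p i : ℝ) : ℂ) = 0 := by
    rw [ae_all_iff]
    intro i
    have h1 := component_ae i u
    rw [h i] at h1
    filter_upwards [h1, Lp.coeFn_zero ℂ 2 (volume : Measure Layer)] with p h2 h3
    rw [← h2, h3]; rfl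
  filter_upwards [this] with p hp
  ext i
  simpa using hp i

theorem eq_zero_of_hat_eq_zero {u : L2Field} (h : ∀ n i, hat n i u = 0) : u = 0 := by
  refine eq_zero_of_component_eq_zero fun i => eq_zero_of_verticalMode_eq_zero fun n => ?_
  rw [← norm_eq_zero, ← Lp.norm_fourier_eq]
  change ‖hat n i u‖ = 0
  rw [h, norm_zero]

/-- No symmetry between the modes `n` and `-n` has to be imposed: the complex sum over `s` is
already `component i u`, and taking real parts commutes with the sum. The identity is checked
against an arbitrary field `v`. -/
theorem sum_embed_hat {u : L2Field} (s : Finset ℤ) (h : ∀ n ∉ s, ∀ i, hat n i u = 0) :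
    ∑ n ∈ s, ∑ i, embed n i (hat n i u) = u := by
  refine ext_inner_right ℝ fun v => ?_
  have h0 : ∀ i, ∀ n ∉ s, verticalMode (component i u) n = 0 := fun i n hn => by
    rw [← norm_eq_zero, ← Lp.norm_fourier_eq]
    change ‖hat n i u‖ = 0
    rw [h n hn, norm_zero]
  rw [Finset.sum_comm, sum_inner]
  have h1 : ∀ i, ⟪∑ n ∈ s, embed n i (hat n i u), v⟫ =
      (inner ℂ (component i u) (component i v)).re := fun i => by
    conv_rhs => rw [← sum_modeLift_verticalMode s (h0 i)]
    rw [sum_inner, sum_inner, Complex.re_sum]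
    refine Finset.sum_congr rfl fun n _ => ?_
    rw [inner_embed, inner_modeLift, hat, hat, Lp.inner_fourier_eq]
  simp_rw [h1, L2.inner_def]
  have h2 : ∀ i, (∫ p, inner ℂ (component i u p) (component i v p)).re =
      ∫ p, u p i * v p i := fun i => by
    refine (integral_re (𝕜 := ℂ)
      (L2.integrable_inner (𝕜 := ℂ) (component i u) (component i v))).symm.trans ?_
    refine integral_congr_ae ?_
    filter_upwards [component_ae i u, component_ae i v] with p h1 h2
    rw [h1, h2]
    simp [RCLike.inner_apply, mul_comm]
  simp_rw [h2]
  rw [← integral_finsetSum]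
  · congr 1
    funext p
    simp [PiLp.inner_apply, mul_comm]
  · intro i _
    refine ((L2.integrable_inner (𝕜 := ℂ) (component i u) (component i v)).re).congr ?_
    filter_upwards [component_ae i u, component_ae i v] with p h1 h2
    rw [h1, h2]
    simp [RCLike.inner_apply, mul_comm]

/-- A bound for the sup norm of a field with one vertical mode. -/
theorem eLpNorm_embed_le (n : ℤ) (i : Fin 3) {h : Lp ℂ 2 (volume : Measure Plane)}
    (h1 : Integrable h) {B : ℝ≥0∞} (hB : ∀ x : Plane, ‖𝓕⁻ (h : Plane → ℂ) x‖ₑ ≤ B) :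
    eLpNorm (embed n i h) ∞ (volume : Measure Layer) ≤ B := by
  rw [eLpNorm_exponent_top]
  refine eLpNormEssSup_le_of_ae_enorm_bound ?_
  have h2 := fourierInv_toLp_ae h1 (Lp.memLp h)
  rw [Lp.toLp_coeFn] at h2
  have h3 : ∀ᵐ p : Layer, (𝓕⁻ h : Lp ℂ 2 (volume : Measure Plane)) p.1 =
      𝓕⁻ (h : Plane → ℂ) p.1 :=
    measurePreserving_fst_layer.quasiMeasurePreserving.ae h2
  filter_upwards [embed_ae n i h, h3] with p h4 h5
  rw [h4, h5]
  refine le_trans ?_ (hB p.1)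
  rw [enorm_le_iff_norm_le, norm_smul]
  simp only [PiLp.norm_single, norm_one, mul_one, Real.norm_eq_abs]
  refine (Complex.abs_re_le_norm _).trans ?_
  rw [norm_mul, norm_fourier_apply, one_mul]

/-! ### Calculus of test functions -/

section TestCalculus

variable {F G : Type*} [NormedAddCommGroup F] [NormedSpace ℝ F] [NormedAddCommGroup G]
  [NormedSpace ℝ G]

theorem cover_surjective : Function.Surjective cover := isQuotientMap_cover.surjective

theorem IsTest.hasDerivAt {f : Layer → F} (hf : IsTest f) (i : Fin 3) (p : Layer) (s : ℝ) :
    HasDerivAt (fun s : ℝ => f (p + cover (s • axis i)))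
      (partialD i f (p + cover (s • axis i))) s := by
  obtain ⟨q, rfl⟩ := cover_surjective p
  have key : ∀ q s, HasDerivAt (fun s : ℝ => f (cover q + cover (s • axis i)))
      (fderiv ℝ (fun q : Plane × ℝ => f (cover q)) (q + s • axis i) (axis i)) s := fun q s => by
    have hd : HasFDerivAt (fun q : Plane × ℝ => f (cover q))
        (fderiv ℝ (fun q : Plane × ℝ => f (cover q)) (q + s • axis i)) (q + s • axis i) :=
      (hf.smooth.differentiable (by simp)).differentiableAt.hasFDerivAt
    have hl : HasDerivAt (fun s : ℝ => q + s • axis i) (axis i) s := by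
      simpa using ((hasDerivAt_id s).smul_const (axis i)).const_add q
    have := hd.comp_hasDerivAt s hl
    simpa only [Function.comp_def, cover_add] using this
  have h0 := (key (q + s • axis i) 0).deriv
  have h1 := key q s
  simp only [zero_smul, add_zero] at h0
  rw [← h0] at h1
  rw [← cover_add]
  exact h1

theorem IsTest.partialD_cover {f : Layer → F} (hf : IsTest f) (i : Fin 3) (q : Plane × ℝ) :
    partialD i f (cover q) = fderiv ℝ (fun q : Plane × ℝ => f (cover q)) q (axis i) := by
  have hd : DifferentiableAt ℝ (fun q : Plane × ℝ => f (cover q)) q :=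
    (hf.smooth.differentiable (by simp)).differentiableAt
  have := hd.lineDeriv_eq_fderiv (v := axis i)
  simp only [lineDeriv, cover_add] at this
  exact this

theorem IsTest.partialD {f : Layer → F} (hf : IsTest f) (i : Fin 3) :
    IsTest (partialD i f) where
  smooth := by
    simp_rw [hf.partialD_cover i]
    exact (hf.smooth.fderiv_right (m := ∞) (by simp)).clm_apply contDiff_const
  compact := by
    refine hf.compact.mono' fun p hp => ?_
    by_contra hq
    apply hp
    have h0 : f =ᶠ[nhds p] 0 := notMem_tsupport_iff_eventuallyEq.mp hq
    have hc : Continuous fun s : ℝ => p + cover (s • axis i) :=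
      continuous_const.add (continuous_cover.comp (continuous_id.smul continuous_const))
    have ht : Filter.Tendsto (fun s : ℝ => p + cover (s • axis i)) (nhds 0) (nhds p) := by
      have := hc.tendsto 0
      simpa [cover, Prod.mk_zero_zero] using this
    have h1 : (fun s : ℝ => f (p + cover (s • axis i))) =ᶠ[nhds 0] fun _ => 0 :=
      ht.eventually h0
    simp [Rossby.partialD, h1.deriv_eq]

theorem IsTest.add {f g : Layer → F} (hf : IsTest f) (hg : IsTest g) :
    IsTest (fun p => f p + g p) :=
  ⟨hf.smooth.add hg.smooth, hf.compact.add hg.compact⟩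

theorem IsTest.laplacian {f : Layer → F} (hf : IsTest f) : IsTest (laplacian f) := by
  have : Rossby.laplacian f = fun p => (Rossby.partialD 0 (Rossby.partialD 0 f) p +
      Rossby.partialD 1 (Rossby.partialD 1 f) p) + Rossby.partialD 2 (Rossby.partialD 2 f) p := by
    funext p
    rw [Rossby.laplacian, Fin.sum_univ_three]
  rw [this]
  exact (((hf.partialD 0).partialD 0).add ((hf.partialD 1).partialD 1)).add
    ((hf.partialD 2).partialD 2)

theorem IsTest.clm_comp {f : Layer → F} (hf : IsTest f) (L : F →L[ℝ] G) :
    IsTest (fun p => L (f p)) :=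
  ⟨L.contDiff.comp hf.smooth, hf.compact.comp_left (map_zero L)⟩

theorem IsTest.partialD_clm_comp {f : Layer → F} (hf : IsTest f) (L : F →L[ℝ] G) (i : Fin 3) :
    Rossby.partialD i (fun p => L (f p)) = fun p => L (Rossby.partialD i f p) := by
  funext p
  have := L.hasFDerivAt.comp_hasDerivAt 0 (hf.hasDerivAt i p 0)
  have h2 := this.deriv
  simp only [zero_smul] at h2
  rw [show p + cover 0 = p by simp [cover, Prod.mk_zero_zero]] at h2
  exact h2

theorem IsTest.laplacian_clm_comp {f : Layer → F} (hf : IsTest f) (L : F →L[ℝ] G) :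
    Rossby.laplacian (fun p => L (f p)) = fun p => L (Rossby.laplacian f p) := by
  funext p
  simp only [Rossby.laplacian, map_sum]
  refine Finset.sum_congr rfl fun i _ => ?_
  rw [hf.partialD_clm_comp L i, (hf.partialD i).partialD_clm_comp L i]

theorem IsTest.continuous {f : Layer → F} (hf : IsTest f) : Continuous f := by
  rw [isQuotientMap_cover.continuous_iff]
  exact hf.smooth.continuous

theorem IsTest.integrable {f : Layer → F} (hf : IsTest f) : Integrable f :=
  hf.continuous.integrable_of_hasCompactSupport hf.compact

theorem IsTest.memLp {f : Layer → F} (hf : IsTest f) : MemLp f 2 (volume : Measure Layer) :=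
  hf.continuous.memLp_of_hasCompactSupport hf.compact

end TestCalculus

/-! ### Fourier coefficients of test functions -/

/-- The frequency vector `(y₁, y₂, n)`; the wave vector is `2π` times it. -/
def freq (n : ℤ) (y : Plane) : Fin 3 → ℝ := ![y 0, y 1, n]

/-- The character `(x, z) ↦ e^{2πi(y·x + nz)}` of the layer. -/
def char (n : ℤ) (y : Plane) (p : Layer) : ℂ := fourier n p.2 * Real.fourierChar ⟪y, p.1⟫

theorem char_add (n : ℤ) (y : Plane) (p q : Layer) :
    char n y (p + q) = char n y p * char n y q := by
  simp only [char, Prod.snd_add, Prod.fst_add, inner_add_right, AddChar.map_add_eq_mul,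
    Circle.coe_mul, fourier_apply, smul_add, AddCircle.toCircle_add]
  ring

theorem char_axis (n : ℤ) (y : Plane) (i : Fin 3) (s : ℝ) :
    char n y (cover (s • axis i)) = Complex.exp (s * (2 * Real.pi * Complex.I * freq n y i)) := by
  fin_cases i
  · simp [char, cover, axis, freq, Real.fourierChar_apply, inner_smul_right,
      EuclideanSpace.inner_single_right]
    ring_nf
  · simp [char, cover, axis, freq, Real.fourierChar_apply, inner_smul_right,
      EuclideanSpace.inner_single_right]
    ring_nf
  · simp [char, cover, axis, freq]
    ring_nf

theorem norm_char (n : ℤ) (y : Plane) (p : Layer) : ‖char n y p‖ = 1 := by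
  rw [char, norm_mul, norm_fourier_apply, Circle.norm_coe, one_mul]

theorem continuous_char (n : ℤ) (y : Plane) : Continuous (char n y) := by
  have h1 : Continuous fun p : Layer => fourier n p.2 :=
    (map_continuous (fourier n)).comp continuous_snd
  have h2 : Continuous fun p : Layer => ((Real.fourierChar ⟪y, p.1⟫ : Circle) : ℂ) := by
    have : Continuous fun p : Layer => ⟪y, p.1⟫ := continuous_const.inner continuous_fst
    exact continuous_subtype_val.comp (Real.continuous_fourierChar.comp this)
  exact h1.mul h2

instance isAddLeftInvariant_layer : (volume : Measure Layer).IsAddLeftInvariant :=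
  inferInstanceAs
    ((volume : Measure Plane).prod (volume : Measure UnitAddCircle)).IsAddLeftInvariant

/-- Translates by `|s| < 1` all live in one compact set, so the maximum times its indicator
dominates. This serves differentiation under the integral sign. -/
theorem IsTest.exists_bound_partialD {f : Layer → ℂ} (hf : IsTest f) (i : Fin 3) :
    ∃ b : Layer → ℝ, Integrable b ∧ ∀ p : Layer, ∀ s ∈ Metric.ball (0 : ℝ) 1,
      ‖Rossby.partialD i f (p + cover (s • axis i))‖ ≤ b p := by
  obtain ⟨M, hM⟩ := (hf.partialD i).compact.exists_bound_of_continuous (hf.partialD i).continuous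
  have hc : Continuous fun r : Layer × ℝ => r.1 - cover (r.2 • axis i) :=
    continuous_fst.sub (continuous_cover.comp (continuous_snd.smul continuous_const))
  have hK : IsCompact ((fun r : Layer × ℝ => r.1 - cover (r.2 • axis i)) ''
      (tsupport (Rossby.partialD i f) ×ˢ Metric.closedBall (0 : ℝ) 1)) :=
    ((hf.partialD i).compact.isCompact.prod (isCompact_closedBall 0 1)).image hc
  refine ⟨indicator _ fun _ => M, (integrable_indicator_iff hK.measurableSet).2
    (integrableOn_const hK.measure_lt_top.ne), fun p s hs => ?_⟩
  by_cases hp : p + cover (s • axis i) ∈ tsupport (Rossby.partialD i f)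
  · rw [indicator_of_mem]
    · exact hM _
    · exact ⟨(p + cover (s • axis i), s), ⟨hp, Metric.ball_subset_closedBall hs⟩, by simp⟩
  · rw [image_eq_zero_of_notMem_tsupport hp, norm_zero]
    exact indicator_nonneg (fun _ _ => (norm_nonneg _).trans (hM p)) _

/-- Integration by parts is replaced by translation invariance. The integral of the translate of `f`
by `s` along the axis, against the conjugate character, equals an exponential in `s` times the
untranslated integral. Differentiating at `s = 0` under the integral sign and in closed form gives
the two sides. -/
theorem IsTest.integral_partialD_mul_conj_char {f : Layer → ℂ} (hf : IsTest f) (n : ℤ) (y : Plane)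
    (i : Fin 3) : ∫ p, Rossby.partialD i f p * starRingEnd ℂ (char n y p) =
      2 * Real.pi * Complex.I * freq n y i * ∫ p, f p * starRingEnd ℂ (char n y p) := by
  have hint : ∀ {g : Layer → ℂ}, IsTest g →
      Integrable (fun p => g p * starRingEnd ℂ (char n y p)) := fun hg =>
    hg.integrable.mul_bdd (c := 1)
      (Complex.continuous_conj.comp (continuous_char n y)).aestronglyMeasurable
      (Filter.Eventually.of_forall fun p => by simp [norm_char])
  have hmeas : ∀ (g : Layer → ℂ), Continuous g → ∀ s : ℝ, AEStronglyMeasurable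
      (fun p => g (p + cover (s • axis i)) * starRingEnd ℂ (char n y p)) volume := fun g hg s =>
    ((hg.comp (continuous_id.add continuous_const)).mul
      (Complex.continuous_conj.comp (continuous_char n y))).aestronglyMeasurable
  obtain ⟨b, hb, hbound⟩ := hf.exists_bound_partialD i
  have hz : ∀ p : Layer, p + cover ((0 : ℝ) • axis i) = p := fun p => by
    simp [cover, Prod.mk_zero_zero]
  have h1 : HasDerivAt
      (fun s : ℝ => ∫ p, f (p + cover (s • axis i)) * starRingEnd ℂ (char n y p))
      (∫ p, Rossby.partialD i f (p + cover ((0 : ℝ) • axis i)) * starRingEnd ℂ (char n y p)) 0 := by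
    refine (hasDerivAt_integral_of_dominated_loc_of_deriv_le
      (F' := fun s p => Rossby.partialD i f (p + cover (s • axis i)) * starRingEnd ℂ (char n y p))
      (bound := b) (Metric.ball_mem_nhds 0 one_pos) (Filter.Eventually.of_forall fun s =>
        hmeas f hf.continuous s) ?_ (hmeas _ (hf.partialD i).continuous 0) ?_ hb ?_).2
    · simp_rw [hz]; exact hint hf
    · refine Filter.Eventually.of_forall fun p s hs => ?_
      rw [norm_mul, RCLike.norm_conj, norm_char, mul_one]
      exact hbound p s hs
    · exact Filter.Eventually.of_forall fun p s _ => (hf.hasDerivAt i p s).mul_const _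
  have h2 : (fun s : ℝ => ∫ p, f (p + cover (s • axis i)) * starRingEnd ℂ (char n y p)) =
      fun s : ℝ => Complex.exp (s * (2 * Real.pi * Complex.I * freq n y i)) *
        ∫ p, f p * starRingEnd ℂ (char n y p) := by
    funext s
    rw [← char_axis, ← integral_add_right_eq_self (μ := (volume : Measure Layer))
      (fun p => f p * starRingEnd ℂ (char n y p)) (cover (s • axis i)), ← integral_const_mul]
    congr 1
    funext p
    have : char n y (cover (s • axis i)) * starRingEnd ℂ (char n y (cover (s • axis i))) = 1 := by
      rw [Complex.mul_conj, Complex.normSq_eq_norm_sq, norm_char]; simp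
    rw [char_add, map_mul]
    linear_combination (- f (p + cover (s • axis i)) * starRingEnd ℂ (char n y p)) * this
  have h3 : HasDerivAt (fun s : ℝ => Complex.exp (s * (2 * Real.pi * Complex.I * freq n y i)) *
        ∫ p, f p * starRingEnd ℂ (char n y p))
      (2 * Real.pi * Complex.I * freq n y i * ∫ p, f p * starRingEnd ℂ (char n y p)) 0 := by
    have h4 : HasDerivAt (fun s : ℝ => ((s : ℝ) : ℂ) * (2 * Real.pi * Complex.I * freq n y i))
        (1 * (2 * Real.pi * Complex.I * freq n y i)) 0 :=
      (Complex.ofRealCLM.hasDerivAt (x := (0 : ℝ))).mul_const _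
    have := (h4.cexp).mul_const (∫ p, f p * starRingEnd ℂ (char n y p))
    simpa using this
  rw [h2] at h1
  simp_rw [hz] at h1
  exact h1.unique h3

theorem IsTest.integral_laplacian_mul_conj_char {f : Layer → ℂ} (hf : IsTest f) (n : ℤ)
    (y : Plane) : ∫ p, Rossby.laplacian f p * starRingEnd ℂ (char n y p) =
      -(4 * Real.pi ^ 2 * ∑ i, (freq n y i : ℂ) ^ 2) *
        ∫ p, f p * starRingEnd ℂ (char n y p) := by
  have hint : ∀ {g : Layer → ℂ}, IsTest g →
      Integrable (fun p => g p * starRingEnd ℂ (char n y p)) := fun hg =>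
    hg.integrable.mul_bdd (c := 1)
      (Complex.continuous_conj.comp (continuous_char n y)).aestronglyMeasurable
      (Filter.Eventually.of_forall fun p => by simp [norm_char])
  simp only [Rossby.laplacian, Finset.sum_mul]
  rw [integral_finsetSum _ fun i _ => hint ((hf.partialD i).partialD i)]
  simp_rw [(hf.partialD _).integral_partialD_mul_conj_char, hf.integral_partialD_mul_conj_char]
  rw [Finset.mul_sum, ← Finset.sum_neg_distrib, Finset.sum_mul]
  refine Finset.sum_congr rfl fun i _ => ?_
  linear_combination (4 * Real.pi ^ 2 * (freq n y i : ℂ) ^ 2 *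
    ∫ p, f p * starRingEnd ℂ (char n y p)) * Complex.I_sq

/-- The Fourier coefficients of an integrable field are given by integrals. -/
theorem hat_toLp_ae {u : Layer → Vec3} (h1 : Integrable u) (h2 : MemLp u 2) (n : ℤ) (i : Fin 3) :
    hat n i (h2.toLp u) =ᵐ[volume] fun y => ∫ p, ((u p i : ℝ) : ℂ) * starRingEnd ℂ (char n y p) := by
  have hint : ∀ y, Integrable (fun p : Layer => ((u p i : ℝ) : ℂ) * starRingEnd ℂ (char n y p)) :=
    fun y => by
      have h3 : Integrable (fun p : Layer => ((u p i : ℝ) : ℂ)) :=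
        (Complex.ofRealCLM ∘L (EuclideanSpace.proj i : Vec3 →L[ℝ] ℝ)).integrable_comp h1
      exact h3.mul_bdd (c := 1)
        (Complex.continuous_conj.comp (continuous_char n y)).aestronglyMeasurable
        (Filter.Eventually.of_forall fun p => by simp [norm_char])
  have hf1 : Integrable (fun p : Layer => ((u p i : ℝ) : ℂ) * starRingEnd ℂ (fourier n p.2)) := by
    have := hint 0
    simpa [char] using this
  have hg1 : Integrable (fun x : Plane =>
      ∫ z : UnitAddCircle, ((u (x, z) i : ℝ) : ℂ) * starRingEnd ℂ (fourier n z)) :=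
    hf1.integral_prod_left
  have e1 : verticalMode (component i (h2.toLp u)) n =ᵐ[volume] fun x : Plane =>
      ∫ z : UnitAddCircle, ((u (x, z) i : ℝ) : ℂ) * starRingEnd ℂ (fourier n z) := by
    have h3 : ∀ᵐ p : Layer, component i (h2.toLp u) p = ((u p i : ℝ) : ℂ) := by
      filter_upwards [component_ae i (h2.toLp u), h2.coeFn_toLp] with p h4 h5
      rw [h4, h5]
    have h6 := Measure.ae_ae_of_ae_prod (μ := (volume : Measure Plane))
      (ν := (volume : Measure UnitAddCircle)) h3
    filter_upwards [(memLp_fourierCoeff (component i (h2.toLp u)) n).coeFn_toLp, h6] with x h7 h8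
    refine h7.trans ?_
    rw [fourierCoeff, ← volume_unitAddCircle]
    refine integral_congr_ae ?_
    filter_upwards [h8] with z hz
    rw [hz, smul_eq_mul, fourier_neg, mul_comm]
  have hg2 : MemLp (fun x : Plane =>
      ∫ z : UnitAddCircle, ((u (x, z) i : ℝ) : ℂ) * starRingEnd ℂ (fourier n z)) 2 :=
    (memLp_congr_ae e1).1 (Lp.memLp _)
  have e2 : verticalMode (component i (h2.toLp u)) n = hg2.toLp _ := by
    ext1
    exact e1.trans hg2.coeFn_toLp.symm
  rw [hat, e2]
  refine (fourier_toLp_ae hg1 hg2).trans (Filter.Eventually.of_forall fun y => ?_)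
  simp only [Real.fourier_eq]
  rw [integral_layer (hint y)]
  congr 1
  funext x
  rw [Circle.smul_def, smul_eq_mul, ← integral_const_mul]
  congr 1
  funext z
  simp only [char, map_mul, ← Circle.coe_inv_eq_conj, ← AddChar.map_neg_eq_inv]
  rw [real_inner_comm]
  ring

/-- The point is that the scalar factor is the same for all `i`: gradients are parallel to the
frequency, hence orthogonal to transversal amplitudes. -/
theorem hat_gradient_ae {f : Layer → ℝ} (hf : IsTest f) (n : ℤ) :
    ∃ h : Plane → ℂ, ∀ i, hat n i (hf.memLp_gradient.toLp (gradient f)) =ᵐ[volume] fun y =>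
      freq n y i * h y := by
  have hi : Integrable (gradient f) := by
    refine Integrable.of_eval_piLp fun i => ?_
    exact (hf.partialD i).integrable
  refine ⟨fun y => 2 * Real.pi * Complex.I * ∫ p, ((f p : ℝ) : ℂ) * starRingEnd ℂ (char n y p),
    fun i => (hat_toLp_ae hi hf.memLp_gradient n i).trans (Filter.Eventually.of_forall fun y => ?_)⟩
  have h1 := (hf.clm_comp Complex.ofRealCLM).integral_partialD_mul_conj_char n y i
  rw [hf.partialD_clm_comp] at h1
  simp only [Complex.ofRealCLM_apply] at h1
  simp only [gradient]
  rw [h1]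
  ring

theorem hat_laplacian_ae {f : Layer → Vec3} (hf : IsTest f) (n : ℤ) (i : Fin 3) :
    hat n i (hf.laplacian.memLp.toLp (laplacian f)) =ᵐ[volume] fun y =>
      -(4 * Real.pi ^ 2 * ∑ j, (freq n y j : ℂ) ^ 2) * hat n i (hf.memLp.toLp f) y := by
  filter_upwards [hat_toLp_ae hf.integrable hf.memLp n i,
    hat_toLp_ae hf.laplacian.integrable hf.laplacian.memLp n i] with y h1 h2
  rw [h1, h2]
  have h3 := (hf.clm_comp (Complex.ofRealCLM ∘L (EuclideanSpace.proj i : Vec3 →L[ℝ] ℝ)))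
    |>.integral_laplacian_mul_conj_char n y
  rw [hf.laplacian_clm_comp] at h3
  simpa using h3

/-! ### Test fields with one vertical mode -/

/-- The function `φ(x) e^{2πinz}`. -/
def testMode (n : ℤ) (φ : Plane → ℂ) (p : Layer) : ℂ := fourier n p.2 * φ p.1

/-- The action of `∂ᵢ` on the amplitude of `φ(x) e^{2πinz}`. -/
def planeD (n : ℤ) (i : Fin 3) (φ : Plane → ℂ) : Plane → ℂ :=
  ![fun x => fderiv ℝ φ x (EuclideanSpace.single 0 1),
    fun x => fderiv ℝ φ x (EuclideanSpace.single 1 1),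
    fun x => 2 * Real.pi * Complex.I * n * φ x] i

/-- The class `C_c^∞(ℝ²)`. -/
def IsPlaneTest (φ : Plane → ℂ) : Prop := ContDiff ℝ ∞ φ ∧ HasCompactSupport φ

theorem IsPlaneTest.continuous {φ : Plane → ℂ} (hφ : IsPlaneTest φ) : Continuous φ :=
  hφ.1.continuous

theorem IsPlaneTest.integrable {φ : Plane → ℂ} (hφ : IsPlaneTest φ) : Integrable φ :=
  hφ.continuous.integrable_of_hasCompactSupport hφ.2

theorem IsPlaneTest.memLp {φ : Plane → ℂ} (hφ : IsPlaneTest φ) : MemLp φ 2 :=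
  hφ.continuous.memLp_of_hasCompactSupport hφ.2

theorem IsPlaneTest.planeD {φ : Plane → ℂ} (hφ : IsPlaneTest φ) (n : ℤ) (i : Fin 3) :
    IsPlaneTest (planeD n i φ) := by
  have hd : ∀ v : Plane, IsPlaneTest (fun x => fderiv ℝ φ x v) := fun v =>
    ⟨(hφ.1.fderiv_right (m := ∞) (by simp)).clm_apply contDiff_const,
      hφ.2.fderiv_apply (𝕜 := ℝ) v⟩
  fin_cases i
  · exact hd _
  · exact hd _
  · exact ⟨contDiff_const.mul hφ.1, hφ.2.mul_left⟩

theorem IsPlaneTest.const_mul {φ : Plane → ℂ} (hφ : IsPlaneTest φ) (c : ℂ) :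
    IsPlaneTest (fun x => c * φ x) :=
  ⟨contDiff_const.mul hφ.1, hφ.2.mul_left⟩

theorem IsPlaneTest.add {φ ψ : Plane → ℂ} (hφ : IsPlaneTest φ) (hψ : IsPlaneTest ψ) :
    IsPlaneTest (fun x => φ x + ψ x) :=
  ⟨hφ.1.add hψ.1, hφ.2.add hψ.2⟩

theorem IsPlaneTest.comp_add {φ : Plane → ℂ} (hφ : IsPlaneTest φ) (v : Plane) :
    IsPlaneTest (fun x => φ (x + v)) :=
  ⟨hφ.1.comp (contDiff_id.add contDiff_const), hφ.2.comp_homeomorph (Homeomorph.addRight v)⟩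

theorem IsPlaneTest.isTest_testMode {φ : Plane → ℂ} (hφ : IsPlaneTest φ) (n : ℤ) :
    IsTest (testMode n φ) where
  smooth := by
    have h : (fun q : Plane × ℝ => testMode n φ (cover q)) = fun q : Plane × ℝ =>
        Complex.exp (2 * Real.pi * Complex.I * n * q.2) * φ q.1 := by
      funext q
      simp [testMode, cover]
    rw [h]
    refine ContDiff.mul ?_ (hφ.1.comp contDiff_fst)
    exact (contDiff_const.mul (Complex.ofRealCLM.contDiff.comp contDiff_snd)).cexp
  compact := by
    refine HasCompactSupport.intro (K := tsupport φ ×ˢ univ)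
      (hφ.2.isCompact.prod isCompact_univ) fun p hp => ?_
    have : p.1 ∉ tsupport φ := fun h => hp ⟨h, mem_univ _⟩
    rw [testMode, image_eq_zero_of_notMem_tsupport this, mul_zero]

theorem IsPlaneTest.partialD_testMode {φ : Plane → ℂ} (hφ : IsPlaneTest φ) (n : ℤ) (i : Fin 3) :
    partialD i (testMode n φ) = testMode n (Rossby.planeD n i φ) := by
  have hd : ∀ (x v : Plane), HasDerivAt (fun s : ℝ => φ (x + s • v)) (fderiv ℝ φ x v) 0 :=
    fun x v => by
      have h1 : HasFDerivAt φ (fderiv ℝ φ x) (x + (0 : ℝ) • v) := by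
        rw [zero_smul, add_zero]
        exact (hφ.1.differentiable (by simp)).differentiableAt.hasFDerivAt
      have hl : HasDerivAt (fun s : ℝ => x + s • v) v 0 := by
        simpa using ((hasDerivAt_id (0 : ℝ)).smul_const v).const_add x
      exact h1.comp_hasDerivAt (0 : ℝ) hl
  funext p
  obtain ⟨⟨x, r⟩, rfl⟩ := cover_surjective p
  simp only [partialD]
  fin_cases i
  · have := (hd x (EuclideanSpace.single 0 1)).const_mul (fourier n (r : UnitAddCircle))
    refine HasDerivAt.deriv ?_
    simpa [testMode, cover, axis, Rossby.planeD] using this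
  · have := (hd x (EuclideanSpace.single 1 1)).const_mul (fourier n (r : UnitAddCircle))
    refine HasDerivAt.deriv ?_
    simpa [testMode, cover, axis, Rossby.planeD] using this
  · have h1 := hasDerivAt_fourier (1 : ℝ) n (r + 0)
    have h2 := (h1.comp_const_add r (0 : ℝ)).mul_const (φ x)
    have h3 : (fun s : ℝ => testMode n φ (cover (x, r) + cover (s • axis 2))) =
        fun s : ℝ => fourier n ((r + s : ℝ) : UnitAddCircle) * φ x := by
      funext s
      simp [testMode, cover, axis]
    have h4 := h2.deriv
    rw [← h3] at h4
    refine h4.trans ?_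
    simp only [testMode, cover, Rossby.planeD, add_zero, Complex.ofReal_one, div_one]
    change _ = _ * (2 * Real.pi * Complex.I * n * φ x)
    ring

theorem IsPlaneTest.laplacian_testMode {φ : Plane → ℂ} (hφ : IsPlaneTest φ) (n : ℤ) :
    laplacian (testMode n φ) =
      testMode n (fun x => ∑ i, Rossby.planeD n i (Rossby.planeD n i φ) x) := by
  funext p
  simp only [laplacian, testMode, Finset.mul_sum]
  refine Finset.sum_congr rfl fun i _ => ?_
  rw [hφ.partialD_testMode n i, (hφ.planeD n i).partialD_testMode n i, testMode]

theorem IsPlaneTest.laplacian_amplitude {φ : Plane → ℂ} (hφ : IsPlaneTest φ) (n : ℤ) :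
    IsPlaneTest (fun x => ∑ i, Rossby.planeD n i (Rossby.planeD n i φ) x) := by
  simp_rw [Fin.sum_univ_three]
  exact (((hφ.planeD n 0).planeD n 0).add ((hφ.planeD n 1).planeD n 1)).add
    ((hφ.planeD n 2).planeD n 2)

theorem IsPlaneTest.integral_testMode {φ : Plane → ℂ} (n : ℤ) (y : Plane) :
    ∫ p, testMode n φ p * starRingEnd ℂ (char n y p) = 𝓕 φ y := by
  have h : ∀ p : Layer, testMode n φ p * starRingEnd ℂ (char n y p) =
      (Real.fourierChar (-⟪p.1, y⟫) • φ p.1) * 1 := fun p => by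
    have h1 : fourier n p.2 * starRingEnd ℂ (fourier n p.2) = 1 := by
      rw [Complex.mul_conj, Complex.normSq_eq_norm_sq, norm_fourier_apply]; simp
    rw [testMode, char, map_mul, ← Circle.coe_inv_eq_conj, ← AddChar.map_neg_eq_inv,
      real_inner_comm y, Circle.smul_def, smul_eq_mul]
    linear_combination (φ p.1 * (Real.fourierChar (-⟪y, p.1⟫) : Circle)) * h1
  simp_rw [h]
  rw [Measure.volume_eq_prod, integral_prod_mul
    (fun x : Plane => (Real.fourierChar (-⟪x, y⟫) • φ x)) (fun _ : UnitAddCircle => (1 : ℂ))]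
  simp [Real.fourier_eq]

theorem IsPlaneTest.fourier_planeD {φ : Plane → ℂ} (hφ : IsPlaneTest φ) (n : ℤ) (i : Fin 3)
    (y : Plane) : 𝓕 (Rossby.planeD n i φ) y = 2 * Real.pi * Complex.I * freq n y i * 𝓕 φ y := by
  rw [← integral_testMode n, ← integral_testMode n, ← hφ.partialD_testMode]
  exact (hφ.isTest_testMode n).integral_partialD_mul_conj_char n y i

theorem IsPlaneTest.fourier_laplacian {φ : Plane → ℂ} (hφ : IsPlaneTest φ) (n : ℤ) (y : Plane) :
    𝓕 (fun x => ∑ i, Rossby.planeD n i (Rossby.planeD n i φ) x) y =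
      -(4 * Real.pi ^ 2 * ∑ i, (freq n y i : ℂ) ^ 2) * 𝓕 φ y := by
  rw [← integral_testMode n, ← integral_testMode n, ← hφ.laplacian_testMode]
  exact (hφ.isTest_testMode n).integral_laplacian_mul_conj_char n y

theorem IsPlaneTest.embed_ae {φ : Plane → ℂ} (hφ : IsPlaneTest φ) (n : ℤ) (i : Fin 3) :
    embed n i (𝓕 (hφ.memLp.toLp φ)) =ᵐ[volume] fun p =>
      Complex.reCLM.smulRight (EuclideanSpace.single i (1 : ℝ) : Vec3) (testMode n φ p) := by
  have h1 : ∀ᵐ p : Layer, hφ.memLp.toLp φ p.1 = φ p.1 :=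
    measurePreserving_fst_layer.quasiMeasurePreserving.ae hφ.memLp.coeFn_toLp
  filter_upwards [Rossby.embed_ae n i (𝓕 (hφ.memLp.toLp φ)), h1] with p h2 h3
  rw [h2, FourierTransform.fourierInv_fourier_eq, h3]
  rfl

/-! ### Test functions determine a function by their Fourier transforms -/

/-- Modulating a bump by the character of `y₀` moves the value of its transform at `0`, which is its
positive integral, to `y₀`. -/
theorem exists_isPlaneTest_fourier_ne_zero (y₀ : Plane) :
    ∃ φ : Plane → ℂ, IsPlaneTest φ ∧ 𝓕 φ y₀ ≠ 0 := by
  let b : ContDiffBump (0 : Plane) := ⟨1, 2, one_pos, one_lt_two⟩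
  refine ⟨fun x => Complex.exp (((2 * Real.pi * ⟪x, y₀⟫ : ℝ) : ℂ) * Complex.I) * (b x : ℂ),
    ⟨?_, ?_⟩, ?_⟩
  · refine ContDiff.mul ?_ (Complex.ofRealCLM.contDiff.comp b.contDiff)
    refine ((Complex.ofRealCLM.contDiff.comp (contDiff_const.mul ?_)).mul contDiff_const).cexp
    exact contDiff_id.inner ℝ contDiff_const
  · have : HasCompactSupport (fun x => (b x : ℂ)) := b.hasCompactSupport.comp_left
      (g := Complex.ofReal) Complex.ofReal_zero
    exact this.mul_left
  · have h : 𝓕 (fun x => Complex.exp (((2 * Real.pi * ⟪x, y₀⟫ : ℝ) : ℂ) * Complex.I) * (b x : ℂ))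
        y₀ = ((∫ x, b x : ℝ) : ℂ) := by
      rw [Real.fourier_eq, ← integral_complex_ofReal]
      congr 1
      funext x
      rw [Circle.smul_def, Real.fourierChar_apply, smul_eq_mul, ← mul_assoc, ← Complex.exp_add]
      have : ((2 * Real.pi * -⟪x, y₀⟫ : ℝ) : ℂ) * Complex.I +
          ((2 * Real.pi * ⟪x, y₀⟫ : ℝ) : ℂ) * Complex.I = 0 := by push_cast; ring
      rw [this, Complex.exp_zero, one_mul]
    rw [h]
    exact_mod_cast b.integral_pos.ne'

theorem continuous_fourier_of_integrable {φ : Plane → ℂ} (hφ : Integrable φ) :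
    Continuous (𝓕 φ) :=
  VectorFourier.fourierIntegral_continuous Real.continuous_fourierChar
    (by simpa using continuous_inner) hφ

/-- Translating `φ` modulates its transform, so the hypothesis for all translates says that the
integrable function `conj (𝓕 φ) * H` has zero Fourier transform. It therefore vanishes almost
everywhere, and near any given point some `𝓕 φ` is nonzero. Integrability of `H` itself is not
required, which leaves room for polynomially growing multipliers. -/
theorem ae_eq_zero_of_integral_test {H : Plane → ℂ}
    (hi : ∀ φ, IsPlaneTest φ → Integrable (fun y => starRingEnd ℂ (𝓕 φ y) * H y))
    (h : ∀ φ, IsPlaneTest φ → (∫ y, starRingEnd ℂ (𝓕 φ y) * H y).re = 0) :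
    H =ᵐ[volume] 0 := by
  have h0 : ∀ φ, IsPlaneTest φ → ∫ y, starRingEnd ℂ (𝓕 φ y) * H y = 0 := fun φ hφ => by
    refine Complex.ext (h φ hφ) ?_
    -- Replacing `φ` by `iφ` turns the statement on real parts into one on imaginary parts.
    have h1 := h _ (hφ.const_mul Complex.I)
    have h2 : ∀ y, 𝓕 (fun x => Complex.I * φ x) y = Complex.I * 𝓕 φ y := fun y => by
      simp only [Real.fourier_eq, Circle.smul_def, smul_eq_mul]
      rw [← integral_const_mul]
      congr 1
      funext x
      ring
    simp_rw [h2, map_mul, Complex.conj_I, mul_assoc] at h1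
    rw [integral_const_mul] at h1
    simpa using h1
  have h1 : ∀ φ, IsPlaneTest φ → ∀ᵐ y, starRingEnd ℂ (𝓕 φ y) * H y = 0 := fun φ hφ => by
    refine ae_eq_zero_of_fourier_eq_zero (hi φ hφ) fun x => ?_
    rw [← h0 _ (hφ.comp_add x), Real.fourier_eq]
    congr 1
    funext y
    have h2 : 𝓕 (fun v => φ (v + x)) y = Real.fourierChar ⟪x, y⟫ • 𝓕 φ y :=
      congrFun (VectorFourier.fourierIntegral_comp_add_right Real.fourierChar
        (volume : Measure Plane) (innerₗ Plane) φ x) y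
    rw [h2, Circle.smul_def, Circle.smul_def, smul_eq_mul, smul_eq_mul, map_mul,
      ← Circle.coe_inv_eq_conj, ← AddChar.map_neg_eq_inv, real_inner_comm, mul_assoc]
  have h2 : volume {y | H y ≠ 0} = 0 := by
    refine measure_null_of_locally_null _ fun y₀ _ => ?_
    obtain ⟨φ, hφ, hne⟩ := exists_isPlaneTest_fourier_ne_zero y₀
    refine ⟨{y | 𝓕 φ y ≠ 0} ∩ {y | H y ≠ 0}, ?_, ?_⟩
    · refine Filter.inter_mem (mem_nhdsWithin_of_mem_nhds ?_) self_mem_nhdsWithin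
      exact (continuous_fourier_of_integrable hφ.integrable).continuousAt.eventually_ne hne
    · refine measure_mono_null ?_ (ae_iff.1 (h1 φ hφ))
      rintro y ⟨hy1, hy2⟩
      exact mul_ne_zero ((map_ne_zero _).2 hy1) hy2
  exact ae_iff.2 h2

/-! ### The divergence-free condition in Fourier variables -/

theorem measurable_freq (n : ℤ) (i : Fin 3) : Measurable fun y => freq n y i := by
  fin_cases i
  · exact (EuclideanSpace.proj 0 : Plane →L[ℝ] ℝ).continuous.measurable
  · exact (EuclideanSpace.proj 1 : Plane →L[ℝ] ℝ).continuous.measurable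
  · exact measurable_const

/-- The squared length of the frequency vector. -/
def freqSq (n : ℤ) (y : Plane) : ℝ := ∑ i, freq n y i ^ 2

theorem freqSq_eq (n : ℤ) (y : Plane) : freqSq n y = ‖y‖ ^ 2 + (n : ℝ) ^ 2 := by
  simp [freqSq, freq, Fin.sum_univ_three, EuclideanSpace.norm_sq_eq, Fin.sum_univ_two]

theorem measurable_freqSq (n : ℤ) : Measurable (freqSq n) :=
  Finset.measurable_sum _ fun i _ => (measurable_freq n i).pow_const 2

theorem freqSq_nonneg (n : ℤ) (y : Plane) : 0 ≤ freqSq n y :=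
  Finset.sum_nonneg fun _ _ => sq_nonneg _

theorem integrable_inner_fun (f g : Lp ℂ 2 (volume : Measure Plane)) :
    Integrable (fun y => starRingEnd ℂ (f y) * g y) :=
  (L2.integrable_inner (𝕜 := ℂ) f g).congr (Filter.Eventually.of_forall fun y => by
    simp only [RCLike.inner_apply, mul_comm])

theorem inner_eq_integral (f g : Lp ℂ 2 (volume : Measure Plane)) :
    inner ℂ f g = ∫ y, starRingEnd ℂ (f y) * g y := by
  rw [L2.inner_def]
  congr 1
  funext y
  rw [RCLike.inner_apply, mul_comm]

theorem eq_of_re_inner_eq {a b : Lp ℂ 2 (volume : Measure Plane)}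
    (h : ∀ g : Lp ℂ 2 (volume : Measure Plane), (inner ℂ g a).re = (inner ℂ g b).re) : a = b := by
  rw [← sub_eq_zero]
  have h1 := h (a - b)
  rw [← sub_eq_zero, ← Complex.sub_re, ← inner_sub_right] at h1
  exact (inner_self_eq_zero (𝕜 := ℂ)).1
    (Complex.ext h1 (inner_self_im (𝕜 := ℂ) (a - b)))

/-- The distributional condition is tested with `Re (φ(x) e^{2πinz})`. Its gradient has amplitudes
`2πi freq · 𝓕 φ`, and `φ` is free. -/
theorem IsDivFree.sum_freq_mul_hat {v : L2Field} (hv : IsDivFree v) (n : ℤ) :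
    ∀ᵐ y, ∑ i, (freq n y i : ℂ) * hat n i v y = 0 := by
  have hF : ∀ φ (hφ : IsPlaneTest φ) (i : Fin 3),
      (𝓕 ((hφ.planeD n i).memLp.toLp _) : Lp ℂ 2 (volume : Measure Plane)) =ᵐ[volume]
        fun y => 2 * Real.pi * Complex.I * freq n y i * 𝓕 φ y := fun φ hφ i =>
    (fourier_toLp_ae (hφ.planeD n i).integrable (hφ.planeD n i).memLp).trans
      (Filter.Eventually.of_forall fun y => hφ.fourier_planeD n i y)
  have hπ : (2 * Real.pi * Complex.I : ℂ) ≠ 0 := Complex.two_pi_I_ne_zero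
  have hint : ∀ φ, IsPlaneTest φ → ∀ i, Integrable (fun y =>
      starRingEnd ℂ (2 * Real.pi * Complex.I * freq n y i * 𝓕 φ y) * hat n i v y) :=
    fun φ hφ i => by
      refine (integrable_inner_fun (𝓕 ((hφ.planeD n i).memLp.toLp _)) (hat n i v)).congr ?_
      filter_upwards [hF φ hφ i] with y hy
      rw [hy]
  have hsum : ∀ (φ : Plane → ℂ) (y : Plane), ∑ i, starRingEnd ℂ (2 * Real.pi * Complex.I * freq n y i * 𝓕 φ y) *
      hat n i v y = starRingEnd ℂ (𝓕 φ y) *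
        (starRingEnd ℂ (2 * Real.pi * Complex.I) * ∑ i, (freq n y i : ℂ) * hat n i v y) :=
    fun φ y => by
      simp only [Finset.mul_sum]
      refine Finset.sum_congr rfl fun i _ => ?_
      rw [map_mul, map_mul (starRingEnd ℂ) (2 * Real.pi * Complex.I), Complex.conj_ofReal]
      ring
  have key := ae_eq_zero_of_integral_test
    (H := fun y => starRingEnd ℂ (2 * Real.pi * Complex.I) * ∑ i, (freq n y i : ℂ) * hat n i v y)
    (fun φ hφ => by
      simp_rw [← hsum]
      exact integrable_finsetSum _ fun i _ => hint φ hφ i)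
    (fun φ hφ => by
      simp_rw [← hsum]
      rw [integral_finsetSum _ fun i _ => hint φ hφ i]
      have ht := (hφ.isTest_testMode n).clm_comp Complex.reCLM
      have h1 := (isDivFree_iff v).1 hv _ ht
      have h2 : ht.memLp_gradient.toLp _ =
          ∑ i, embed n i (𝓕 ((hφ.planeD n i).memLp.toLp _)) := by
        ext1
        have h3 : ∀ᵐ p : Layer, ∀ i, embed n i (𝓕 ((hφ.planeD n i).memLp.toLp _)) p =
            Complex.reCLM.smulRight (EuclideanSpace.single i (1 : ℝ) : Vec3)
              (testMode n (planeD n i φ) p) :=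
          ae_all_iff.2 fun i => (hφ.planeD n i).embed_ae n i
        filter_upwards [ht.memLp_gradient.coeFn_toLp, h3, Lp.coeFn_finsetSum Finset.univ
          (fun i => embed n i (𝓕 ((hφ.planeD n i).memLp.toLp _)))] with p h4 h5 h6
        rw [h4, h6, Finset.sum_apply]
        simp_rw [h5]
        ext j
        simp only [gradient, (hφ.isTest_testMode n).partialD_clm_comp, hφ.partialD_testMode]
        simp [Finset.sum_apply, Pi.single_apply]
      rw [h2, real_inner_comm, sum_inner] at h1
      simp_rw [inner_embed, inner_eq_integral] at h1
      rw [Complex.re_sum, ← h1]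
      refine Finset.sum_congr rfl fun i _ => ?_
      congr 1
      refine integral_congr_ae ?_
      filter_upwards [hF φ hφ i] with y hy
      rw [hy])
  filter_upwards [key] with y hy
  exact (mul_eq_zero.1 hy).resolve_left ((map_ne_zero _).2 hπ)

theorem isDivFree_sum_embed (n : ℤ) (g : Fin 3 → Lp ℂ 2 (volume : Measure Plane))
    (hg : ∀ᵐ y, ∑ i, (freq n y i : ℂ) * g i y = 0) : IsDivFree (∑ i, embed n i (g i)) := by
  rw [isDivFree_iff]
  intro f hf
  obtain ⟨h, hh⟩ := hat_gradient_ae hf n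
  rw [sum_inner]
  simp_rw [inner_embed]
  rw [← Complex.re_sum]
  simp_rw [inner_eq_integral]
  rw [← integral_finsetSum _ fun i _ => integrable_inner_fun _ _]
  have : (fun y => ∑ i, starRingEnd ℂ (g i y) *
      hat n i (hf.memLp_gradient.toLp (gradient f)) y) =ᵐ[volume] 0 := by
    filter_upwards [hg, ae_all_iff.2 hh] with y h1 h2
    simp_rw [h2]
    have h3 := congrArg (starRingEnd ℂ) h1
    rw [map_sum, map_zero] at h3
    calc _ = (∑ i, starRingEnd ℂ ((freq n y i : ℂ) * g i y)) * h y := by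
          rw [Finset.sum_mul]
          refine Finset.sum_congr rfl fun i _ => ?_
          rw [map_mul, Complex.conj_ofReal]
          ring
      _ = 0 := by rw [h3, zero_mul]
  rw [integral_congr_ae this]
  simp

/-! ### The Leray projector in Fourier variables -/

/-- The matrix of the orthogonal projection onto the complement of the frequency vector. -/
def projSym (n : ℤ) (i j : Fin 3) (y : Plane) : ℂ :=
  (((if i = j then 1 else 0) - freq n y i * freq n y j / freqSq n y : ℝ) : ℂ)

theorem isSymbol_projSym (n : ℤ) (i j : Fin 3) : IsSymbol (projSym n i j) := by
  refine ⟨Complex.measurable_ofReal.comp (measurable_const.sub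
    (((measurable_freq n i).mul (measurable_freq n j)).div (measurable_freqSq n))), 2, fun y => ?_⟩
  rw [projSym, Complex.norm_real, Real.norm_eq_abs]
  have hi : freq n y i ^ 2 ≤ freqSq n y :=
    Finset.single_le_sum (f := fun i => freq n y i ^ 2) (fun _ _ => sq_nonneg _)
      (Finset.mem_univ i)
  have hj : freq n y j ^ 2 ≤ freqSq n y :=
    Finset.single_le_sum (f := fun i => freq n y i ^ 2) (fun _ _ => sq_nonneg _)
      (Finset.mem_univ j)
  have h1 : |freq n y i * freq n y j / freqSq n y| ≤ 1 := by
    rw [abs_div, abs_of_nonneg (freqSq_nonneg n y)]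
    refine div_le_one_of_le₀ ?_ (freqSq_nonneg n y)
    rw [abs_le]
    constructor <;> nlinarith [sq_nonneg (freq n y i + freq n y j),
      sq_nonneg (freq n y i - freq n y j)]
  refine (abs_sub _ _).trans ?_
  have h2 : |(if i = j then (1 : ℝ) else 0)| ≤ 1 := by split_ifs <;> simp
  linarith

/-- The action of the Leray projector on Fourier coefficients. -/
def projHat (n : ℤ) (g : Fin 3 → Lp ℂ 2 (volume : Measure Plane)) (i : Fin 3) :
    Lp ℂ 2 (volume : Measure Plane) :=
  ∑ j, mulOp (projSym n i j) (g j)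

theorem projHat_ae (n : ℤ) (g : Fin 3 → Lp ℂ 2 (volume : Measure Plane)) :
    ∀ᵐ y, ∀ i, projHat n g i y = ∑ j, projSym n i j y * g j y := by
  rw [ae_all_iff]
  intro i
  have h1 : ∀ᵐ y, ∀ j, mulOp (projSym n i j) (g j) y = projSym n i j y * g j y :=
    ae_all_iff.2 fun j => mulOp_ae (isSymbol_projSym n i j) (g j)
  filter_upwards [h1, Lp.coeFn_finsetSum Finset.univ
    (fun j => mulOp (projSym n i j) (g j))] with y h2 h3
  rw [projHat, h3, Finset.sum_apply]
  simp_rw [h2]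

theorem sum_freq_mul_projSym (n : ℤ) (j : Fin 3) (y : Plane) :
    ∑ i, (freq n y i : ℂ) * projSym n i j y = 0 := by
  simp only [projSym]
  have : ∑ i, freq n y i * ((if i = j then 1 else 0) - freq n y i * freq n y j / freqSq n y)
      = 0 := by
    simp_rw [mul_sub, Finset.sum_sub_distrib]
    have h1 : ∑ i, freq n y i * (freq n y i * freq n y j / freqSq n y) =
        freqSq n y / freqSq n y * freq n y j := by
      rw [freqSq, Finset.sum_div, Finset.sum_mul]
      exact Finset.sum_congr rfl fun i _ => by ring
    rw [h1]
    simp only [mul_ite, mul_one, mul_zero, Finset.sum_ite_eq', Finset.mem_univ, if_true]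
    -- At zero frequency the quotient is `0` by convention, and the identity survives because every
    -- component of the frequency vanishes.
    by_cases hq : freqSq n y = 0
    · have h2 : freq n y j ^ 2 = 0 :=
        (Finset.sum_eq_zero_iff_of_nonneg (fun _ _ => sq_nonneg _)).1 hq j (Finset.mem_univ j)
      rw [hq, pow_eq_zero_iff (two_ne_zero) |>.1 h2]
      simp
    · rw [div_self hq]; ring
  exact_mod_cast this

/-- An orthogonal projection is characterized by two facts. The projected amplitude is transversal
to the frequency, so the field is divergence-free. The remainder is parallel to the frequency, hence
orthogonal to every divergence-free field. -/
theorem leray_sum_embed (n : ℤ) (g : Fin 3 → Lp ℂ 2 (volume : Measure Plane)) :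
    leray (∑ i, embed n i (g i)) = ∑ i, embed n i (projHat n g i) := by
  refine Submodule.eq_starProjection_of_mem_of_inner_eq_zero ?_ fun w hw => ?_
  · refine isDivFree_sum_embed n _ ?_
    filter_upwards [projHat_ae n g] with y hy
    simp_rw [hy, Finset.mul_sum]
    rw [Finset.sum_comm]
    refine Finset.sum_eq_zero fun j _ => ?_
    simp_rw [← mul_assoc]
    rw [← Finset.sum_mul, sum_freq_mul_projSym, zero_mul]
  · have hw' : IsDivFree w := hw
    rw [← Finset.sum_sub_distrib, sum_inner]
    simp only [← map_sub, inner_embed]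
    rw [← Complex.re_sum]
    simp_rw [inner_eq_integral]
    rw [← integral_finsetSum _ fun i _ => integrable_inner_fun _ _]
    have h0 : (fun y => ∑ i, starRingEnd ℂ ((g i - projHat n g i : Lp ℂ 2 volume) y) *
        hat n i w y) =ᵐ[volume] 0 := by
      filter_upwards [projHat_ae n g, hw'.sum_freq_mul_hat n,
        ae_all_iff.2 fun i => Lp.coeFn_sub (g i) (projHat n g i)] with y h1 h2 h3
      have h4 : ∀ i, (g i - projHat n g i : Lp ℂ 2 volume) y =
          (freq n y i : ℂ) * ((∑ j, (freq n y j : ℂ) * g j y) / freqSq n y) := fun i => by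
        rw [h3, Pi.sub_apply, h1]
        simp only [projSym, Complex.ofReal_sub, sub_mul]
        rw [Finset.sum_sub_distrib]
        have : ∑ j, (((if i = j then 1 else 0 : ℝ)) : ℂ) * g j y = g i y := by
          rw [Finset.sum_eq_single i]
          · rw [if_pos rfl, Complex.ofReal_one, one_mul]
          · intro j _ hj
            rw [if_neg hj.symm, Complex.ofReal_zero, zero_mul]
          · exact fun h => absurd (Finset.mem_univ i) h
        rw [this, sub_sub_cancel, Finset.sum_div, Finset.mul_sum]
        refine Finset.sum_congr rfl fun j _ => ?_
        push_cast
        ring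
      simp_rw [h4, map_mul, Complex.conj_ofReal]
      calc _ = starRingEnd ℂ ((∑ j, (freq n y j : ℂ) * g j y) / freqSq n y) *
            ∑ i, (freq n y i : ℂ) * hat n i w y := by
            rw [Finset.mul_sum]
            exact Finset.sum_congr rfl fun i _ => by ring
        _ = 0 := by rw [h2, mul_zero]
    rw [integral_congr_ae h0]
    simp

theorem embed_eq_sum (n : ℤ) (i : Fin 3) (g : Lp ℂ 2 (volume : Measure Plane)) :
    embed n i g = ∑ j, embed n j (Pi.single (M := fun _ => Lp ℂ 2 (volume : Measure Plane)) i g j) := by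
  rw [Finset.sum_eq_single i]
  · simp
  · intro j _ hj
    rw [Pi.single_eq_of_ne hj, map_zero]
  · simp

/-- Self-adjointness moves the projector onto a field with one vertical mode, where
`leray_sum_embed` computes it. The matrix `projSym` is real and symmetric, so it moves back
unchanged, and `v` may have infinitely many modes. -/
theorem hat_leray (n : ℤ) (i : Fin 3) (v : L2Field) :
    hat n i (leray v) = projHat n (fun j => hat n j v) i := by
  refine eq_of_re_inner_eq fun g => ?_
  rw [← inner_embed]
  have h1 : ⟪embed n i g, leray v⟫ = ⟪leray (embed n i g), v⟫ :=
    (Submodule.inner_starProjection_left_eq_right _ _ _).symm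
  rw [h1, embed_eq_sum, leray_sum_embed, sum_inner, projHat, inner_sum, Complex.re_sum]
  refine Finset.sum_congr rfl fun j _ => ?_
  rw [inner_embed, inner_mulOp_right (isSymbol_projSym n i j), projHat,
    Finset.sum_eq_single i]
  · have : (fun y => starRingEnd ℂ (projSym n i j y)) = projSym n j i := by
      funext y
      rw [projSym, projSym, Complex.conj_ofReal, mul_comm (freq n y i)]
      simp only [eq_comm]
    rw [this, Pi.single_eq_same]
  · intro k _ hk
    rw [Pi.single_eq_of_ne hk, map_zero]
  · simp

/-- The rotation `v ↦ e₃ ∧ v` acting on Fourier coefficients. -/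
def crossHat {M : Type*} [AddCommGroup M] (g : Fin 3 → M) : Fin 3 → M := ![-g 1, g 0, 0]

theorem crossE3_apply (w : Vec3) (i : Fin 3) :
    crossE3 w i = (![-w 1, w 0, 0] : Fin 3 → ℝ) i := by
  simp only [crossE3]
  fin_cases i <;> simp [crossProduct]

theorem component_crossE3 (v : L2Field) (i : Fin 3) :
    component i (crossE3.compLp v) = crossHat (fun j => component j v) i := by
  ext1
  have h0 := component_ae i (crossE3.compLp v)
  have h1 := crossE3.coeFn_compLp v
  have h2 : ∀ᵐ p : Layer, ∀ j, component j v p = ((v p j : ℝ) : ℂ) :=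
    ae_all_iff.2 fun j => component_ae j v
  have h3 : ∀ᵐ p : Layer, crossHat (fun j => component j v) i p =
      crossHat (fun j => component j v p) i := by
    fin_cases i
    · exact Lp.coeFn_neg (component 1 v)
    · exact Filter.Eventually.of_forall fun _ => rfl
    · exact Lp.coeFn_zero ℂ 2 (volume : Measure Layer)
  filter_upwards [h0, h1, h2, h3] with p h4 h5 h6 h7
  rw [h4, h5, h7, crossE3_apply]
  simp_rw [h6]
  fin_cases i <;> simp [crossHat]

theorem hat_crossE3 (n : ℤ) (i : Fin 3) (v : L2Field) :
    hat n i (crossE3.compLp v) = crossHat (fun j => hat n j v) i := by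
  have hL : ∀ f : Lp ℂ 2 (volume : Measure Layer),
      (𝓕 (verticalMode f n) : Lp ℂ 2 (volume : Measure Plane)) =
      (FourierTransform.fourierCLM ℂ (Lp ℂ 2 (volume : Measure Plane)) ∘L
      ContinuousLinearMap.adjoint (modeLift n)) f := fun f => by
    rw [verticalMode_eq_adjoint]; rfl
  simp only [hat, component_crossE3, hL]
  fin_cases i
  · exact map_neg _ _
  · rfl
  · exact map_zero _

theorem hat_coriolis (n : ℤ) (i : Fin 3) (v : L2Field) :
    hat n i (coriolis v) = projHat n (crossHat fun j => hat n j v) i := by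
  rw [coriolis, hat_leray]
  simp_rw [hat_crossE3]

/-! ### Linear combinations of solutions -/

theorem integral_inner_eq {f : Layer → Vec3} (hf : MemLp f 2 (volume : Measure Layer))
    (u : L2Field) : ∫ p, ⟪u p, f p⟫ = ⟪u, hf.toLp f⟫ := by
  rw [L2.inner_def]
  refine integral_congr_ae ?_
  filter_upwards [hf.coeFn_toLp] with p hp
  rw [hp]

/-- `coriolis` as a continuous linear map. -/
def coriolisL : L2Field →L[ℝ] L2Field := leray ∘L crossE3.compLpL 2 volume

theorem coriolisL_apply (u : L2Field) : coriolisL u = coriolis u := rfl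

theorem IsSolution.hasDerivAt_inner {Ω : ℝ} {u₀ : L2Field} {u : ℝ → L2Field}
    (hu : IsSolution Ω u₀ u) {f : Layer → Vec3} (hf : IsTest f) {t : ℝ} (ht : 0 < t) :
    HasDerivAt (fun s => ⟪u s, hf.memLp.toLp f⟫) (⟪u t, hf.laplacian.memLp.toLp (laplacian f)⟫ -
      Ω * ⟪coriolis (u t), hf.memLp.toLp f⟫) t := by
  have := hu.equation f hf t ht
  simpa only [integral_inner_eq hf.memLp, integral_inner_eq hf.laplacian.memLp] using this

theorem IsSolution.of_hasDerivAt_inner {Ω : ℝ} {u₀ : L2Field} {u : ℝ → L2Field}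
    (h1 : ContinuousOn u (Ici 0)) (h2 : u 0 = u₀) (h3 : ∀ t, 0 ≤ t → IsDivFree (u t))
    (h4 : ∀ (f : Layer → Vec3) (hf : IsTest f) (t : ℝ), 0 < t →
      HasDerivAt (fun s => ⟪u s, hf.memLp.toLp f⟫)
        (⟪u t, hf.laplacian.memLp.toLp (laplacian f)⟫ -
          Ω * ⟪coriolis (u t), hf.memLp.toLp f⟫) t) : IsSolution Ω u₀ u := by
  refine ⟨h1, h2, h3, fun f hf t ht => ?_⟩
  simpa only [integral_inner_eq hf.memLp, integral_inner_eq hf.laplacian.memLp] using h4 f hf t ht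

theorem IsSolution.add_smul {Ω : ℝ} {u₀ v₀ : L2Field} {u v : ℝ → L2Field}
    (hu : IsSolution Ω u₀ u) (hv : IsSolution Ω v₀ v) (c : ℝ) :
    IsSolution Ω (u₀ + c • v₀) (fun t => u t + c • v t) := by
  refine IsSolution.of_hasDerivAt_inner (hu.continuousOn.add (hv.continuousOn.const_smul c))
    (by rw [hu.initial, hv.initial]) (fun t ht => ?_) fun f hf t ht => ?_
  · exact Rossby.divFree.toSubmodule.add_mem (hu.divFree t ht)
      (Rossby.divFree.toSubmodule.smul_mem c (hv.divFree t ht))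
  · have h := (hu.hasDerivAt_inner hf ht).add ((hv.hasDerivAt_inner hf ht).const_mul c)
    rw [← coriolisL_apply, map_add, map_smul, coriolisL_apply, coriolisL_apply]
    simp only [inner_add_left, real_inner_smul_left]
    refine h.congr_deriv ?_
    ring

theorem IsSolution.zero (Ω : ℝ) : IsSolution Ω 0 (fun _ => 0) := by
  refine IsSolution.of_hasDerivAt_inner continuousOn_const rfl
    (fun t _ => Rossby.divFree.toSubmodule.zero_mem) fun f hf t _ => ?_
  rw [← coriolisL_apply, map_zero]
  simpa using hasDerivAt_const t (0 : ℝ)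

theorem IsSolution.add {Ω : ℝ} {u₀ v₀ : L2Field} {u v : ℝ → L2Field}
    (hu : IsSolution Ω u₀ u) (hv : IsSolution Ω v₀ v) :
    IsSolution Ω (u₀ + v₀) (fun t => u t + v t) := by
  simpa using hu.add_smul hv 1

theorem IsSolution.sum {Ω : ℝ} {ι : Type*} (s : Finset ι) {u₀ : ι → L2Field}
    {u : ι → ℝ → L2Field} (h : ∀ i ∈ s, IsSolution Ω (u₀ i) (u i)) :
    IsSolution Ω (∑ i ∈ s, u₀ i) (fun t => ∑ i ∈ s, u i t) := by
  classical
  induction s using Finset.induction_on with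
  | empty => simpa using IsSolution.zero Ω
  | insert a s ha ih =>
    simp_rw [Finset.sum_insert ha]
    exact (h a (Finset.mem_insert_self a s)).add
      (ih fun i hi => h i (Finset.mem_insert_of_mem hi))

/-! ### Uniqueness -/

theorem mulOp_mulOp {m m' : Plane → ℂ} (hm : IsSymbol m) (hm' : IsSymbol m')
    (g : Lp ℂ 2 (volume : Measure Plane)) :
    mulOp m (mulOp m' g) = mulOp (fun y => m y * m' y) g := by
  ext1
  filter_upwards [mulOp_ae hm (mulOp m' g), mulOp_ae hm' g, mulOp_ae (hm.mul hm') g]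
    with y h1 h2 h3
  rw [h1, h2, h3, mul_assoc]

theorem mulOp_comm {m m' : Plane → ℂ} (hm : IsSymbol m) (hm' : IsSymbol m')
    (g : Lp ℂ 2 (volume : Measure Plane)) : mulOp m (mulOp m' g) = mulOp m' (mulOp m g) := by
  rw [mulOp_mulOp hm hm', mulOp_mulOp hm' hm]
  simp_rw [mul_comm]

theorem crossHat_map {M N : Type*} [AddCommGroup M] [AddCommGroup N] (L : M →+ N)
    (g : Fin 3 → M) (i : Fin 3) : L (crossHat g i) = crossHat (fun j => L (g j)) i := by
  fin_cases i
  · exact map_neg L _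
  · rfl
  · exact map_zero L

/-- Scalar multipliers commute with the Coriolis operator; in the uniqueness proof this is applied
to the resolvent and to the frequency cutoff. -/
theorem mulOp_projHat_crossHat {m : Plane → ℂ} (hm : IsSymbol m) (n : ℤ)
    (g : Fin 3 → Lp ℂ 2 (volume : Measure Plane)) (i : Fin 3) :
    mulOp m (projHat n (crossHat g) i) = projHat n (crossHat fun j => mulOp m (g j)) i := by
  simp only [projHat, map_sum]
  refine Finset.sum_congr rfl fun j _ => ?_
  rw [mulOp_comm hm (isSymbol_projSym n i j)]
  congr 1
  exact crossHat_map ((mulOp m).toLinearMap.toAddMonoidHom) g j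

/-- `crossHat` on triples of coefficients, as a continuous linear map. -/
def crossHatL : (Fin 3 → Lp ℂ 2 (volume : Measure Plane)) →L[ℂ]
    (Fin 3 → Lp ℂ 2 (volume : Measure Plane)) :=
  ContinuousLinearMap.pi ![-ContinuousLinearMap.proj 1, ContinuousLinearMap.proj 0, 0]

theorem crossHatL_apply (g : Fin 3 → Lp ℂ 2 (volume : Measure Plane)) :
    crossHatL g = crossHat g := by
  funext i
  fin_cases i <;> simp [crossHatL, crossHat]

/-- `g ↦ P (e₃ ∧ g)` on Fourier coefficients, as a continuous linear map. -/
def coriolisHatL (n : ℤ) : (Fin 3 → Lp ℂ 2 (volume : Measure Plane)) →L[ℂ]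
    (Fin 3 → Lp ℂ 2 (volume : Measure Plane)) :=
  (ContinuousLinearMap.pi fun i => ∑ j, mulOp (projSym n i j) ∘L ContinuousLinearMap.proj j) ∘L
    crossHatL

theorem coriolisHatL_apply (n : ℤ) (g : Fin 3 → Lp ℂ 2 (volume : Measure Plane)) (i : Fin 3) :
    coriolisHatL n g i = projHat n (crossHat g) i := by
  simp [coriolisHatL, projHat, crossHatL_apply]

/-- The functional `Re ⟨g, ·⟩`. -/
def reInner (g : Lp ℂ 2 (volume : Measure Plane)) : Lp ℂ 2 (volume : Measure Plane) →L[ℝ] ℝ :=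
  Complex.reCLM ∘L (innerSL ℂ g).restrictScalars ℝ

theorem reInner_apply (g h : Lp ℂ 2 (volume : Measure Plane)) :
    reInner g h = (inner ℂ g h).re := rfl

/-! ### Resolvent, frequency cutoffs and uniqueness. -/

/-- The symbol of `-Δ` on the `n`-th vertical mode. -/
def lapSym (n : ℤ) (y : Plane) : ℝ := 4 * Real.pi ^ 2 * freqSq n y

theorem lapSym_nonneg (n : ℤ) (y : Plane) : 0 ≤ lapSym n y :=
  mul_nonneg (by positivity) (freqSq_nonneg n y)

theorem measurable_lapSym (n : ℤ) : Measurable (lapSym n) :=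
  measurable_const.mul (measurable_freqSq n)

theorem isSymbol_resolvent (n : ℤ) : IsSymbol fun y => (((1 + lapSym n y)⁻¹ : ℝ) : ℂ) := by
  refine ⟨Complex.measurable_ofReal.comp (measurable_const.add (measurable_lapSym n)).inv, 1,
    fun y => ?_⟩
  have := lapSym_nonneg n y
  rw [Complex.norm_real, Real.norm_of_nonneg (by positivity)]
  exact inv_le_one_of_one_le₀ (by linarith)

theorem isSymbol_lap_mul_resolvent (n : ℤ) :
    IsSymbol fun y => ((-lapSym n y * (1 + lapSym n y)⁻¹ : ℝ) : ℂ) := by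
  refine ⟨Complex.measurable_ofReal.comp ((measurable_lapSym n).neg.mul
    (measurable_const.add (measurable_lapSym n)).inv), 1, fun y => ?_⟩
  have := lapSym_nonneg n y
  rw [Complex.norm_real, Real.norm_eq_abs, abs_mul, abs_neg, abs_of_nonneg this,
    abs_of_nonneg (by positivity), ← div_eq_mul_inv]
  exact div_le_one_of_le₀ (by linarith) (by positivity)

theorem isSymbol_indicator_ball {m : Plane → ℂ} (hm : Measurable m) {N C : ℝ}
    (hC : ∀ y, ‖y‖ ≤ N → ‖m y‖ ≤ C) :
    IsSymbol (indicator (Metric.closedBall 0 N) m) := by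
  refine ⟨hm.indicator Metric.isClosed_closedBall.measurableSet, max C 0, fun y => ?_⟩
  by_cases hy : y ∈ Metric.closedBall (0 : Plane) N
  · rw [indicator_of_mem hy]
    exact (hC y (by simpa using hy)).trans (le_max_left _ _)
  · rw [indicator_of_notMem hy, norm_zero]
    exact le_max_right _ _

theorem lapSym_le {n : ℤ} {y : Plane} {N : ℝ} (hy : ‖y‖ ≤ N) :
    lapSym n y ≤ 4 * Real.pi ^ 2 * (N ^ 2 + (n : ℝ) ^ 2) := by
  rw [lapSym, freqSq_eq]
  gcongr

/-- This is the weak equation tested with `Re (φ(x) e^{2πinz})` in direction `i`, read on the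
Fourier side. -/
theorem IsSolution.hasDerivAt_reInner {Ω : ℝ} {u₀ : L2Field} {w : ℝ → L2Field}
    (hw : IsSolution Ω u₀ w) {φ : Plane → ℂ} (hφ : IsPlaneTest φ) (n : ℤ) (i : Fin 3) {t : ℝ}
    (ht : 0 < t) :
    HasDerivAt (fun s => reInner (𝓕 (hφ.memLp.toLp φ)) (hat n i (w s)))
      (reInner (𝓕 ((hφ.laplacian_amplitude n).memLp.toLp _)) (hat n i (w t)) -
        Ω * reInner (𝓕 (hφ.memLp.toLp φ)) (projHat n (crossHat fun j => hat n j (w t)) i)) t := by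
  have hf := (hφ.isTest_testMode n).clm_comp
    (Complex.reCLM.smulRight (EuclideanSpace.single i (1 : ℝ) : Vec3))
  have h := hw.hasDerivAt_inner hf ht
  have e1 : hf.memLp.toLp _ = embed n i (𝓕 (hφ.memLp.toLp φ)) := by
    ext1
    exact hf.memLp.coeFn_toLp.trans (hφ.embed_ae n i).symm
  have e2 : hf.laplacian.memLp.toLp _ =
      embed n i (𝓕 ((hφ.laplacian_amplitude n).memLp.toLp _)) := by
    ext1
    refine hf.laplacian.memLp.coeFn_toLp.trans ?_
    rw [(hφ.isTest_testMode n).laplacian_clm_comp, hφ.laplacian_testMode]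
    exact ((hφ.laplacian_amplitude n).embed_ae n i).symm
  rw [e1, e2] at h
  simp_rw [reInner_apply, ← hat_coriolis, ← inner_embed, real_inner_comm _ (embed _ _ _)]
  exact h

/-- Duhamel's formula for the Fourier coefficients of a solution, smoothed by a resolvent. -/
theorem IsSolution.resolvent_hat_eq {Ω : ℝ} {w : ℝ → L2Field} (hw : IsSolution Ω 0 w)
    (n : ℤ) {W : Fin 3 → ℝ → Lp ℂ 2 (volume : Measure Plane)} (hc : ∀ i, Continuous (W i))
    (hW : ∀ i t, 0 ≤ t → W i t = hat n i (w t)) (i : Fin 3) {t : ℝ} (ht : 0 ≤ t) :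
    mulOp (fun y => (((1 + lapSym n y)⁻¹ : ℝ) : ℂ)) (W i t) =
      ∫ s in (0 : ℝ)..t, (mulOp (fun y => ((-lapSym n y * (1 + lapSym n y)⁻¹ : ℝ) : ℂ)) (W i s) -
        Ω • mulOp (fun y => (((1 + lapSym n y)⁻¹ : ℝ) : ℂ))
          (projHat n (crossHat fun j => W j s) i)) := by
  have hcP : Continuous fun s => projHat n (crossHat fun j => W j s) i := by
    simp_rw [← coriolisHatL_apply]
    exact (continuous_apply i).comp ((coriolisHatL n).continuous.comp (continuous_pi hc))
  have hcI : Continuous fun s =>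
      (mulOp (fun y => ((-lapSym n y * (1 + lapSym n y)⁻¹ : ℝ) : ℂ)) (W i s) -
        Ω • mulOp (fun y => (((1 + lapSym n y)⁻¹ : ℝ) : ℂ))
          (projHat n (crossHat fun j => W j s) i)) :=
    ((mulOp _).continuous.comp (hc i)).sub
      (((mulOp _).continuous.comp hcP).const_smul Ω)
  set Θ := mulOp (fun y => (((1 + lapSym n y)⁻¹ : ℝ) : ℂ)) (W i t) -
      ∫ s in (0 : ℝ)..t, (mulOp (fun y => ((-lapSym n y * (1 + lapSym n y)⁻¹ : ℝ) : ℂ)) (W i s) -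
        Ω • mulOp (fun y => (((1 + lapSym n y)⁻¹ : ℝ) : ℂ))
          (projHat n (crossHat fun j => W j s) i)) with hΘ
  suffices h : Θ = 0 from sub_eq_zero.1 h
  have hne : ∀ y, (1 + lapSym n y) ≠ 0 := fun y => by have := lapSym_nonneg n y; positivity
  -- The test function is the amplitude of `(1 - Δ)(φ e^{2πinz})`. Its transform carries the factor
  -- `1 + lapSym`, which cancels the resolvent when it is paired with a resolvent-smoothed
  -- coefficient.
  have hψ : ∀ φ, IsPlaneTest φ → IsPlaneTest (fun x => φ x + (-1) * ∑ i, planeD n i (planeD n i φ) x) :=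
    fun φ hφ => hφ.add ((hφ.laplacian_amplitude n).const_mul (-1))
  have hL : ∀ φ (hφ : IsPlaneTest φ),
      (𝓕 ((hφ.laplacian_amplitude n).memLp.toLp _) : Lp ℂ 2 (volume : Measure Plane))
      =ᵐ[volume] fun y => -(lapSym n y : ℂ) * 𝓕 φ y := fun φ hφ => by
    refine (fourier_toLp_ae (hφ.laplacian_amplitude n).integrable _).trans
      (Filter.Eventually.of_forall fun y => ?_)
    simp only [hφ.fourier_laplacian, lapSym, freqSq]
    push_cast
    ring
  have hF : ∀ φ (hφ : IsPlaneTest φ),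
      (𝓕 ((hψ φ hφ).memLp.toLp _) : Lp ℂ 2 (volume : Measure Plane)) =ᵐ[volume]
        fun y => (1 + lapSym n y : ℝ) * 𝓕 φ y := fun φ hφ => by
    have e : (hψ φ hφ).memLp.toLp _ =
        hφ.memLp.toLp φ - (hφ.laplacian_amplitude n).memLp.toLp _ := by
      rw [← MemLp.toLp_sub]
      congr 1
      funext x
      simp [sub_eq_add_neg]
    have e' : (𝓕 (hφ.memLp.toLp φ - (hφ.laplacian_amplitude n).memLp.toLp _) :
        Lp ℂ 2 (volume : Measure Plane)) =
        𝓕 (hφ.memLp.toLp φ) - 𝓕 ((hφ.laplacian_amplitude n).memLp.toLp _) :=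
      map_sub (FourierTransform.fourierCLM ℂ (Lp ℂ 2 (volume : Measure Plane))) _ _
    rw [e, e']
    filter_upwards [hL φ hφ, fourier_toLp_ae hφ.integrable hφ.memLp,
      Lp.coeFn_sub (𝓕 (hφ.memLp.toLp φ)) (𝓕 ((hφ.laplacian_amplitude n).memLp.toLp _))]
      with y h1 h2 h3
    rw [h3, Pi.sub_apply, h1, h2]
    push_cast
    ring
  have hm1 : ∀ φ (hφ : IsPlaneTest φ) (g : Lp ℂ 2 (volume : Measure Plane)),
      reInner (𝓕 ((hψ φ hφ).memLp.toLp _)) (mulOp (fun y => (((1 + lapSym n y)⁻¹ : ℝ) : ℂ)) g) =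
        reInner (𝓕 (hφ.memLp.toLp φ)) g := fun φ hφ g => by
    rw [reInner_apply, reInner_apply, inner_mulOp_right (isSymbol_resolvent n)]
    congr 2
    ext1
    filter_upwards [mulOp_ae (isSymbol_resolvent n).conj (𝓕 ((hψ φ hφ).memLp.toLp _)), hF φ hφ,
      fourier_toLp_ae hφ.integrable hφ.memLp] with y h1 h2 h3
    rw [h1, h2, h3, Complex.conj_ofReal, ← mul_assoc, ← Complex.ofReal_mul,
      inv_mul_cancel₀ (hne y), Complex.ofReal_one, one_mul]
  have hm2 : ∀ φ (hφ : IsPlaneTest φ) (g : Lp ℂ 2 (volume : Measure Plane)),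
      reInner (𝓕 ((hψ φ hφ).memLp.toLp _))
        (mulOp (fun y => ((-lapSym n y * (1 + lapSym n y)⁻¹ : ℝ) : ℂ)) g) =
        reInner (𝓕 ((hφ.laplacian_amplitude n).memLp.toLp _)) g := fun φ hφ g => by
    rw [reInner_apply, reInner_apply, inner_mulOp_right (isSymbol_lap_mul_resolvent n)]
    congr 2
    ext1
    filter_upwards [mulOp_ae (isSymbol_lap_mul_resolvent n).conj (𝓕 ((hψ φ hφ).memLp.toLp _)),
      hF φ hφ, hL φ hφ] with y h1 h2 h3
    rw [h1, h2, h3, Complex.conj_ofReal, ← mul_assoc, ← Complex.ofReal_mul, mul_assoc,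
      inv_mul_cancel₀ (hne y), mul_one, Complex.ofReal_neg]
  -- Pairing `Θ` with the transform of the modified test function is pairing `(1 + lapSym) Θ` with
  -- `𝓕 φ`. That product need not be square integrable, but its products with the transforms of test
  -- functions are integrable.
  have key := ae_eq_zero_of_integral_test (H := fun y => ((1 + lapSym n y : ℝ) : ℂ) * Θ y)
    (fun φ hφ => by
      refine (integrable_inner_fun (𝓕 ((hψ φ hφ).memLp.toLp _)) Θ).congr ?_
      filter_upwards [hF φ hφ] with y hy
      rw [hy, map_mul, Complex.conj_ofReal]
      ring)
    (fun φ hφ => by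
      have e : (∫ y, starRingEnd ℂ (𝓕 φ y) * (((1 + lapSym n y : ℝ) : ℂ) * Θ y)).re =
          reInner (𝓕 ((hψ φ hφ).memLp.toLp _)) Θ := by
        rw [reInner_apply, inner_eq_integral]
        congr 1
        refine integral_congr_ae ?_
        filter_upwards [hF φ hφ] with y hy
        rw [hy, map_mul, Complex.conj_ofReal]
        ring
      rw [e, hΘ, map_sub, ← ContinuousLinearMap.intervalIntegral_comp_comm _
        (hcI.intervalIntegrable 0 t)]
      have hm3 : ∀ s, reInner (𝓕 ((hψ φ hφ).memLp.toLp _))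
          (mulOp (fun y => ((-lapSym n y * (1 + lapSym n y)⁻¹ : ℝ) : ℂ)) (W i s) -
            Ω • mulOp (fun y => (((1 + lapSym n y)⁻¹ : ℝ) : ℂ))
              (projHat n (crossHat fun j => W j s) i)) =
          reInner (𝓕 ((hφ.laplacian_amplitude n).memLp.toLp _)) (W i s) -
            Ω • reInner (𝓕 (hφ.memLp.toLp φ)) (projHat n (crossHat fun j => W j s) i) :=
        fun s => by rw [map_sub, map_smul, hm1 φ hφ, hm2 φ hφ]
      simp_rw [hm3]
      rw [hm1 φ hφ]
      -- The equation is available only at positive times; continuity up to `0` lets the fundamental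
      -- theorem of calculus reach the zero initial value.
      have hF1 : ContinuousOn (fun s => reInner (𝓕 (hφ.memLp.toLp φ)) (W i s)) (Icc 0 t) :=
        ((reInner _).continuous.comp (hc i)).continuousOn
      have hF2 : ∀ s ∈ Ioo 0 t, HasDerivAt (fun s => reInner (𝓕 (hφ.memLp.toLp φ)) (W i s))
          (reInner (𝓕 ((hφ.laplacian_amplitude n).memLp.toLp _)) (W i s) -
            Ω • reInner (𝓕 (hφ.memLp.toLp φ)) (projHat n (crossHat fun j => W j s) i)) s := by
        intro s hs
        have := hw.hasDerivAt_reInner hφ n i hs.1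
        simp_rw [hW _ s hs.1.le]
        refine this.congr_of_eventuallyEq ?_
        filter_upwards [lt_mem_nhds hs.1] with r hr
        rw [hW i r hr.le]
      have hF3 : Continuous fun s =>
          (reInner (𝓕 ((hφ.laplacian_amplitude n).memLp.toLp _)) (W i s) -
            Ω • reInner (𝓕 (hφ.memLp.toLp φ)) (projHat n (crossHat fun j => W j s) i)) :=
        ((reInner _).continuous.comp (hc i)).sub
          (((reInner _).continuous.comp hcP).const_smul Ω)
      rw [intervalIntegral.integral_eq_sub_of_hasDerivAt_of_le ht hF1 hF2
        (hF3.intervalIntegrable 0 t), hW i 0 le_rfl, hw.initial]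
      rw [← hatL_apply, map_zero, map_zero, sub_zero, sub_self])
  rw [Lp.eq_zero_iff_ae_eq_zero]
  filter_upwards [key] with y hy
  refine (mul_eq_zero.1 hy).resolve_left ?_
  exact_mod_cast hne y

/-- On `‖y‖ ≤ N` the Laplacian of a fixed mode is a bounded multiplier. The truncated, smoothed
coefficients thus solve a linear ODE with Lipschitz right-hand side and zero data. Both `N` and the
mode are arbitrary, and the resolvent symbol never vanishes. -/
theorem IsSolution.eq_zero {Ω : ℝ} {w : ℝ → L2Field} (hw : IsSolution Ω 0 w) {t : ℝ}
    (ht : 0 ≤ t) : w t = 0 := by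
  refine eq_zero_of_hat_eq_zero fun n => ?_
  -- Freezing the solution at negative times gives coefficients continuous on the whole line, since
  -- `w` is controlled only for nonnegative times.
  let W : Fin 3 → ℝ → Lp ℂ 2 (volume : Measure Plane) := fun i s => hatL n i (w (max s 0))
  have hc : ∀ i, Continuous (W i) := fun i => by
    refine (hatL n i).continuous.comp ?_
    exact hw.continuousOn.comp_continuous (continuous_id.max continuous_const)
      fun s => le_max_right s 0
  have hW : ∀ i s, 0 ≤ s → W i s = hat n i (w s) := fun i s hs => by
    simp only [W, hatL_apply, max_eq_left hs]
  have hres := isSymbol_resolvent n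
  have hlap := isSymbol_lap_mul_resolvent n
  have hcut : ∀ N : ℕ, ∀ i, mulOp (indicator (Metric.closedBall 0 (N : ℝ)) fun _ => (1 : ℂ))
      (mulOp (fun y => (((1 + lapSym n y)⁻¹ : ℝ) : ℂ)) (W i t)) = 0 := fun N => by
    have hχ : IsSymbol (indicator (Metric.closedBall (0 : Plane) (N : ℝ)) fun _ => (1 : ℂ)) :=
      isSymbol_indicator_ball measurable_const (C := 1) (by simp)
    have hχ' : IsSymbol (indicator (Metric.closedBall (0 : Plane) (N : ℝ))
        fun y => ((-lapSym n y : ℝ) : ℂ)) := by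
      refine isSymbol_indicator_ball (C := 4 * Real.pi ^ 2 * ((N : ℝ) ^ 2 + (n : ℝ) ^ 2))
        (Complex.measurable_ofReal.comp (measurable_lapSym n).neg) fun y hy => ?_
      simp only [Function.comp_apply, Pi.neg_apply]
      rw [Complex.norm_real, norm_neg, Real.norm_of_nonneg (lapSym_nonneg n y)]
      exact lapSym_le hy
    let χ := mulOp (indicator (Metric.closedBall (0 : Plane) (N : ℝ)) fun _ => (1 : ℂ))
    let Y : ℝ → Fin 3 → Lp ℂ 2 (volume : Measure Plane) := fun s i =>
      χ (mulOp (fun y => (((1 + lapSym n y)⁻¹ : ℝ) : ℂ)) (W i s))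
    -- The generator is the truncated Laplacian minus `Ω` times the Coriolis operator. The
    -- truncation makes it bounded and changes nothing on the truncated coefficients `Y`.
    let D : (Fin 3 → Lp ℂ 2 (volume : Measure Plane)) →L[ℂ]
        (Fin 3 → Lp ℂ 2 (volume : Measure Plane)) :=
      (ContinuousLinearMap.pi fun i => mulOp (indicator (Metric.closedBall (0 : Plane) (N : ℝ))
        fun y => ((-lapSym n y : ℝ) : ℂ)) ∘L ContinuousLinearMap.proj i) - (Ω : ℂ) • coriolisHatL n
    have hYc : Continuous Y := continuous_pi fun i =>
      χ.continuous.comp ((mulOp _).continuous.comp (hc i))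
    have hDY : ∀ s i, D (Y s) i = χ (mulOp (fun y => ((-lapSym n y * (1 + lapSym n y)⁻¹ : ℝ) : ℂ))
        (W i s) - Ω • mulOp (fun y => (((1 + lapSym n y)⁻¹ : ℝ) : ℂ))
          (projHat n (crossHat fun j => W j s) i)) := fun s i => by
      have e1 : D (Y s) i = mulOp (indicator (Metric.closedBall (0 : Plane) (N : ℝ))
          fun y => ((-lapSym n y : ℝ) : ℂ)) (Y s i) - (Ω : ℂ) • coriolisHatL n (Y s) i := rfl
      rw [e1, coriolisHatL_apply, map_sub]
      congr 1
      · simp only [Y, χ]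
        rw [mulOp_mulOp hχ hres, mulOp_mulOp hχ' (hχ.mul hres), mulOp_mulOp hχ hlap]
        congr 2
        funext y
        by_cases hy : y ∈ Metric.closedBall (0 : Plane) (N : ℝ)
        · simp only [indicator_of_mem hy]; push_cast; ring
        · simp only [indicator_of_notMem hy]; ring
      · rw [Complex.coe_smul, mulOp_projHat_crossHat hres]
        simp only [Y, χ]
        rw [← mulOp_projHat_crossHat hχ]
        exact ((mulOp _).restrictScalars ℝ).map_smul Ω _ |>.symm
    have hY : ∀ s, 0 ≤ s → Y s = ∫ r in (0 : ℝ)..s, D (Y r) := fun s hs => by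
      funext i
      have hcD : Continuous fun r => D (Y r) := D.continuous.comp hYc
      have e2 : (∫ r in (0 : ℝ)..s, D (Y r)) i = ∫ r in (0 : ℝ)..s, D (Y r) i :=
        (ContinuousLinearMap.intervalIntegral_comp_comm
          (ContinuousLinearMap.proj (R := ℝ) (φ := fun _ : Fin 3 => Lp ℂ 2 (volume : Measure Plane)) i)
          (hcD.intervalIntegrable 0 s)).symm
      rw [e2]
      simp_rw [hDY]
      have hcP : Continuous fun s => projHat n (crossHat fun j => W j s) i := by
        simp_rw [← coriolisHatL_apply]
        exact (continuous_apply i).comp ((coriolisHatL n).continuous.comp (continuous_pi hc))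
      rw [ContinuousLinearMap.intervalIntegral_comp_comm]
      · rw [← hw.resolvent_hat_eq n hc hW i hs]
      · exact (((mulOp _).continuous.comp (hc i)).sub
          (((mulOp _).continuous.comp hcP).const_smul Ω)).intervalIntegrable 0 s
    have hY0 : EqOn Y (fun _ => 0) (Icc 0 t) := by
      refine ODE_solution_unique (v := fun _ => D) (K := ‖D‖₊) (fun _ => D.lipschitz)
        hYc.continuousOn (fun s hs => ?_) continuousOn_const (fun s _ => ?_) ?_
      · have hcD : Continuous fun r => D (Y r) := D.continuous.comp hYc
        have h1 := (intervalIntegral.integral_hasDerivAt_right (hcD.intervalIntegrable 0 s)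
          (hcD.stronglyMeasurableAtFilter _ _) hcD.continuousAt).hasDerivWithinAt (s := Ici s)
        exact h1.congr (fun r hr => hY r (hs.1.trans hr)) (hY s hs.1)
      · rw [map_zero]; exact hasDerivWithinAt_const _ _ _
      · rw [hY 0 le_rfl, intervalIntegral.integral_same]
    intro i
    exact congrFun (hY0 ⟨ht, le_rfl⟩) i
  intro i
  rw [← hW i t ht, Lp.eq_zero_iff_ae_eq_zero]
  have h1 : ∀ᵐ y : Plane, ∀ N : ℕ, indicator (Metric.closedBall (0 : Plane) (N : ℝ))
      (fun _ => (1 : ℂ)) y * ((((1 + lapSym n y)⁻¹ : ℝ) : ℂ) * W i t y) = 0 := by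
    rw [ae_all_iff]
    intro N
    have hχ : IsSymbol (indicator (Metric.closedBall (0 : Plane) (N : ℝ)) fun _ => (1 : ℂ)) :=
      isSymbol_indicator_ball measurable_const (C := 1) (by simp)
    have h2 := mulOp_ae hχ (mulOp (fun y => (((1 + lapSym n y)⁻¹ : ℝ) : ℂ)) (W i t))
    rw [hcut N i] at h2
    filter_upwards [h2, mulOp_ae hres (W i t), Lp.coeFn_zero ℂ 2 (volume : Measure Plane)]
      with y h3 h4 h5
    rw [← h4, ← h3, h5]; rfl
  filter_upwards [h1] with y hy
  -- The exceptional null set is common to all cutoffs, so `N` may be chosen depending on `y`.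
  obtain ⟨N, hN⟩ := exists_nat_ge ‖y‖
  have h2 := hy N
  rw [indicator_of_mem (by simpa using hN), one_mul] at h2
  have h3 : (1 + lapSym n y)⁻¹ ≠ 0 := by have := lapSym_nonneg n y; positivity
  exact (mul_eq_zero.1 h2).resolve_left (by exact_mod_cast h3)

theorem IsSolution.unique {Ω : ℝ} {u₀ : L2Field} {u v : ℝ → L2Field}
    (hu : IsSolution Ω u₀ u) (hv : IsSolution Ω u₀ v) : EqOn v u (Ici 0) := by
  intro t ht
  have h := hv.add_smul hu (-1)
  rw [neg_one_smul, add_neg_cancel] at h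
  have := h.eq_zero ht
  rwa [neg_one_smul, ← sub_eq_add_neg, sub_eq_zero] at this

/-! ### Exponentials of multiplication operators -/

theorem IsSymbol.exp {m : Plane → ℂ} (hm : IsSymbol m) (t : ℝ) :
    IsSymbol fun y => Complex.exp (t * m y) := by
  obtain ⟨h, C, hC⟩ := hm
  refine ⟨Complex.measurable_exp.comp (measurable_const.mul h), Real.exp (|t| * C), fun y => ?_⟩
  rw [Complex.norm_exp]
  refine Real.exp_le_exp.2 ((Complex.re_le_norm _).trans ?_)
  rw [norm_mul, Complex.norm_real, Real.norm_eq_abs]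
  exact mul_le_mul_of_nonneg_left (hC y) (abs_nonneg t)

/-- Since `m` is bounded, the Taylor remainder of the exponential is quadratic in the time increment
uniformly in `y`, and this bound passes to the `L²` norm. -/
theorem hasDerivAt_mulOp_exp {m : Plane → ℂ} (hm : IsSymbol m)
    (g : Lp ℂ 2 (volume : Measure Plane)) (t : ℝ) :
    HasDerivAt (fun s : ℝ => mulOp (fun y => Complex.exp (s * m y)) g)
      (mulOp m (mulOp (fun y => Complex.exp (t * m y)) g)) t := by
  rw [hasDerivAt_iff_isLittleO_nhds_zero]
  obtain ⟨C, hC⟩ := hm.2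
  have hC0 : 0 ≤ C := (norm_nonneg _).trans (hC 0)
  refine Asymptotics.IsBigO.trans_isLittleO (g := fun h : ℝ => h ^ 2) ?_
    (Asymptotics.isLittleO_pow_id one_lt_two)
  refine Asymptotics.IsBigO.of_bound (Real.exp (|t| * C) * C ^ 2 * ‖g‖) ?_
  have hev : ∀ᶠ h : ℝ in nhds 0, |h| * C ≤ 1 := by
    have : Filter.Tendsto (fun h : ℝ => |h| * C) (nhds 0) (nhds (|0| * C)) :=
      (continuous_abs.mul continuous_const).tendsto 0
    rw [abs_zero, zero_mul] at this
    exact this.eventually (Iic_mem_nhds one_pos)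
  filter_upwards [hev] with h hh
  have key : ‖mulOp (fun y => Complex.exp (((t + h : ℝ) : ℂ) * m y)) g -
      mulOp (fun y => Complex.exp (t * m y)) g -
      h • mulOp m (mulOp (fun y => Complex.exp (t * m y)) g)‖ ≤
      (Real.exp (|t| * C) * (C ^ 2 * h ^ 2)) * ‖g‖ := by
    refine Lp.norm_le_mul_norm_of_ae_le_mul ?_
    filter_upwards [mulOp_ae (hm.exp (t + h)) g, mulOp_ae (hm.exp t) g,
      mulOp_ae hm (mulOp (fun y => Complex.exp (t * m y)) g),
      Lp.coeFn_sub (mulOp (fun y => Complex.exp (((t + h : ℝ) : ℂ) * m y)) g -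
        mulOp (fun y => Complex.exp (t * m y)) g)
        (h • mulOp m (mulOp (fun y => Complex.exp (t * m y)) g)),
      Lp.coeFn_sub (mulOp (fun y => Complex.exp (((t + h : ℝ) : ℂ) * m y)) g)
        (mulOp (fun y => Complex.exp (t * m y)) g),
      Lp.coeFn_smul h (mulOp m (mulOp (fun y => Complex.exp (t * m y)) g))]
      with y h1 h2 h3 h4 h5 h6
    rw [h4, Pi.sub_apply, h5, Pi.sub_apply, h6, Pi.smul_apply, h3, h1, h2, Complex.real_smul]
    have e : Complex.exp (((t + h : ℝ) : ℂ) * m y) * g y - Complex.exp (t * m y) * g y -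
        h * (m y * (Complex.exp (t * m y) * g y)) =
        (Complex.exp (t * m y) * (Complex.exp (h * m y) - 1 - h * m y)) * g y := by
      rw [show ((t + h : ℝ) : ℂ) * m y = t * m y + h * m y by push_cast; ring, Complex.exp_add]
      ring
    rw [e, norm_mul, norm_mul]
    have hn : ‖(h : ℂ) * m y‖ ≤ |h| * C := by
      rw [norm_mul, Complex.norm_real, Real.norm_eq_abs]
      exact mul_le_mul_of_nonneg_left (hC y) (abs_nonneg h)
    have b1 : ‖Complex.exp (h * m y) - 1 - h * m y‖ ≤ C ^ 2 * h ^ 2 := by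
      refine (Complex.norm_exp_sub_one_sub_id_le (hn.trans hh)).trans ?_
      calc ‖(h : ℂ) * m y‖ ^ 2 ≤ (|h| * C) ^ 2 := pow_le_pow_left₀ (norm_nonneg _) hn 2
        _ = C ^ 2 * h ^ 2 := by rw [mul_pow, sq_abs]; ring
    have b2 : ‖Complex.exp (t * m y)‖ ≤ Real.exp (|t| * C) := by
      rw [Complex.norm_exp]
      refine Real.exp_le_exp.2 ((Complex.re_le_norm _).trans ?_)
      rw [norm_mul, Complex.norm_real, Real.norm_eq_abs]
      exact mul_le_mul_of_nonneg_left (hC y) (abs_nonneg t)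
    gcongr
  refine key.trans (le_of_eq ?_)
  rw [Real.norm_of_nonneg (sq_nonneg h)]
  ring

/-! ### Solutions with one vertical mode -/

theorem crossE3_embed (n : ℤ) (h : Lp ℂ 2 (volume : Measure Plane)) :
    crossE3.compLp (embed n 0 h) = embed n 1 h ∧
    crossE3.compLp (embed n 1 h) = embed n 0 (-h) ∧ crossE3.compLp (embed n 2 h) = 0 := by
  refine ⟨?_, ?_, ?_⟩
  · ext1
    filter_upwards [crossE3.coeFn_compLp (embed n 0 h), embed_ae n 0 h, embed_ae n 1 h]
      with p h1 h2 h3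
    rw [h1, h2, h3]
    ext i
    rw [crossE3_apply]
    fin_cases i <;> simp
  · rw [map_neg]
    ext1
    filter_upwards [crossE3.coeFn_compLp (embed n 1 h), embed_ae n 0 h, embed_ae n 1 h,
      Lp.coeFn_neg (embed n 0 h)] with p h1 h2 h3 h4
    rw [h1, h4, Pi.neg_apply, h2, h3]
    ext i
    rw [crossE3_apply]
    fin_cases i <;> simp
  · ext1
    filter_upwards [crossE3.coeFn_compLp (embed n 2 h), embed_ae n 2 h,
      Lp.coeFn_zero Vec3 2 (volume : Measure Layer)] with p h1 h2 h3
    rw [h1, h2, h3]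
    ext i
    rw [crossE3_apply]
    fin_cases i <;> simp

theorem coriolis_sum_embed (n : ℤ) (g : Fin 3 → Lp ℂ 2 (volume : Measure Plane)) :
    coriolis (∑ i, embed n i (g i)) = ∑ i, embed n i (projHat n (crossHat g) i) := by
  rw [← leray_sum_embed, coriolis]
  congr 1
  have := map_sum (crossE3.compLpL 2 (volume : Measure Layer)) (fun i => embed n i (g i))
    Finset.univ
  refine this.trans ?_
  rw [Fin.sum_univ_three, Fin.sum_univ_three]
  change crossE3.compLp _ + crossE3.compLp _ + crossE3.compLp _ = _
  rw [(crossE3_embed n (g 0)).1, (crossE3_embed n (g 1)).2.1, (crossE3_embed n (g 2)).2.2]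
  rw [show crossHat g 0 = -g 1 from rfl, show crossHat g 1 = g 0 from rfl,
    show crossHat g 2 = 0 from rfl, map_zero, add_comm (embed n 1 (g 0))]

theorem projHat_crossHat_ae (n : ℤ) (g : Fin 3 → Lp ℂ 2 (volume : Measure Plane)) :
    ∀ᵐ y, ∀ i, projHat n (crossHat g) i y = ∑ j, projSym n i j y * crossHat (fun k => g k y) j := by
  have h : ∀ᵐ y, ∀ j, crossHat g j y = crossHat (fun k => g k y) j := by
    rw [ae_all_iff]
    intro j
    fin_cases j
    · exact Lp.coeFn_neg (g 1)
    · exact Filter.Eventually.of_forall fun _ => rfl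
    · exact Lp.coeFn_zero ℂ 2 (volume : Measure Plane)
  filter_upwards [projHat_ae n (crossHat g), h] with y h1 h2 i
  rw [h1]
  simp_rw [h2]

/-- The symbol `ν - |ξ|²`, cut off at frequency `N`. -/
def waveSym (n : ℤ) (N : ℝ) (ν : Plane → ℂ) : Plane → ℂ :=
  indicator (Metric.closedBall 0 N) fun y => ν y - lapSym n y

theorem isSymbol_waveSym (n : ℤ) (N : ℝ) {ν : Plane → ℂ} (hν : IsSymbol ν) :
    IsSymbol (waveSym n N ν) := by
  obtain ⟨h, C, hC⟩ := hν
  refine isSymbol_indicator_ball (C := C + 4 * Real.pi ^ 2 * (N ^ 2 + (n : ℝ) ^ 2))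
    (h.sub (Complex.measurable_ofReal.comp (measurable_lapSym n))) fun y hy => ?_
  refine (norm_sub_le _ _).trans (add_le_add (hC y) ?_)
  simp only [Function.comp_apply]
  rw [Complex.norm_real, Real.norm_of_nonneg (lapSym_nonneg n y)]
  exact lapSym_le hy

/-- Eigenvectors of the Coriolis operator with bounded frequencies give solutions. -/
theorem isSolution_wave {Ω : ℝ} (n : ℤ) (N : ℝ) {ν : Plane → ℂ} (hν : IsSymbol ν)
    (a : Fin 3 → Lp ℂ 2 (volume : Measure Plane))
    (hsupp : ∀ᵐ y, N < ‖y‖ → ∀ i, a i y = 0)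
    (hdiv : ∀ᵐ y, ∑ i, (freq n y i : ℂ) * a i y = 0)
    (heig : ∀ᵐ y, ∀ i, Ω * ∑ j, projSym n i j y * crossHat (fun k => a k y) j = -ν y * a i y) :
    IsSolution Ω (∑ i, embed n i (a i)) (fun t => ∑ i, embed n i
      (mulOp (fun y => Complex.exp (t * waveSym n N ν y)) (a i))) := by
  have hw := isSymbol_waveSym n N hν
  have hE : ∀ t : ℝ, ∀ᵐ y, ∀ i, mulOp (fun y => Complex.exp (t * waveSym n N ν y)) (a i) y =
      Complex.exp (t * waveSym n N ν y) * a i y := fun t =>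
    ae_all_iff.2 fun i => mulOp_ae (hw.exp t) (a i)
  have hD : ∀ (i : Fin 3) (t : ℝ), HasDerivAt (fun s : ℝ => mulOp (fun y => Complex.exp (s * waveSym n N ν y)) (a i))
      (mulOp (waveSym n N ν) (mulOp (fun y => Complex.exp (t * waveSym n N ν y)) (a i))) t :=
    fun i t => hasDerivAt_mulOp_exp hw (a i) t
  refine IsSolution.of_hasDerivAt_inner ?_ ?_ (fun t _ => ?_) fun f hf t ht => ?_
  · refine Continuous.continuousOn (continuous_finsetSum _ fun i _ => (embed n i).continuous.comp ?_)
    exact continuous_iff_continuousAt.2 fun t => (hD i t).continuousAt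
  · refine Finset.sum_congr rfl fun i _ => ?_
    congr 1
    ext1
    filter_upwards [hE 0] with y hy
    rw [hy, Complex.ofReal_zero, zero_mul, Complex.exp_zero, one_mul]
  · refine isDivFree_sum_embed n _ ?_
    filter_upwards [hE t, hdiv] with y h1 h2
    simp_rw [h1]
    calc _ = Complex.exp (t * waveSym n N ν y) * ∑ i, (freq n y i : ℂ) * a i y := by
          rw [Finset.mul_sum]
          exact Finset.sum_congr rfl fun i _ => by ring
      _ = 0 := by rw [h2, mul_zero]
  · rw [coriolis_sum_embed]
    simp_rw [sum_inner, inner_embed]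
    have h1 : HasDerivAt (fun s : ℝ => ∑ i, (inner ℂ
        (mulOp (fun y => Complex.exp (s * waveSym n N ν y)) (a i))
        (hat n i (hf.memLp.toLp f))).re)
        (∑ i, (inner ℂ (mulOp (waveSym n N ν)
          (mulOp (fun y => Complex.exp (t * waveSym n N ν y)) (a i)))
          (hat n i (hf.memLp.toLp f))).re) t := by
      refine HasDerivAt.fun_sum fun i _ => ?_
      have h2 := (reInner (hat n i (hf.memLp.toLp f))).hasFDerivAt.comp_hasDerivAt t (hD i t)
      simp only [Function.comp_def, reInner_apply] at h2
      convert h2 using 1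
      · funext s
        rw [← inner_conj_symm, Complex.conj_re]
      · rw [← inner_conj_symm, Complex.conj_re]
    refine h1.congr_deriv ?_
    rw [Finset.mul_sum, ← Finset.sum_sub_distrib]
    refine Finset.sum_congr rfl fun i _ => ?_
    simp only [inner_eq_integral]
    rw [← Complex.re_ofReal_mul, ← Complex.sub_re, ← integral_const_mul,
      ← integral_sub (integrable_inner_fun _ _) ((integrable_inner_fun _ _).const_mul _)]
    congr 1
    refine integral_congr_ae ?_
    filter_upwards [hE t, hsupp, heig, projHat_crossHat_ae n
      (fun i => mulOp (fun y => Complex.exp (t * waveSym n N ν y)) (a i)),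
      hat_laplacian_ae hf n i, mulOp_ae hw
        (mulOp (fun y => Complex.exp (t * waveSym n N ν y)) (a i))] with y h1 h2 h3 h4 h5 h6
    rw [h6, h5, h4, h1]
    have h7 : ∑ j, projSym n i j y * crossHat (fun k =>
        mulOp (fun y => Complex.exp (t * waveSym n N ν y)) (a k) y) j =
        Complex.exp (t * waveSym n N ν y) * ∑ j, projSym n i j y * crossHat (fun k => a k y) j := by
      simp_rw [h1]
      rw [Finset.mul_sum]
      refine Finset.sum_congr rfl fun j _ => ?_
      have := crossHat_map (AddMonoidHom.mulLeft (Complex.exp (t * waveSym n N ν y)))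
        (fun k => a k y) j
      simp only [AddMonoidHom.coe_mulLeft] at this
      rw [← this]
      ring
    have h8 : (Ω : ℂ) * starRingEnd ℂ (∑ j, projSym n i j y * crossHat (fun k =>
        mulOp (fun y => Complex.exp (t * waveSym n N ν y)) (a k) y) j) =
        starRingEnd ℂ (Complex.exp (t * waveSym n N ν y) * (-ν y * a i y)) := by
      rw [h7, ← h3 i, ← Complex.conj_ofReal Ω, ← map_mul, Complex.conj_ofReal]
      congr 1
      ring
    rw [← mul_assoc (Ω : ℂ), h8]
    -- Inside the ball the exponent is the true symbol `ν - lapSym`. Outside it the cutoff is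
    -- harmless because the amplitudes vanish.
    by_cases hy : y ∈ Metric.closedBall (0 : Plane) N
    · have h9 : waveSym n N ν y = ν y - lapSym n y := indicator_of_mem hy _
      rw [h9]
      simp only [map_mul, map_sub, map_neg, Complex.conj_ofReal, lapSym, freqSq]
      push_cast
      ring
    · rw [h2 (by simpa using hy) i]
      simp

/-! ### The dispersive estimate -/

/-- The amplitude `e^{iτ(M+ρ)^{-1/2}} (M+ρ)^{-3/2} e^{-αρ}`, where `ρ` is a squared frequency. -/
def oscAmp (τ M α ρ : ℝ) : ℂ :=
  Complex.exp ((τ * (√(M + ρ))⁻¹ : ℝ) * Complex.I) *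
    (((√(M + ρ) ^ 3)⁻¹ * Real.exp (-α * ρ) : ℝ) : ℂ)

theorem norm_oscAmp (τ M α ρ : ℝ) :
    ‖oscAmp τ M α ρ‖ = (√(M + ρ) ^ 3)⁻¹ * Real.exp (-α * ρ) := by
  rw [oscAmp, norm_mul, Complex.norm_exp_ofReal_mul_I, one_mul, Complex.norm_real,
    Real.norm_of_nonneg (by positivity)]

theorem norm_oscAmp_le (τ : ℝ) {M : ℝ} (hM : 1 ≤ M) (α : ℝ) {ρ : ℝ} (hρ : 0 ≤ ρ) :
    ‖oscAmp τ M α ρ‖ ≤ Real.exp (-α * ρ) := by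
  rw [norm_oscAmp]
  have h1 : 1 ≤ √(M + ρ) := Real.one_le_sqrt.2 (by linarith)
  have h2 : (√(M + ρ) ^ 3)⁻¹ ≤ 1 := inv_le_one_of_one_le₀ (one_le_pow₀ h1)
  exact mul_le_of_le_one_left (Real.exp_pos _).le h2

theorem measurable_oscAmp (τ M α : ℝ) : Measurable (oscAmp τ M α) := by
  unfold oscAmp
  fun_prop

/-- The non-stationary part of the oscillatory integral, by integration by parts. -/
theorem norm_integral_Ioi_oscAmp_le {τ M α δ : ℝ} (hτ : τ ≠ 0) (hM : 1 ≤ M) (hα : 0 < α)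
    (hδ : 0 < δ) : ‖∫ q in Ioi δ, oscAmp τ M α (q ^ 2)‖ ≤ 2 / (|τ| * δ) := by
  have hτ' : (τ : ℂ) ≠ 0 := by exact_mod_cast hτ
  -- The phase derivative contains exactly the factor `(M + q²)^{-3/2}` of the amplitude. Dividing
  -- the amplitude by it leaves only `e^{-αq²}/q`, up to a factor of modulus `1/|τ|`.
  have hS : ∀ q : ℝ, HasDerivAt (fun q : ℝ => (√(M + q ^ 2))⁻¹) (-q * (√(M + q ^ 2) ^ 3)⁻¹) q := by
    intro q
    have hp : 0 < M + q ^ 2 := by positivity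
    have hs : √(M + q ^ 2) ≠ 0 := (Real.sqrt_pos.2 hp).ne'
    have h1 : HasDerivAt (fun q : ℝ => M + q ^ 2) (2 * q) q := by
      simpa using (hasDerivAt_pow 2 q).const_add M
    have h2 := (h1.sqrt hp.ne').inv hs
    refine h2.congr_deriv ?_
    field_simp
  have hk : ∀ q : ℝ, 0 < q → HasDerivAt (fun q : ℝ => Real.exp (-α * q ^ 2) / q)
      (-((2 * α + 1 / q ^ 2) * Real.exp (-α * q ^ 2))) q := by
    intro q hq
    have h1 : HasDerivAt (fun q : ℝ => -α * q ^ 2) (-α * (2 * q)) q := by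
      simpa using (hasDerivAt_pow 2 q).const_mul (-α)
    have h2 := h1.exp.div (hasDerivAt_id q) hq.ne'
    refine h2.congr_deriv ?_
    simp only [id]
    field_simp
    ring
  have hk0 : Filter.Tendsto (fun q : ℝ => Real.exp (-α * q ^ 2) / q) Filter.atTop (nhds 0) := by
    refine squeeze_zero_norm' ?_ tendsto_inv_atTop_zero
    filter_upwards [Filter.eventually_gt_atTop 0] with q hq
    rw [Real.norm_of_nonneg (by positivity), inv_eq_one_div]
    gcongr
    exact Real.exp_le_one_iff.2 (by nlinarith [sq_nonneg q])
  -- Monotonicity of `e^{-αq²}/q` makes its total variation on `(δ, ∞)` equal to its value at `δ`.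
  -- The integral term left by the integration by parts is then bounded by `1/δ`, like the boundary
  -- term, whatever `M` and `α` are.
  have hkneg : ∀ q ∈ Ioi δ, -((2 * α + 1 / q ^ 2) * Real.exp (-α * q ^ 2)) ≤ 0 := fun q _ => by
    have : 0 ≤ (2 * α + 1 / q ^ 2) * Real.exp (-α * q ^ 2) := by positivity
    linarith
  have hk' : ∀ q ∈ Ici δ, HasDerivAt (fun q : ℝ => Real.exp (-α * q ^ 2) / q)
      (-((2 * α + 1 / q ^ 2) * Real.exp (-α * q ^ 2))) q := fun q hq => hk q (hδ.trans_le hq)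
  have hkint := integrableOn_Ioi_deriv_of_nonpos' hk' hkneg hk0
  have hkval := integral_Ioi_of_hasDerivAt_of_nonpos' hk' hkneg hk0
  set e : ℝ → ℂ := fun q => Complex.exp ((τ * (√(M + q ^ 2))⁻¹ : ℝ) * Complex.I) with he
  have hed : ∀ q, HasDerivAt e
      (e q * ((τ * (-q * (√(M + q ^ 2) ^ 3)⁻¹) : ℝ) * Complex.I)) q := fun q =>
    ((((hS q).const_mul τ).ofReal_comp).mul_const Complex.I).cexp
  have hec : Continuous e := continuous_iff_continuousAt.2 fun q => (hed q).continuousAt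
  have hen : ∀ q, ‖e q‖ = 1 := fun q => Complex.norm_exp_ofReal_mul_I _
  have hint1 : IntegrableOn (fun q => oscAmp τ M α (q ^ 2)) (Ioi δ) := by
    refine Integrable.integrableOn ?_
    refine (integrable_exp_neg_mul_sq hα).mono'
      ((measurable_oscAmp τ M α).comp (measurable_id.pow_const 2)).aestronglyMeasurable
      (Filter.Eventually.of_forall fun q => norm_oscAmp_le τ hM α (sq_nonneg q))
  have hint2 : IntegrableOn (fun q => e q * ((-((2 * α + 1 / q ^ 2) * Real.exp (-α * q ^ 2)) : ℝ) : ℂ))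
      (Ioi δ) := by
    refine hkint.ofReal.bdd_mul (c := 1) hec.aestronglyMeasurable ?_
    exact Filter.Eventually.of_forall fun q => (hen q).le
  have hΦ : ∀ q ∈ Ici δ, HasDerivAt
      (fun q : ℝ => Complex.I / τ * (e q * ((Real.exp (-α * q ^ 2) / q : ℝ) : ℂ)))
      (oscAmp τ M α (q ^ 2) + Complex.I / τ *
        (e q * ((-((2 * α + 1 / q ^ 2) * Real.exp (-α * q ^ 2)) : ℝ) : ℂ))) q := by
    intro q hq
    have hq0 : q ≠ 0 := (hδ.trans_le hq).ne'
    have h1 := ((hed q).mul ((hk' q hq).ofReal_comp)).const_mul (Complex.I / τ)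
    refine h1.congr_deriv ?_
    rw [mul_add]
    congr 1
    have hq0' : (q : ℂ) ≠ 0 := by exact_mod_cast hq0
    simp only [oscAmp, he]
    push_cast
    field_simp
    rw [Complex.I_sq]
    ring
  have hlim : Filter.Tendsto
      (fun q : ℝ => Complex.I / τ * (e q * ((Real.exp (-α * q ^ 2) / q : ℝ) : ℂ)))
      Filter.atTop (nhds 0) := by
    have : Filter.Tendsto (fun q : ℝ => e q * ((Real.exp (-α * q ^ 2) / q : ℝ) : ℂ))
        Filter.atTop (nhds 0) := by
      refine squeeze_zero_norm (a := fun q => ‖Real.exp (-α * q ^ 2) / q‖) (fun q => ?_) ?_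
      · rw [norm_mul, hen, one_mul, Complex.norm_real]
      · simpa using hk0.norm
    simpa using this.const_mul (Complex.I / τ)
  have hval := integral_Ioi_of_hasDerivAt_of_tendsto' hΦ (hint1.add (hint2.const_mul _)) hlim
  rw [integral_add hint1 (hint2.const_mul _), integral_const_mul] at hval
  have hEδ : Real.exp (-α * δ ^ 2) / δ ≤ 1 / δ := by
    gcongr
    exact Real.exp_le_one_iff.2 (by nlinarith [sq_nonneg δ])
  have hn1 : ‖∫ q in Ioi δ, e q * ((-((2 * α + 1 / q ^ 2) * Real.exp (-α * q ^ 2)) : ℝ) : ℂ)‖ ≤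
      1 / δ := by
    calc _ ≤ ∫ q in Ioi δ, -(-((2 * α + 1 / q ^ 2) * Real.exp (-α * q ^ 2))) := by
          refine norm_integral_le_of_norm_le hkint.neg ?_
          filter_upwards [ae_restrict_mem measurableSet_Ioi] with q hq
          rw [norm_mul, hen, one_mul, Complex.norm_real, Real.norm_of_nonpos (hkneg q hq)]
      _ = Real.exp (-α * δ ^ 2) / δ := by rw [integral_neg, hkval]; ring
      _ ≤ 1 / δ := hEδ
  have hn2 : ‖e δ * ((Real.exp (-α * δ ^ 2) / δ : ℝ) : ℂ)‖ ≤ 1 / δ := by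
    rw [norm_mul, hen, one_mul, Complex.norm_real, Real.norm_of_nonneg (by positivity)]
    exact hEδ
  have hIτ : ‖Complex.I / (τ : ℂ)‖ = 1 / |τ| := by
    rw [norm_div, Complex.norm_I, Complex.norm_real, Real.norm_eq_abs]
  rw [eq_sub_of_add_eq hval, zero_sub]
  refine (norm_sub_le _ _).trans ?_
  have hA : ∀ z : ℂ, ‖Complex.I / (τ : ℂ) * z‖ = 1 / |τ| * ‖z‖ := fun z => by rw [norm_mul, hIτ]
  rw [norm_neg, hA, hA]
  calc _ ≤ 1 / |τ| * (1 / δ) + 1 / |τ| * (1 / δ) := by gcongr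
    _ = 2 / (|τ| * δ) := by
      have : |τ| ≠ 0 := abs_ne_zero.2 hτ
      field_simp
      ring

/-- This is a van der Corput bound at the stationary point `q = 0`. With `δ = |τ|^{-1/2}`, each
half-line contributes at most `δ` from `q ≤ δ` and `2/(|τ|δ) = 2δ` from the rest, which gives `6δ`
in total. Uniformity in `M` and `α` matters for the planar estimate. -/
theorem norm_integral_oscAmp_le {τ M α : ℝ} (hτ : τ ≠ 0) (hM : 1 ≤ M) (hα : 0 < α) :
    ‖∫ q : ℝ, oscAmp τ M α (q ^ 2)‖ ≤ 6 * |τ| ^ (-(1 / 2) : ℝ) := by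
  have hτ0 : 0 < |τ| := abs_pos.2 hτ
  set δ : ℝ := |τ| ^ (-(1 / 2) : ℝ) with hδ
  have hδ0 : 0 < δ := Real.rpow_pos_of_pos hτ0 _
  have hδ2 : |τ| * δ * δ = 1 := by
    rw [hδ, mul_assoc, ← Real.rpow_add hτ0]
    norm_num [Real.rpow_neg_one, hτ0.ne']
  have hint : Integrable (fun q : ℝ => oscAmp τ M α (q ^ 2)) :=
    (integrable_exp_neg_mul_sq hα).mono'
      ((measurable_oscAmp τ M α).comp (measurable_id.pow_const 2)).aestronglyMeasurable
      (Filter.Eventually.of_forall fun q => norm_oscAmp_le τ hM α (sq_nonneg q))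
  have h1 : ∫ q in Iic 0, oscAmp τ M α (q ^ 2) = ∫ q in Ioi 0, oscAmp τ M α (q ^ 2) := by
    have := integral_comp_neg_Iic (0 : ℝ) (fun q => oscAmp τ M α (q ^ 2))
    simpa using this
  have h2 : ∫ q in Ioi 0, oscAmp τ M α (q ^ 2) =
      (∫ q in Ioc 0 δ, oscAmp τ M α (q ^ 2)) + ∫ q in Ioi δ, oscAmp τ M α (q ^ 2) := by
    rw [← Ioc_union_Ioi_eq_Ioi hδ0.le]
    exact setIntegral_union (disjoint_left.2 fun q hq hq' => not_lt.2 hq.2 hq')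
      measurableSet_Ioi hint.integrableOn hint.integrableOn
  have h3 : ‖∫ q in Ioc 0 δ, oscAmp τ M α (q ^ 2)‖ ≤ δ := by
    have := norm_setIntegral_le_of_norm_le_const (μ := volume) (s := Ioc 0 δ) (C := 1)
      (f := fun q => oscAmp τ M α (q ^ 2)) (by simp) (fun q _ =>
        (norm_oscAmp_le τ hM α (sq_nonneg q)).trans
          (Real.exp_le_one_iff.2 (by nlinarith [sq_nonneg q])))
    simpa [hδ0.le] using this
  have h4 := norm_integral_Ioi_oscAmp_le hτ hM hα hδ0
  have h5 : 2 / (|τ| * δ) = 2 * δ := by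
    rw [div_eq_iff (by positivity)]
    linear_combination (-2 : ℝ) * hδ2
  rw [← intervalIntegral.integral_Iic_add_Ioi (b := 0) hint.integrableOn hint.integrableOn, h1, h2]
  rw [h5] at h4
  refine (norm_add_le _ _).trans ?_
  have h6 := norm_add_le (∫ q in Ioc 0 δ, oscAmp τ M α (q ^ 2)) (∫ q in Ioi δ, oscAmp τ M α (q ^ 2))
  linarith

/-- Coordinates of the plane adapted to a given direction. -/
theorem exists_adapted_coordinates (x : Plane) :
    ∃ e : Plane → ℝ × ℝ, MeasurePreserving e ∧ MeasurableEmbedding e ∧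
      (∀ y, ‖y‖ ^ 2 = (e y).1 ^ 2 + (e y).2 ^ 2) ∧ ∃ c : ℝ, ∀ y, ⟪y, x⟫ = c * (e y).1 := by
  obtain ⟨b, c, hb⟩ : ∃ b : OrthonormalBasis (Fin 2) ℝ Plane, ∃ c : ℝ, x = c • b 0 := by
    by_cases hx : x = 0
    · exact ⟨EuclideanSpace.basisFun (Fin 2) ℝ, 0, by simp [hx]⟩
    · have hv : Orthonormal ℝ (({0} : Set (Fin 2)).domRestrict fun _ => ‖x‖⁻¹ • x) := by
        exact ⟨fun _ => norm_smul_inv_norm (𝕜 := ℝ) hx,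
          fun i j hij => absurd (Subsingleton.elim i j) hij⟩
      obtain ⟨b, hb⟩ := hv.exists_orthonormalBasis_extension_of_card_eq (by simp)
      refine ⟨b, ‖x‖, ?_⟩
      rw [hb 0 (mem_singleton _), smul_smul, mul_inv_cancel₀ (norm_ne_zero_iff.2 hx), one_smul]
  have hmp := ((volume_preserving_finTwoArrow ℝ).comp
    (EuclideanSpace.volume_preserving_symm_measurableEquiv_toLp (Fin 2))).comp
      b.measurePreserving_repr
  have hme := ((MeasurableEquiv.finTwoArrow (α := ℝ)).measurableEmbedding.comp
    (MeasurableEquiv.toLp 2 (Fin 2 → ℝ)).symm.measurableEmbedding).comp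
      b.repr.toHomeomorph.measurableEmbedding
  refine ⟨_, hmp, hme, fun y => ?_, c, fun y => ?_⟩
  · have := b.repr.norm_map y
    rw [← this, EuclideanSpace.norm_sq_eq, Fin.sum_univ_two]
    simp
  · have h1 : ⟪b 0, y⟫ = b.repr y 0 := (b.repr_apply_apply y 0).symm
    rw [hb, inner_smul_right, real_inner_comm, h1]
    rfl

/-- Decay of the dispersive kernel, uniformly in space. -/
theorem norm_integral_fourierChar_oscAmp_le {τ M α : ℝ} (hτ : τ ≠ 0) (hM : 1 ≤ M) (hα : 1 ≤ α)
    (x : Plane) : ‖∫ y : Plane, (Real.fourierChar ⟪y, x⟫ : ℂ) * oscAmp τ M α (‖y‖ ^ 2)‖ ≤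
      6 * √Real.pi * |τ| ^ (-(1 / 2) : ℝ) := by
  obtain ⟨e, he, hemb, hnorm, c, hc⟩ := exists_adapted_coordinates x
  let G : ℝ × ℝ → ℂ := fun r =>
    (Real.fourierChar (c * r.1) : ℂ) * oscAmp τ M α (r.1 ^ 2 + r.2 ^ 2)
  have h0 : ∫ y : Plane, (Real.fourierChar ⟪y, x⟫ : ℂ) * oscAmp τ M α (‖y‖ ^ 2) = ∫ r, G r := by
    rw [← he.integral_comp hemb G]
    congr 1
    funext y
    simp only [G, hnorm, hc]
  rw [h0]
  -- If `G` were not integrable its integral would be `0` by convention, so integrability need not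
  -- be proved.
  by_cases hi : Integrable G
  swap
  · rw [integral_undef hi, norm_zero]; positivity
  have h1 := integral_prod _ hi
  rw [← Measure.volume_eq_prod] at h1
  rw [h1]
  have hα0 : 0 < α := by linarith
  -- The coordinate `p` along `x` carries the whole spatial phase. For fixed `p`, the integral over
  -- `q` is the one-dimensional one with `M + p²` in place of `M`, and the Gaussian in `p` makes the
  -- outer integral converge.
  have hosc : ∀ p q : ℝ, oscAmp τ M α (p ^ 2 + q ^ 2) =
      (Real.exp (-α * p ^ 2) : ℂ) * oscAmp τ (M + p ^ 2) α (q ^ 2) := fun p q => by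
    simp only [oscAmp]
    rw [← add_assoc, mul_add, Real.exp_add]
    push_cast
    ring
  calc _ ≤ ∫ p : ℝ, Real.exp (-α * p ^ 2) * (6 * |τ| ^ (-(1 / 2) : ℝ)) := by
        refine norm_integral_le_of_norm_le ((integrable_exp_neg_mul_sq hα0).mul_const _)
          (Filter.Eventually.of_forall fun p => ?_)
        simp only [G, hosc, ← mul_assoc]
        rw [integral_const_mul, norm_mul, norm_mul, Circle.norm_coe, one_mul, Complex.norm_real,
          Real.norm_of_nonneg (Real.exp_pos _).le]
        rw [mul_assoc (Real.exp _)]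
        exact mul_le_mul_of_nonneg_left
          (norm_integral_oscAmp_le (M := M + p ^ 2) hτ (by nlinarith [sq_nonneg p]) hα0) (Real.exp_pos _).le
    _ = √(Real.pi / α) * (6 * |τ| ^ (-(1 / 2) : ℝ)) := by
        rw [integral_mul_const, integral_gaussian]
    _ ≤ √Real.pi * (6 * |τ| ^ (-(1 / 2) : ℝ)) := by
        gcongr
        exact div_le_self Real.pi_pos.le hα
    _ = _ := by ring

/-! ### The `TT*` argument -/

section Duality

variable {T Y : Type*} [MeasurableSpace T] [MeasurableSpace Y] {μ : Measure T} {ν : Measure Y}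
  {g : T → Y → ℂ} {D : T → ℝ} {ψ : Y → ℝ}

theorem integrable_uncurry_mul (hg : AEStronglyMeasurable (Function.uncurry g) (μ.prod ν))
    (hD : Integrable D μ) (hψ : MemLp ψ 2 ν) (hb : ∀ᵐ t ∂μ, ∀ y, ‖g t y‖ ≤ D t * ψ y)
    {b : Y → ℂ} (hbL : MemLp b 2 ν) :
    Integrable (fun p : T × Y => g p.1 p.2 * b p.2) (μ.prod ν) := by
  have h1 : Integrable (fun y => ψ y * ‖b y‖) ν := hψ.integrable_mul hbL.norm
  refine (hD.mul_prod h1).mono' (hg.mul hbL.1.comp_snd) ?_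
  have h2 : ∀ᵐ p : T × Y ∂(μ.prod ν), ∀ y, ‖g p.1 y‖ ≤ D p.1 * ψ y :=
    Measure.quasiMeasurePreserving_fst.ae hb
  filter_upwards [h2] with p hp
  rw [norm_mul, ← mul_assoc]
  exact mul_le_mul_of_nonneg_right (hp _) (norm_nonneg _)

theorem memLp_integral_left [SFinite μ] [SFinite ν]
    (hg : AEStronglyMeasurable (Function.uncurry g) (μ.prod ν))
    (hD : Integrable D μ) (hψ : MemLp ψ 2 ν) (hb : ∀ᵐ t ∂μ, ∀ y, ‖g t y‖ ≤ D t * ψ y) :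
    MemLp (fun y => ∫ t, g t y ∂μ) 2 ν := by
  refine (hψ.const_mul (∫ t, D t ∂μ)).mono' hg.prod_swap.integral_prod_right'
    (Filter.Eventually.of_forall fun y => ?_)
  rw [← integral_mul_const]
  exact norm_integral_le_of_norm_le (hD.mul_const _) (hb.mono fun t ht => ht y)

/-- This is `TT*` in dual form. With `G = ∫ g t`, Fubini writes `‖G‖²` as the double integral over
`(t, s)` of the pairings of `g t` and `g s`, which is at most `Λ`; Cauchy–Schwarz against `b` then
gives `√Λ`. The product bound `D t * ψ y` only justifies Fubini and does not enter the constant. -/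
theorem norm_integral_integral_le [SFinite μ] [SFinite ν]
    (hg : AEStronglyMeasurable (Function.uncurry g) (μ.prod ν))
    (hD : Integrable D μ) (hψ : MemLp ψ 2 ν) (hb : ∀ᵐ t ∂μ, ∀ y, ‖g t y‖ ≤ D t * ψ y)
    {κ : T → T → ℝ≥0∞} {Λ : ℝ} (hΛ : 0 ≤ Λ)
    (hκ : ∀ᵐ t ∂μ, ∀ᵐ s ∂μ, ‖∫ y, g t y * starRingEnd ℂ (g s y) ∂ν‖ₑ ≤ κ t s)
    (hκΛ : ∫⁻ t, ∫⁻ s, κ t s ∂μ ∂μ ≤ ENNReal.ofReal Λ) (b : Lp ℂ 2 ν) :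
    ‖∫ t, ∫ y, g t y * b y ∂ν ∂μ‖ ≤ √Λ * ‖b‖ := by
  have hG := memLp_integral_left hg hD hψ hb
  set G : Y → ℂ := fun y => ∫ t, g t y ∂μ with hGdef
  have hGs : MemLp (fun y => starRingEnd ℂ (G y)) 2 ν := hG.star
  have swap : ∀ {c : Y → ℂ}, MemLp c 2 ν →
      ∫ t, ∫ y, g t y * c y ∂ν ∂μ = ∫ y, G y * c y ∂ν := fun {c} hc => by
    rw [integral_integral_swap (integrable_uncurry_mul hg hD hψ hb hc)]
    simp_rw [integral_mul_const, hGdef]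
  have hinner : ∀ c : Lp ℂ 2 ν, ∫ y, G y * c y ∂ν = inner ℂ (hGs.toLp _) c := fun c => by
    rw [L2.inner_def]
    refine integral_congr_ae ?_
    filter_upwards [hGs.coeFn_toLp] with y hy
    rw [hy, RCLike.inner_apply, RingHomCompTriple.comp_apply, RingHom.id_apply, mul_comm]
  -- The choice `b = conj G` produces `‖G‖²`; expanding the conjugate factor as an integral over `s`
  -- brings in the kernel.
  have hsq : ‖∫ t, ∫ y, g t y * starRingEnd ℂ (G y) ∂ν ∂μ‖ₑ ≤ ENNReal.ofReal Λ := by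
    refine (enorm_integral_le_lintegral_enorm _).trans (le_trans (lintegral_mono_ae ?_) hκΛ)
    filter_upwards [hb, hκ, hg.prodMk_left] with t ht hκt hgt
    have h1 : ∀ y, g t y * starRingEnd ℂ (G y) =
        ∫ s, g t y * starRingEnd ℂ (g s y) ∂μ := fun y => by
      rw [integral_const_mul, hGdef, ← integral_conj]
    simp_rw [h1]
    have hgtL : MemLp (g t) 2 ν :=
      (hψ.const_mul (D t)).mono' hgt (Filter.Eventually.of_forall ht)
    have hi : Integrable (fun p : T × Y => g t p.2 * starRingEnd ℂ (g p.1 p.2)) (μ.prod ν) := by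
      have := integrable_uncurry_mul hg hD hψ hb (b := fun y => starRingEnd ℂ (g t y)) hgtL.star
      have h2 := (Complex.conjCLE : ℂ →L[ℝ] ℂ).integrable_comp this
      refine h2.congr (Filter.Eventually.of_forall fun p => ?_)
      simp [mul_comm]
    rw [← integral_integral_swap hi]
    exact (enorm_integral_le_lintegral_enorm _).trans (lintegral_mono_ae hκt)
  have hnorm : ‖hGs.toLp _‖ ^ 2 ≤ Λ := by
    have h1 : ∫ t, ∫ y, g t y * starRingEnd ℂ (G y) ∂ν ∂μ =
        inner ℂ (hGs.toLp _) (hGs.toLp _) := by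
      rw [swap hGs, ← hinner]
      refine integral_congr_ae ?_
      filter_upwards [hGs.coeFn_toLp] with y hy
      rw [hy]
    rw [h1, inner_self_eq_norm_sq_to_K, ← ofReal_norm] at hsq
    have := (ENNReal.ofReal_le_ofReal_iff hΛ).1 hsq
    simpa using this
  rw [swap (Lp.memLp b), hinner]
  refine (norm_inner_le_norm _ _).trans ?_
  gcongr
  exact Real.le_sqrt_of_sq_le hnorm

end Duality

/-! ### Finiteness of the time kernel -/

theorem lintegral_rpow_neg_half_lt_top :
    ∫⁻ r : ℝ in Icc (-1) 1, ENNReal.ofReal (|r| ^ (-(1 / 2) : ℝ)) < ⊤ := by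
  have h : IntervalIntegrable (fun r : ℝ => |r| ^ (-(1 / 2) : ℝ)) volume (-1) 1 := by
    have h1 : IntervalIntegrable (fun r : ℝ => |r| ^ (-(1 / 2) : ℝ)) volume 0 1 := by
      refine (intervalIntegral.intervalIntegrable_rpow' (r := -(1 / 2)) (by norm_num)).congr ?_
      intro r hr
      rw [uIoc_of_le zero_le_one] at hr
      simp only
      rw [abs_of_pos hr.1]
    have h2 := (IntervalIntegrable.iff_comp_neg (by simp)).1 h1
    simp only [abs_neg, neg_zero] at h2
    exact h2.symm.trans h1
  rw [intervalIntegrable_iff_integrableOn_Icc_of_le (by norm_num)] at h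
  exact h.lintegral_lt_top

/-- The kernel `|t - s|^{-1/2} e^{-t-s}`. -/
def timeKernel (t s : ℝ) : ℝ≥0∞ :=
  ENNReal.ofReal (|t - s| ^ (-(1 / 2) : ℝ)) * ENNReal.ofReal (Real.exp (-(t + s)))

/-- For `|t - s| ≤ 1` the factor `e^{-s}` is dropped and the integrable singularity remains; for `|t
- s| > 1` the power is at most `1` and is dropped instead. In both cases `e^{-t}` is kept for the
outer integral. -/
theorem lintegral_timeKernel_lt_top :
    ∫⁻ t in Ioi (0 : ℝ), ∫⁻ s in Ioi (0 : ℝ), timeKernel t s < ⊤ := by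
  set L₀ := ∫⁻ r : ℝ in Icc (-1) 1, ENNReal.ofReal (|r| ^ (-(1 / 2) : ℝ)) with hL₀
  have hE : ∫⁻ s in Ioi (0 : ℝ), ENNReal.ofReal (Real.exp (-s)) < ⊤ :=
    (integrableOn_exp_neg_Ioi 0).lintegral_lt_top
  set E := ∫⁻ s in Ioi (0 : ℝ), ENNReal.ofReal (Real.exp (-s)) with hEdef
  have hin : ∀ t ∈ Ioi (0 : ℝ), ∫⁻ s in Ioi (0 : ℝ), timeKernel t s ≤
      ENNReal.ofReal (Real.exp (-t)) * (L₀ + E) := fun t ht => by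
    have hp : ∀ s ∈ Ioi (0 : ℝ), timeKernel t s ≤ ENNReal.ofReal (Real.exp (-t)) *
        ((Icc (-1) 1).indicator (fun r : ℝ => ENNReal.ofReal (|r| ^ (-(1 / 2) : ℝ))) (t - s) +
          ENNReal.ofReal (Real.exp (-s))) := fun s hs => by
      rw [timeKernel, neg_add, Real.exp_add, ENNReal.ofReal_mul (Real.exp_pos _).le,
        mul_left_comm]
      gcongr
      by_cases h : t - s ∈ Icc (-1 : ℝ) 1
      · rw [indicator_of_mem h]
        refine le_trans (mul_le_of_le_one_right' ?_) le_self_add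
        rw [ENNReal.ofReal_le_one]
        exact Real.exp_le_one_iff.2 (by simpa using hs.le)
      · rw [indicator_of_notMem h, zero_add]
        refine mul_le_of_le_one_left' ?_
        rw [ENNReal.ofReal_le_one]
        refine Real.rpow_le_one_of_one_le_of_nonpos ?_ (by norm_num)
        rw [mem_Icc, ← abs_le, not_le] at h
        exact h.le
    refine (setLIntegral_mono' measurableSet_Ioi hp).trans ?_
    rw [lintegral_const_mul' _ _ ENNReal.ofReal_ne_top,
      lintegral_add_right _ (by fun_prop : Measurable fun s : ℝ => ENNReal.ofReal (Real.exp (-s)))]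
    gcongr
    refine (setLIntegral_le_lintegral _ _).trans (le_of_eq ?_)
    rw [lintegral_sub_left_eq_self
      (fun r => (Icc (-1) 1).indicator (fun r : ℝ => ENNReal.ofReal (|r| ^ (-(1 / 2) : ℝ))) r) t,
      lintegral_indicator measurableSet_Icc]
  refine (setLIntegral_mono' measurableSet_Ioi hin).trans_lt ?_
  rw [lintegral_mul_const' _ _ (ENNReal.add_lt_top.2 ⟨lintegral_rpow_neg_half_lt_top, hE⟩).ne]
  exact ENNReal.mul_lt_top hE (ENNReal.add_lt_top.2 ⟨lintegral_rpow_neg_half_lt_top, hE⟩)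

/-! ### Dispersive estimate for one vertical mode -/

/-- The damped Rossby propagator `e^{iβt/√q - 4π²qt}`, where `q = M + |y|²`. -/
def propagator (β M t : ℝ) (y : Plane) : ℂ :=
  ((Real.exp (-(4 * Real.pi ^ 2 * (M + ‖y‖ ^ 2) * t)) : ℝ) : ℂ) *
    Complex.exp ((β * t * (√(M + ‖y‖ ^ 2))⁻¹ : ℝ) * Complex.I)

/-- The square root of the amplitude in `oscAmp`. -/
def weight (M : ℝ) (y : Plane) : ℝ := √((√(M + ‖y‖ ^ 2) ^ 3)⁻¹ * Real.exp (-‖y‖ ^ 2))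

theorem continuous_weight {M : ℝ} (hM : 1 ≤ M) : Continuous (weight M) := by
  unfold weight
  refine Real.continuous_sqrt.comp (Continuous.mul (Continuous.inv₀ (by fun_prop) fun y => ?_)
    (by fun_prop))
  have : 0 < M + ‖y‖ ^ 2 := by positivity
  positivity

theorem weight_pos {M : ℝ} (hM : 1 ≤ M) (y : Plane) : 0 < weight M y := by
  have : 0 < M + ‖y‖ ^ 2 := by positivity
  unfold weight
  positivity

theorem weight_sq {M : ℝ} (y : Plane) :
    weight M y * weight M y = (√(M + ‖y‖ ^ 2) ^ 3)⁻¹ * Real.exp (-‖y‖ ^ 2) :=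
  Real.mul_self_sqrt (by positivity)

theorem memLp_weight {M : ℝ} (hM : 1 ≤ M) : MemLp (weight M) 2 (volume : Measure Plane) := by
  rw [memLp_two_iff_integrable_sq (continuous_weight hM).aestronglyMeasurable]
  have h := GaussianFourier.integrable_cexp_neg_mul_sq_norm_add (V := Plane) (b := 1) (by simp) 0 0
  refine h.norm.mono' ((continuous_weight hM).pow 2).aestronglyMeasurable
    (Filter.Eventually.of_forall fun y => ?_)
  rw [Real.norm_of_nonneg (by positivity), sq, weight_sq, Complex.norm_exp]
  refine (mul_le_of_le_one_left (Real.exp_pos _).le ?_).trans (le_of_eq ?_)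
  · refine inv_le_one_of_one_le₀ (one_le_pow₀ ?_)
    rw [Real.one_le_sqrt]
    nlinarith [sq_nonneg ‖y‖]
  · norm_num [← Complex.ofReal_pow]

theorem norm_propagator (β M t : ℝ) (y : Plane) :
    ‖propagator β M t y‖ = Real.exp (-(4 * Real.pi ^ 2 * (M + ‖y‖ ^ 2) * t)) := by
  rw [propagator, norm_mul, Complex.norm_exp_ofReal_mul_I, mul_one, Complex.norm_real,
    Real.norm_of_nonneg (Real.exp_pos _).le]

theorem le_four_pi_sq_mul {r : ℝ} (hr : 0 ≤ r) : r ≤ 4 * Real.pi ^ 2 * r := by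
  have := Real.pi_gt_three
  nlinarith [mul_nonneg (by nlinarith : (0 : ℝ) ≤ 4 * Real.pi ^ 2 - 1) hr]

theorem norm_propagator_le {β M t : ℝ} (hM : 1 ≤ M) (ht : 0 ≤ t) (y : Plane) :
    ‖propagator β M t y‖ ≤ Real.exp (-t) := by
  rw [norm_propagator]
  refine Real.exp_le_exp.2 (neg_le_neg ?_)
  have h1 : t ≤ (M + ‖y‖ ^ 2) * t := le_mul_of_one_le_left ht (by nlinarith [sq_nonneg ‖y‖])
  refine h1.trans ((le_four_pi_sq_mul (ht.trans h1)).trans (le_of_eq (by ring)))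

theorem measurable_propagator (β M : ℝ) {α : Type*} [MeasurableSpace α] {f : α → ℝ}
    {g : α → Plane} (hf : Measurable f) (hg : Measurable g) :
    Measurable fun q => propagator β M (f q) (g q) := by
  unfold propagator
  fun_prop

/-- In the product the phases subtract, giving `τ = β(t - s)`, while the dampings add. The squared
weight supplies the amplitude of `oscAmp`, so that `α = 1 + 4π²(t + s) ≥ 1`. The leftover
`e^{-4π²M(t+s)}` is bounded by `e^{-(t+s)}`. The positions enter only through `v - w`, in which the
kernel bound is uniform. -/
theorem norm_integral_propagator_le {β M t s : ℝ} (hβ : β ≠ 0) (hM : 1 ≤ M) (ht : 0 < t)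
    (hs : 0 < s) (hts : t ≠ s) {θ η : ℂ} (hθ : ‖θ‖ ≤ 1) (hη : ‖η‖ ≤ 1) (v w : Plane) :
    ‖∫ y : Plane, θ * (Real.fourierChar ⟪y, v⟫ : ℂ) * propagator β M t y * (weight M y : ℂ) *
      starRingEnd ℂ (η * (Real.fourierChar ⟪y, w⟫ : ℂ) * propagator β M s y *
        (weight M y : ℂ))‖ₑ ≤
      ENNReal.ofReal (6 * √Real.pi * |β| ^ (-(1 / 2) : ℝ)) * timeKernel t s := by
  have h0 : ∀ y : Plane, θ * (Real.fourierChar ⟪y, v⟫ : ℂ) * propagator β M t y *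
      (weight M y : ℂ) * starRingEnd ℂ (η * (Real.fourierChar ⟪y, w⟫ : ℂ) *
        propagator β M s y * (weight M y : ℂ)) =
      (θ * starRingEnd ℂ η * (Real.exp (-(4 * Real.pi ^ 2 * M * (t + s))) : ℝ)) *
        ((Real.fourierChar ⟪y, v - w⟫ : ℂ) *
          oscAmp (β * (t - s)) M (1 + 4 * Real.pi ^ 2 * (t + s)) (‖y‖ ^ 2)) := fun y => by
    have e1 : starRingEnd ℂ (Real.fourierChar ⟪y, w⟫ : ℂ) = (Real.fourierChar (-⟪y, w⟫) : ℂ) := by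
      rw [AddChar.map_neg_eq_inv, Circle.coe_inv_eq_conj]
    have e2 : (Real.fourierChar ⟪y, v - w⟫ : ℂ) =
        (Real.fourierChar ⟪y, v⟫ : ℂ) * (Real.fourierChar (-⟪y, w⟫) : ℂ) := by
      rw [inner_sub_right, sub_eq_add_neg, AddChar.map_add_eq_mul, Circle.coe_mul]
    have e3 : starRingEnd ℂ (propagator β M s y) =
        ((Real.exp (-(4 * Real.pi ^ 2 * (M + ‖y‖ ^ 2) * s)) : ℝ) : ℂ) *
        Complex.exp ((-(β * s * (√(M + ‖y‖ ^ 2))⁻¹) : ℝ) * Complex.I) := by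
      rw [propagator, map_mul, Complex.conj_ofReal, ← Complex.exp_conj, map_mul,
        Complex.conj_ofReal, Complex.conj_I]
      push_cast
      ring_nf
    have e4 : ((weight M y : ℝ) : ℂ) * (weight M y : ℝ) =
        (((√(M + ‖y‖ ^ 2) ^ 3)⁻¹ * Real.exp (-‖y‖ ^ 2) : ℝ) : ℂ) := by
      rw [← weight_sq]; push_cast; ring
    have e5 : ((Real.exp (-(4 * Real.pi ^ 2 * (M + ‖y‖ ^ 2) * t)) : ℝ) : ℂ) *
        (Real.exp (-(4 * Real.pi ^ 2 * (M + ‖y‖ ^ 2) * s)) : ℝ) *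
        (((√(M + ‖y‖ ^ 2) ^ 3)⁻¹ * Real.exp (-‖y‖ ^ 2) : ℝ) : ℂ) =
        (Real.exp (-(4 * Real.pi ^ 2 * M * (t + s))) : ℝ) *
        ((((√(M + ‖y‖ ^ 2) ^ 3)⁻¹ *
          Real.exp (-(1 + 4 * Real.pi ^ 2 * (t + s)) * ‖y‖ ^ 2) : ℝ)) : ℂ) := by
      rw [← Complex.ofReal_mul, ← Complex.ofReal_mul, ← Complex.ofReal_mul, Complex.ofReal_inj]
      rw [mul_left_comm, mul_left_comm (Real.exp (-(4 * Real.pi ^ 2 * M * (t + s)))),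
        ← Real.exp_add, ← Real.exp_add, ← Real.exp_add]
      ring_nf
    have e6 : Complex.exp ((β * t * (√(M + ‖y‖ ^ 2))⁻¹ : ℝ) * Complex.I) *
        Complex.exp ((-(β * s * (√(M + ‖y‖ ^ 2))⁻¹) : ℝ) * Complex.I) =
        Complex.exp ((β * (t - s) * (√(M + ‖y‖ ^ 2))⁻¹ : ℝ) * Complex.I) := by
      rw [← Complex.exp_add]
      push_cast
      ring_nf
    rw [map_mul, map_mul, map_mul, e1, e3, e2, Complex.conj_ofReal, oscAmp, propagator, ← e6]
    linear_combination (θ * starRingEnd ℂ η * ((Real.fourierChar ⟪y, v⟫ : ℂ) *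
      (Real.fourierChar (-⟪y, w⟫) : ℂ)) *
      (Complex.exp ((β * t * (√(M + ‖y‖ ^ 2))⁻¹ : ℝ) * Complex.I) *
        Complex.exp ((-(β * s * (√(M + ‖y‖ ^ 2))⁻¹) : ℝ) * Complex.I))) *
      (((Real.exp (-(4 * Real.pi ^ 2 * (M + ‖y‖ ^ 2) * t)) : ℝ) : ℂ) *
        (Real.exp (-(4 * Real.pi ^ 2 * (M + ‖y‖ ^ 2) * s)) : ℝ) * e4 + e5)
  simp_rw [h0]
  rw [integral_const_mul, timeKernel, ← ENNReal.ofReal_mul (by positivity),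
    ← ENNReal.ofReal_mul (by positivity), ← ofReal_norm]
  refine ENNReal.ofReal_le_ofReal ?_
  rw [norm_mul, norm_mul, norm_mul, RCLike.norm_conj, Complex.norm_real,
    Real.norm_of_nonneg (Real.exp_pos _).le]
  have hτ : β * (t - s) ≠ 0 := mul_ne_zero hβ (sub_ne_zero.2 hts)
  have h1 := norm_integral_fourierChar_oscAmp_le hτ hM
    (α := 1 + 4 * Real.pi ^ 2 * (t + s)) (by nlinarith [Real.pi_pos, sq_nonneg Real.pi]) (v - w)
  rw [abs_mul, Real.mul_rpow (abs_nonneg _) (abs_nonneg _)] at h1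
  have h2 : Real.exp (-(4 * Real.pi ^ 2 * M * (t + s))) ≤ Real.exp (-(t + s)) := by
    refine Real.exp_le_exp.2 (neg_le_neg ?_)
    have : t + s ≤ M * (t + s) := le_mul_of_one_le_left (by positivity) hM
    exact this.trans ((le_four_pi_sq_mul (by positivity)).trans (le_of_eq (by ring)))
  have h3 : ‖θ‖ * ‖η‖ ≤ 1 := mul_le_one₀ hθ (norm_nonneg _) hη
  calc _ ≤ 1 * Real.exp (-(t + s)) * (6 * √Real.pi *
        (|β| ^ (-(1 / 2) : ℝ) * |t - s| ^ (-(1 / 2) : ℝ))) :=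
        mul_le_mul (mul_le_mul h3 h2 (Real.exp_pos _).le zero_le_one) h1 (norm_nonneg _)
          (by positivity)
    _ = _ := by ring

/-! ### Waves observed along a moving point. -/

/-- The wave with data `a` at time `t`, evaluated at the point `x` of the plane. -/
def waveAt (β M : ℝ) (a : Lp ℂ 2 (volume : Measure Plane)) (t : ℝ) (x : Plane) : ℂ :=
  ∫ y, (Real.fourierChar ⟪y, x⟫ : ℂ) * propagator β M t y * a y

theorem measurable_fourierChar_inner {α : Type*} [MeasurableSpace α] {f g : α → Plane}
    (hf : Measurable f) (hg : Measurable g) :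
    Measurable fun q => (Real.fourierChar ⟪f q, g q⟫ : ℂ) := by
  have h : Measurable fun r : ℝ => (Real.fourierChar r : ℂ) :=
    (continuous_subtype_val.comp Real.continuous_fourierChar).measurable
  exact h.comp (hf.inner hg)

theorem measurable_waveAt (β M : ℝ) (a : Lp ℂ 2 (volume : Measure Plane)) {α : Type*}
    [MeasurableSpace α] {f : α → ℝ} {g : α → Plane} (hf : Measurable f) (hg : Measurable g) :
    Measurable fun q => waveAt β M a (f q) (g q) := by
  have h1 : Measurable fun q : α × Plane => (Real.fourierChar ⟪q.2, g q.1⟫ : ℂ) :=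
    measurable_fourierChar_inner measurable_snd (hg.comp measurable_fst)
  have h2 : Measurable fun q : α × Plane => propagator β M (f q.1) q.2 :=
    measurable_propagator β M (hf.comp measurable_fst) measurable_snd
  have h3 : Measurable fun q : α × Plane => a q.2 :=
    (Lp.stronglyMeasurable a).measurable.comp measurable_snd
  have h4 : StronglyMeasurable fun q : α × Plane =>
      (Real.fourierChar ⟪q.2, g q.1⟫ : ℂ) * propagator β M (f q.1) q.2 * a q.2 :=
    ((h1.mul h2).mul h3).stronglyMeasurable
  exact (h4.integral_prod_right' (ν := volume)).measurable

/-- The constant in the dispersive estimate. -/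
def dispersiveConst (M N : ℝ) : ℝ :=
  √(6 * √Real.pi * (∫⁻ t in Ioi (0 : ℝ), ∫⁻ s in Ioi (0 : ℝ), timeKernel t s).toReal) *
    (√((√(M + N ^ 2) ^ 3)⁻¹ * Real.exp (-N ^ 2)))⁻¹

theorem dispersiveConst_nonneg (M N : ℝ) : 0 ≤ dispersiveConst M N := by
  unfold dispersiveConst; positivity

theorem weight_inv_le {M N : ℝ} (hM : 1 ≤ M) {y : Plane} (hy : ‖y‖ ≤ N) :
    (weight M y)⁻¹ ≤ (√((√(M + N ^ 2) ^ 3)⁻¹ * Real.exp (-N ^ 2)))⁻¹ := by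
  have h1 : ‖y‖ ^ 2 ≤ N ^ 2 := pow_le_pow_left₀ (norm_nonneg _) hy 2
  have h2 : 0 < M + ‖y‖ ^ 2 := by positivity
  unfold weight
  gcongr

/-- A measurable phase `θ` turns the integral of `‖F t‖` into a linear functional of the data, to
which the `TT*` bound applies. The kernel estimate does not see the positions, so an arbitrary path
is allowed. -/
theorem lintegral_waveAt_path_le {β M N : ℝ} (hβ : β ≠ 0) (hM : 1 ≤ M)
    (a : Lp ℂ 2 (volume : Measure Plane)) (ha : ∀ᵐ y, N < ‖y‖ → a y = 0)
    {X : ℝ → Plane} (hX : Measurable X) :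
    ∫⁻ t in Ioi (0 : ℝ), ‖waveAt β M a t (X t)‖ₑ ≤
      ENNReal.ofReal (dispersiveConst M N * |β| ^ (-(1 / 4) : ℝ) * ‖a‖) := by
  set μ := (volume : Measure ℝ).restrict (Ioi 0) with hμ
  -- Where `F t = 0` the phase `θ t` defined from `F` is `0` by the convention for inverses, so `‖θ
  -- t‖ ≤ 1` and `θ t * F t = ‖F t‖` hold everywhere.
  set F : ℝ → ℂ := fun t => waveAt β M a t (X t) with hF
  have hFm : Measurable F := measurable_waveAt β M a measurable_id hX
  set θ : ℝ → ℂ := fun t => starRingEnd ℂ (F t) * ((‖F t‖ : ℝ) : ℂ)⁻¹ with hθ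
  have hθm : Measurable θ := (Complex.continuous_conj.measurable.comp hFm).mul
    (Complex.measurable_ofReal.comp hFm.norm).inv
  have hθ1 : ∀ t, ‖θ t‖ ≤ 1 := fun t => by
    simp only [hθ]
    rw [norm_mul, RCLike.norm_conj, norm_inv, Complex.norm_real, norm_norm]
    exact mul_inv_le_one
  have hθF : ∀ t, θ t * F t = (‖F t‖ : ℝ) := fun t => by
    by_cases h : F t = 0
    · simp [h]
    · have h' : ((‖F t‖ : ℝ) : ℂ) ≠ 0 := by simpa using h
      simp only [hθ]
      rw [mul_right_comm, mul_comm (starRingEnd ℂ (F t)), Complex.mul_conj,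
        Complex.normSq_eq_norm_sq, mul_inv_eq_iff_eq_mul₀ h']
      push_cast
      ring
  set g : ℝ → Plane → ℂ := fun t y => θ t * (Real.fourierChar ⟪y, X t⟫ : ℂ) *
    propagator β M t y * (weight M y : ℂ) with hg
  have hgm : Measurable (Function.uncurry g) := by
    have h1 : Measurable fun q : ℝ × Plane => θ q.1 := hθm.comp measurable_fst
    have h2 : Measurable fun q : ℝ × Plane => (Real.fourierChar ⟪q.2, X q.1⟫ : ℂ) :=
      measurable_fourierChar_inner measurable_snd (hX.comp measurable_fst)
    have h3 : Measurable fun q : ℝ × Plane => propagator β M q.1 q.2 :=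
      measurable_propagator β M measurable_fst measurable_snd
    have h4 : Measurable fun q : ℝ × Plane => (weight M q.2 : ℂ) :=
      Complex.measurable_ofReal.comp ((continuous_weight hM).measurable.comp measurable_snd)
    exact ((h1.mul h2).mul h3).mul h4
  have hD : Integrable (fun t : ℝ => Real.exp (-t)) μ := integrableOn_exp_neg_Ioi 0
  have hb : ∀ᵐ t ∂μ, ∀ y, ‖g t y‖ ≤ Real.exp (-t) * weight M y := by
    filter_upwards [ae_restrict_mem measurableSet_Ioi] with t ht y
    simp only [hg]
    rw [norm_mul, norm_mul, norm_mul, Circle.norm_coe, mul_one, Complex.norm_real,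
      Real.norm_of_nonneg (weight_pos hM y).le]
    refine mul_le_mul_of_nonneg_right ?_ (weight_pos hM y).le
    exact (mul_le_of_le_one_left (norm_nonneg _) (hθ1 t)).trans
      (norm_propagator_le hM (le_of_lt ht) y)
  set K₀ := ∫⁻ t in Ioi (0 : ℝ), ∫⁻ s in Ioi (0 : ℝ), timeKernel t s with hK₀
  set Λ : ℝ := 6 * √Real.pi * |β| ^ (-(1 / 2) : ℝ) * K₀.toReal with hΛ
  have hΛ0 : 0 ≤ Λ := by positivity
  have hκ : ∀ᵐ t ∂μ, ∀ᵐ s ∂μ, ‖∫ y, g t y * starRingEnd ℂ (g s y)‖ₑ ≤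
      ENNReal.ofReal (6 * √Real.pi * |β| ^ (-(1 / 2) : ℝ)) * timeKernel t s := by
    filter_upwards [ae_restrict_mem measurableSet_Ioi] with t ht
    -- The diagonal `s = t`, where the phase no longer oscillates, is a null set in `s`.
    filter_upwards [ae_restrict_mem measurableSet_Ioi,
      ae_restrict_of_ae (Measure.ae_ne volume t)] with s hs hts
    exact norm_integral_propagator_le hβ hM ht hs hts.symm (hθ1 t) (hθ1 s) _ _
  have hκΛ : ∫⁻ t, ∫⁻ s, ENNReal.ofReal (6 * √Real.pi * |β| ^ (-(1 / 2) : ℝ)) * timeKernel t s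
      ∂μ ∂μ ≤ ENNReal.ofReal Λ := by
    simp_rw [lintegral_const_mul' _ _ ENNReal.ofReal_ne_top]
    rw [hΛ, ENNReal.ofReal_mul (p := 6 * √Real.pi * |β| ^ (-(1 / 2) : ℝ)) (by positivity),
      ENNReal.ofReal_toReal lintegral_timeKernel_lt_top.ne]
  -- The weight put into `g` is undone on the data. It is bounded below on the ball carrying `a`,
  -- and this is where the constant depends on the frequency radius.
  set m : Plane → ℂ := indicator (Metric.closedBall 0 N) fun y => (((weight M y)⁻¹ : ℝ) : ℂ)
    with hm
  set c := (√((√(M + N ^ 2) ^ 3)⁻¹ * Real.exp (-N ^ 2)))⁻¹ with hc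
  have hc0 : 0 ≤ c := by positivity
  have hms : IsSymbol m := isSymbol_indicator_ball (C := c)
    (Complex.measurable_ofReal.comp (continuous_weight hM).measurable.inv) fun y hy => by
      rw [Function.comp_apply, Complex.norm_real, Pi.inv_apply, Real.norm_of_nonneg (inv_pos.2 (weight_pos hM y)).le]
      exact weight_inv_le hM hy
  have hmc : ∀ y, ‖m y‖ ≤ c := fun y => by
    by_cases hy : y ∈ Metric.closedBall (0 : Plane) N
    · rw [hm, indicator_of_mem hy, Complex.norm_real,
        Real.norm_of_nonneg (inv_pos.2 (weight_pos hM y)).le]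
      exact weight_inv_le hM (by simpa using hy)
    · rw [hm, indicator_of_notMem hy, norm_zero]
      exact hc0
  have hprod : ∀ t, ∫ y, g t y * mulOp m a y = (‖F t‖ : ℝ) := fun t => by
    rw [← hθF]
    simp only [hF, waveAt]
    rw [← integral_const_mul]
    refine integral_congr_ae ?_
    filter_upwards [mulOp_ae hms a, ha] with y h1 h2
    rw [h1]
    by_cases hy : N < ‖y‖
    · rw [h2 hy]; simp
    · rw [hm, indicator_of_mem (by simpa using hy)]
      simp only [hg]
      have : (weight M y : ℂ) * ((weight M y)⁻¹ : ℝ) = 1 := by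
        rw [← Complex.ofReal_mul, mul_inv_cancel₀ (weight_pos hM y).ne', Complex.ofReal_one]
      linear_combination (θ t * (Real.fourierChar ⟪y, X t⟫ : ℂ) * propagator β M t y * a y) * this
  have hint : Integrable (fun t => ((‖F t‖ : ℝ) : ℂ)) μ := by
    have := (integrable_uncurry_mul hgm.aestronglyMeasurable hD (memLp_weight hM) hb
      (Lp.memLp (mulOp m a))).integral_prod_left
    simpa only [hprod] using this
  have hmain := norm_integral_integral_le hgm.aestronglyMeasurable hD (memLp_weight hM) hb hΛ0
    hκ hκΛ (mulOp m a)
  simp_rw [hprod] at hmain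
  rw [integral_complex_ofReal, Complex.norm_real,
    Real.norm_of_nonneg (integral_nonneg fun _ => norm_nonneg _)] at hmain
  have hint' : Integrable F μ := by
    rw [← integrable_norm_iff hFm.aestronglyMeasurable]
    simpa using hint.norm
  rw [← ofReal_integral_norm_eq_lintegral_enorm hint']
  refine ENNReal.ofReal_le_ofReal (hmain.trans ?_)
  -- The square root from `TT*` halves the dispersive exponent `-1/2`.
  have hsq : √Λ = √(6 * √Real.pi * K₀.toReal) * |β| ^ (-(1 / 4) : ℝ) := by
    rw [hΛ, mul_right_comm, Real.sqrt_mul (by positivity), Real.sqrt_eq_rpow (|β| ^ _),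
      ← Real.rpow_mul (abs_nonneg _)]
    norm_num
  calc √Λ * ‖mulOp m a‖ ≤ √Λ * (c * ‖a‖) := by
        gcongr
        exact (mulOp m).le_of_opNorm_le (norm_mulOp_le hms hc0 hmc) a
    _ = _ := by
        rw [hsq, dispersiveConst]
        ring

/-! ### From measurable paths to the supremum over the plane. -/

/-- A maximizer among finitely many points can be chosen measurably in time by successive
comparison: switch to the new point on the measurable set of times where it does strictly better. -/
theorem exists_measurable_path {E : Type*} [MeasurableSpace E] {F : ℝ → E → ℂ}
    (hF : Measurable (Function.uncurry F)) (x : ℕ → E) (N : ℕ) :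
    ∃ X : ℝ → E, Measurable X ∧ ∀ t, ∀ j ≤ N, ‖F t (x j)‖ₑ ≤ ‖F t (X t)‖ₑ := by
  induction N with
  | zero =>
    exact ⟨fun _ => x 0, measurable_const, fun t j hj => by rw [Nat.le_zero.1 hj]⟩
  | succ N ih =>
    obtain ⟨X, hX, h⟩ := ih
    have h1 : Measurable fun t => ‖F t (X t)‖ₑ :=
      (hF.comp (measurable_id.prodMk hX)).enorm
    have h2 : Measurable fun t => ‖F t (x (N + 1))‖ₑ :=
      (hF.comp (measurable_id.prodMk measurable_const)).enorm
    classical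
    refine ⟨fun t => if ‖F t (X t)‖ₑ < ‖F t (x (N + 1))‖ₑ then x (N + 1) else X t,
      Measurable.ite (measurableSet_lt h1 h2) measurable_const hX, fun t j hj => ?_⟩
    by_cases hlt : ‖F t (X t)‖ₑ < ‖F t (x (N + 1))‖ₑ
    · simp only [hlt, if_true]
      rcases Nat.le_succ_iff.1 hj with hj | hj
      · exact (h t j hj).trans hlt.le
      · rw [hj]
    · simp only [hlt, if_false]
      rcases Nat.le_succ_iff.1 hj with hj | hj
      · exact h t j hj
      · rw [hj]; exact not_lt.1 hlt

/-- A bound along all measurable paths is a bound for the maximal function. -/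
theorem lintegral_iSup_le_of_path {E : Type*} [MeasurableSpace E] {F : ℝ → E → ℂ}
    (hF : Measurable (Function.uncurry F)) (x : ℕ → E) {μ : Measure ℝ} {B : ℝ≥0∞}
    (h : ∀ X : ℝ → E, Measurable X → ∫⁻ t, ‖F t (X t)‖ₑ ∂μ ≤ B) :
    ∫⁻ t, ⨆ j, ‖F t (x j)‖ₑ ∂μ ≤ B := by
  -- Finite suprema are bounded along a measurable path, and they increase with `N`, so monotone
  -- convergence reaches the full supremum.
  have h1 : ∀ t, ⨆ j, ‖F t (x j)‖ₑ = ⨆ N : ℕ, ⨆ j : Fin (N + 1), ‖F t (x j)‖ₑ := fun t => by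
    refine le_antisymm (iSup_le fun j => ?_) (iSup_le fun N => iSup_le fun j => ?_)
    · exact le_iSup_of_le j (le_iSup_of_le (Fin.last j) (by simp))
    · exact le_iSup (fun j => ‖F t (x j)‖ₑ) j
  simp_rw [h1]
  rw [lintegral_iSup]
  · refine iSup_le fun N => ?_
    obtain ⟨X, hX, hle⟩ := exists_measurable_path hF x N
    refine le_trans (lintegral_mono fun t => iSup_le fun j : Fin (N + 1) => ?_) (h X hX)
    exact hle t j (Nat.lt_succ_iff.1 j.2)
  · exact fun N => Measurable.iSup fun j =>
      (hF.comp (measurable_id.prodMk measurable_const)).enorm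
  · refine fun N N' hN t => iSup_le fun j => ?_
    exact le_iSup_of_le (⟨j, by have := j.2; omega⟩ : Fin (N' + 1)) le_rfl

/-- The dispersion relation `iβ/|ξ|` of the Rossby waves. -/
def dispersion (β : ℝ) (n : ℤ) (y : Plane) : ℂ := ((β * (√(freqSq n y))⁻¹ : ℝ) : ℂ) * Complex.I

theorem one_le_freqSq {n : ℤ} (hn : n ≠ 0) (y : Plane) : 1 ≤ freqSq n y := by
  rw [freqSq_eq]
  have h : (1 : ℝ) ≤ (n : ℝ) ^ 2 := by
    exact_mod_cast Int.add_one_le_iff.2 (sq_pos_of_ne_zero hn)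
  nlinarith [sq_nonneg ‖y‖]

theorem isSymbol_dispersion (β : ℝ) {n : ℤ} (hn : n ≠ 0) : IsSymbol (dispersion β n) := by
  refine ⟨?_, |β|, fun y => ?_⟩
  · exact (Complex.measurable_ofReal.comp (measurable_const.mul
      (measurable_freqSq n).sqrt.inv)).mul measurable_const
  · rw [dispersion, norm_mul, Complex.norm_I, mul_one, Complex.norm_real, norm_mul, norm_inv,
      Real.norm_eq_abs, Real.norm_of_nonneg (Real.sqrt_nonneg _)]
    refine mul_le_of_le_one_right (abs_nonneg _) (inv_le_one_of_one_le₀ ?_)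
    exact Real.one_le_sqrt.2 (one_le_freqSq hn y)

theorem integrable_of_bounded_support {h : Lp ℂ 2 (volume : Measure Plane)} {N : ℝ}
    (hs : ∀ᵐ y, N < ‖y‖ → h y = 0) : Integrable h := by
  have h1 : IntegrableOn h (Metric.closedBall (0 : Plane) N) := by
    have : IsFiniteMeasure ((volume : Measure Plane).restrict (Metric.closedBall 0 N)) :=
      isFiniteMeasure_restrict.2 measure_closedBall_lt_top.ne
    exact ((Lp.memLp h).restrict _).integrable one_le_two
  have h2 : (Metric.closedBall (0 : Plane) N).indicator h =ᵐ[volume] h := by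
    filter_upwards [hs] with y hy
    by_cases hN : y ∈ Metric.closedBall (0 : Plane) N
    · rw [indicator_of_mem hN]
    · rw [indicator_of_notMem hN, hy (by simpa using hN)]
  exact ((integrable_indicator_iff Metric.isClosed_closedBall.measurableSet).2 h1).congr h2

theorem mulOp_exp_waveSym_ae {β N : ℝ} {n : ℤ} (hn : n ≠ 0)
    {a : Lp ℂ 2 (volume : Measure Plane)} (ha : ∀ᵐ y, N < ‖y‖ → a y = 0) (t : ℝ) :
    mulOp (fun y => Complex.exp (t * waveSym n N (dispersion β n) y)) a =ᵐ[volume]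
      fun y => propagator β ((n : ℝ) ^ 2) t y * a y := by
  filter_upwards [mulOp_ae ((isSymbol_waveSym n N (isSymbol_dispersion β hn)).exp t) a, ha]
    with y h1 h2
  rw [h1]
  by_cases hy : N < ‖y‖
  · rw [h2 hy]; simp
  · have hq : freqSq n y = (n : ℝ) ^ 2 + ‖y‖ ^ 2 := by rw [freqSq_eq, add_comm]
    rw [waveSym, indicator_of_mem (by simpa using hy), dispersion, propagator, lapSym, hq,
      Complex.ofReal_exp, ← Complex.exp_add]
    congr 2
    push_cast
    ring

/-- Bounded frequency support makes the amplitude integrable, so its inverse transform is continuous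
and a countable dense set of points suffices for the supremum. -/
theorem eLpNorm_embed_wave_le {β N : ℝ} {n : ℤ} (hn : n ≠ 0)
    {a : Lp ℂ 2 (volume : Measure Plane)} (ha : ∀ᵐ y, N < ‖y‖ → a y = 0) (i : Fin 3) (t : ℝ) :
    eLpNorm (embed n i (mulOp (fun y => Complex.exp (t * waveSym n N (dispersion β n) y)) a)) ⊤
      (volume : Measure Layer) ≤
      ⨆ j, ‖waveAt β ((n : ℝ) ^ 2) a t (TopologicalSpace.denseSeq Plane j)‖ₑ := by
  set h := mulOp (fun y => Complex.exp (t * waveSym n N (dispersion β n) y)) a with hh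
  have hae := mulOp_exp_waveSym_ae (β := β) hn ha t
  have h1 : Integrable h := integrable_of_bounded_support (N := N) <| by
    filter_upwards [hae, ha] with y e1 e2 hy
    rw [hh, e1, e2 hy, mul_zero]
  have hF : ∀ x : Plane, 𝓕⁻ (h : Plane → ℂ) x = waveAt β ((n : ℝ) ^ 2) a t x := fun x => by
    rw [Real.fourierInv_eq, waveAt]
    refine integral_congr_ae ?_
    filter_upwards [hae] with y e1
    rw [hh, e1, Circle.smul_def, smul_eq_mul, mul_assoc]
  have hc : Continuous (𝓕⁻ (h : Plane → ℂ)) := by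
    rw [Real.fourierInv_eq_fourier_comp_neg]
    exact continuous_fourier_of_integrable h1.comp_neg
  refine eLpNorm_embed_le n i h1 fun x => ?_
  have hcl : IsClosed {x : Plane | ‖𝓕⁻ (h : Plane → ℂ) x‖ₑ ≤
      ⨆ j, ‖waveAt β ((n : ℝ) ^ 2) a t (TopologicalSpace.denseSeq Plane j)‖ₑ} :=
    isClosed_le hc.enorm continuous_const
  refine (TopologicalSpace.denseRange_denseSeq Plane).induction_on
    (p := fun x => ‖𝓕⁻ (h : Plane → ℂ) x‖ₑ ≤
      ⨆ j, ‖waveAt β ((n : ℝ) ^ 2) a t (TopologicalSpace.denseSeq Plane j)‖ₑ) x hcl fun j => ?_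
  rw [hF]
  exact le_iSup (fun j => ‖waveAt β ((n : ℝ) ^ 2) a t (TopologicalSpace.denseSeq Plane j)‖ₑ) j

/-- The majorant of the sup norm of a wave, as a function of time. -/
def waveSup (β M : ℝ) (a : Lp ℂ 2 (volume : Measure Plane)) (t : ℝ) : ℝ≥0∞ :=
  ⨆ j, ‖waveAt β M a t (TopologicalSpace.denseSeq Plane j)‖ₑ

theorem measurable_waveSup (β M : ℝ) (a : Lp ℂ 2 (volume : Measure Plane)) :
    Measurable (waveSup β M a) :=
  Measurable.iSup fun _ => (measurable_waveAt β M a measurable_id measurable_const).enorm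

theorem lintegral_waveSup_le {β M N : ℝ} (hβ : β ≠ 0) (hM : 1 ≤ M)
    (a : Lp ℂ 2 (volume : Measure Plane)) (ha : ∀ᵐ y, N < ‖y‖ → a y = 0) :
    ∫⁻ t in Ici (0 : ℝ), waveSup β M a t ≤
      ENNReal.ofReal (dispersiveConst M N * |β| ^ (-(1 / 4) : ℝ) * ‖a‖) := by
  rw [← setLIntegral_congr (Ioi_ae_eq_Ici (a := (0 : ℝ)))]
  exact lintegral_iSup_le_of_path (measurable_waveAt β M a measurable_fst measurable_snd) _
    fun X hX => lintegral_waveAt_path_le hβ hM a ha hX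

/-! ### Circular polarizations -/

/-- Components of the vector product, with indices mod 3. -/
def cross (k v : Fin 3 → ℂ) (i : Fin 3) : ℂ := k (i + 1) * v (i + 2) - k (i + 2) * v (i + 1)

/-- The projection onto one of the two circular polarizations transversal to `k`. -/
def polarVec (σ r : ℂ) (k v : Fin 3 → ℂ) (i : Fin 3) : ℂ :=
  (1 / 2) * (v i + Complex.I * σ * r * cross k v i)

theorem sum_mul_polarVec {σ r : ℂ} {k v : Fin 3 → ℂ} (hv : ∑ i, k i * v i = 0) :
    ∑ i, k i * polarVec σ r k v i = 0 := by
  have e : ∀ i, cross k v i = ![k 1 * v 2 - k 2 * v 1, k 2 * v 0 - k 0 * v 2,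
      k 0 * v 1 - k 1 * v 0] i := fun i => by fin_cases i <;> rfl
  simp only [polarVec, e, Fin.sum_univ_three, Matrix.cons_val] at hv ⊢
  linear_combination (1 / 2) * hv

/-- On vectors with `k · v = 0` one has `k × (k × v) = -q v`. Hence `k × ·` has eigenvalues `± i√q`
there, and `polarVec` is the corresponding spectral projection. -/
theorem cross_polarVec {σ r q : ℂ} {k v : Fin 3 → ℂ} (hσ : σ ^ 2 = 1) (hr : r ^ 2 * q = 1)
    (hq : q = ∑ i, k i ^ 2) (hv : ∑ i, k i * v i = 0) (i : Fin 3) :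
    cross k (polarVec σ r k v) i = -Complex.I * σ * r * q * polarVec σ r k v i := by
  have e : ∀ w i, cross k w i = ![k 1 * w 2 - k 2 * w 1, k 2 * w 0 - k 0 * w 2,
      k 0 * w 1 - k 1 * w 0] i := fun w i => by fin_cases i <;> rfl
  have h : ∀ i, cross k (polarVec σ r k v) i =
      (1 / 2) * (cross k v i - Complex.I * σ * r * q * v i) := fun i => by
    rw [hq]
    rw [Fin.sum_univ_three] at hv ⊢
    fin_cases i
    · simp only [polarVec, e, Matrix.cons_val, Fin.zero_eta]
      linear_combination (1 / 2) * Complex.I * σ * r * k 0 * hv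
    · simp only [polarVec, e, Matrix.cons_val, Fin.mk_one]
      linear_combination (1 / 2) * Complex.I * σ * r * k 1 * hv
    · simp only [polarVec, e, Matrix.cons_val, Fin.reduceFinMk]
      linear_combination (1 / 2) * Complex.I * σ * r * k 2 * hv
  rw [h, polarVec]
  linear_combination (1 / 2) * cross k v i * (σ ^ 2 * r ^ 2 * q * Complex.I_sq - hσ - σ ^ 2 * hr)

/-- The projection transversal to `k` is `w ↦ -k × (k × w)/q`, and `k × (e₃ ∧ a) = -k₃ a` when `k ·
a = 0`. The projected rotation is therefore a multiple of `k × ·`, with `k₃` stored at index `2`. -/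
theorem sum_proj_crossHat {q : ℂ} (hq0 : q ≠ 0) {k a : Fin 3 → ℂ} (hq : q = ∑ i, k i ^ 2)
    (ha : ∑ i, k i * a i = 0) (i : Fin 3) :
    ∑ j, ((if i = j then 1 else 0) - k i * k j / q) * crossHat a j =
      k 2 / q * cross k a i := by
  have e : ∀ i, cross k a i = ![k 1 * a 2 - k 2 * a 1, k 2 * a 0 - k 0 * a 2,
      k 0 * a 1 - k 1 * a 0] i := fun i => by fin_cases i <;> rfl
  obtain ⟨Q, hQ⟩ : ∃ Q, Q = q⁻¹ := ⟨_, rfl⟩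
  have hqQ : q * Q = 1 := by rw [hQ, mul_inv_cancel₀ hq0]
  rw [hq, Fin.sum_univ_three] at hqQ
  rw [Fin.sum_univ_three] at ha
  simp only [div_eq_mul_inv, ← hQ, e, Fin.sum_univ_three, crossHat]
  fin_cases i
  · simp
    linear_combination a 1 * hqQ - Q * k 1 * ha
  · simp
    linear_combination -a 0 * hqQ + Q * k 0 * ha
  · simp
    ring

/-- Unit wave vectors as multipliers. -/
def dirSym (n : ℤ) (i : Fin 3) (y : Plane) : ℂ := ((freq n y i * (√(freqSq n y))⁻¹ : ℝ) : ℂ)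

theorem norm_dirSym_le (n : ℤ) (i : Fin 3) (y : Plane) : ‖dirSym n i y‖ ≤ 1 := by
  rw [dirSym, Complex.norm_real, norm_mul, norm_inv, Real.norm_of_nonneg (Real.sqrt_nonneg _)]
  refine mul_inv_le_one_of_le₀ ?_ (Real.sqrt_nonneg _)
  rw [Real.norm_eq_abs]
  refine Real.abs_le_sqrt ?_
  exact Finset.single_le_sum (f := fun i => freq n y i ^ 2) (fun _ _ => sq_nonneg _)
    (Finset.mem_univ i)

theorem isSymbol_dirSym (n : ℤ) (i : Fin 3) : IsSymbol (dirSym n i) :=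
  ⟨Complex.measurable_ofReal.comp ((measurable_freq n i).mul (measurable_freqSq n).sqrt.inv), 1,
    norm_dirSym_le n i⟩

/-- The polarized part of a field on the Fourier side. -/
def polar (σ : ℝ) (n : ℤ) (v : Fin 3 → Lp ℂ 2 (volume : Measure Plane)) (i : Fin 3) :
    Lp ℂ 2 (volume : Measure Plane) :=
  (1 / 2 : ℂ) • (v i + (Complex.I * σ) •
    (mulOp (dirSym n (i + 1)) (v (i + 2)) - mulOp (dirSym n (i + 2)) (v (i + 1))))

theorem polar_ae (σ : ℝ) (n : ℤ) (v : Fin 3 → Lp ℂ 2 (volume : Measure Plane)) :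
    ∀ᵐ y, ∀ i, polar σ n v i y = polarVec σ ((√(freqSq n y))⁻¹ : ℝ)
      (fun i => (freq n y i : ℂ)) (fun i => v i y) i := by
  rw [ae_all_iff]
  intro i
  set A := mulOp (dirSym n (i + 1)) (v (i + 2))
  set B := mulOp (dirSym n (i + 2)) (v (i + 1))
  filter_upwards [Lp.coeFn_smul (1 / 2 : ℂ) (v i + (Complex.I * σ) • (A - B)),
    Lp.coeFn_add (v i) ((Complex.I * σ) • (A - B)), Lp.coeFn_smul (Complex.I * σ) (A - B),
    Lp.coeFn_sub A B, mulOp_ae (isSymbol_dirSym n (i + 1)) (v (i + 2)),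
    mulOp_ae (isSymbol_dirSym n (i + 2)) (v (i + 1))] with y h1 h2 h3 h4 h5 h6
  rw [polar, h1, Pi.smul_apply, h2, Pi.add_apply, h3, Pi.smul_apply, h4, Pi.sub_apply, h5, h6,
    polarVec, cross, dirSym, dirSym, smul_eq_mul, smul_eq_mul]
  push_cast
  ring

theorem norm_polar_le {σ : ℝ} (hσ : |σ| ≤ 1) (n : ℤ)
    {v : Fin 3 → Lp ℂ 2 (volume : Measure Plane)} {B : ℝ} (hB : ∀ i, ‖v i‖ ≤ B) (i : Fin 3) :
    ‖polar σ n v i‖ ≤ 3 / 2 * B := by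
  have hm : ∀ j l, ‖mulOp (dirSym n j) (v l)‖ ≤ B := fun j l => by
    have := (mulOp (dirSym n j)).le_of_opNorm_le
      (norm_mulOp_le (isSymbol_dirSym n j) zero_le_one (norm_dirSym_le n j)) (v l)
    rw [one_mul] at this
    exact this.trans (hB l)
  have hB0 : 0 ≤ B := (norm_nonneg _).trans (hB 0)
  have h1 : ‖(Complex.I * σ) •
      (mulOp (dirSym n (i + 1)) (v (i + 2)) - mulOp (dirSym n (i + 2)) (v (i + 1)))‖ ≤ B + B := by
    rw [norm_smul, norm_mul, Complex.norm_I, one_mul, Complex.norm_real]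
    refine (mul_le_of_le_one_left (norm_nonneg _) hσ).trans ?_
    exact (norm_sub_le _ _).trans (add_le_add (hm _ _) (hm _ _))
  rw [polar, norm_smul]
  have h2 := (norm_add_le (v i) ((Complex.I * σ) •
      (mulOp (dirSym n (i + 1)) (v (i + 2)) - mulOp (dirSym n (i + 2)) (v (i + 1))))).trans
    (add_le_add (hB i) h1)
  have h3 : ‖(1 / 2 : ℂ)‖ = 1 / 2 := by norm_num
  rw [h3]
  linarith

theorem polar_add_polar (n : ℤ) (v : Fin 3 → Lp ℂ 2 (volume : Measure Plane)) (i : Fin 3) :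
    polar 1 n v i + polar (-1) n v i = v i := by
  rw [polar, polar]
  push_cast
  rw [mul_neg, neg_smul, ← smul_add, add_add_add_comm, add_neg_cancel, add_zero, ← two_smul ℂ,
    smul_smul]
  norm_num

/-- The wave with polarization `σ` and vertical frequency `n` generated by the Fourier data `v`. -/
def polarWave (Ω N σ : ℝ) (n : ℤ) (v : Fin 3 → Lp ℂ 2 (volume : Measure Plane)) (t : ℝ) :
    L2Field :=
  ∑ i, embed n i (mulOp (fun y => Complex.exp (t * waveSym n N (dispersion (σ * Ω * n) n) y))
    (polar σ n v i))

theorem polar_support {N : ℝ} (σ : ℝ) (n : ℤ) {v : Fin 3 → Lp ℂ 2 (volume : Measure Plane)}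
    (hv : ∀ᵐ y, N < ‖y‖ → ∀ i, v i y = 0) : ∀ᵐ y, N < ‖y‖ → ∀ i, polar σ n v i y = 0 := by
  filter_upwards [hv, polar_ae σ n v] with y h1 h2 hy i
  rw [h2]
  simp [polarVec, cross, h1 hy]

/-- A polarized amplitude is an eigenvector of the Coriolis operator with eigenvalue `-iσn/|ξ|`.
Multiplied by `Ω` this is minus the symbol `dispersion (σ * Ω * n) n`, and `n ≠ 0` keeps it bounded.
-/
theorem isSolution_polarWave {Ω N σ : ℝ} (hσ : σ ^ 2 = 1) {n : ℤ} (hn : n ≠ 0)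
    {v : Fin 3 → Lp ℂ 2 (volume : Measure Plane)} (hv : ∀ᵐ y, N < ‖y‖ → ∀ i, v i y = 0)
    (hdiv : ∀ᵐ y, ∑ i, (freq n y i : ℂ) * v i y = 0) :
    IsSolution Ω (∑ i, embed n i (polar σ n v i)) (polarWave Ω N σ n v) := by
  refine isSolution_wave n N (isSymbol_dispersion (σ * Ω * n) hn) (polar σ n v)
    (polar_support σ n hv) ?_ ?_
  · filter_upwards [polar_ae σ n v, hdiv] with y h1 h2
    simp_rw [h1]
    exact sum_mul_polarVec h2
  · filter_upwards [polar_ae σ n v, hdiv] with y h1 h2 i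
    have hq : 0 < freqSq n y := zero_lt_one.trans_le (one_le_freqSq hn y)
    have hqC : (freqSq n y : ℂ) ≠ 0 := by exact_mod_cast hq.ne'
    have hqs : (freqSq n y : ℂ) = ∑ i, (freq n y i : ℂ) ^ 2 := by
      rw [freqSq]; push_cast; rfl
    have hr : (((√(freqSq n y))⁻¹ : ℝ) : ℂ) ^ 2 * freqSq n y = 1 := by
      rw [← Complex.ofReal_pow, ← Complex.ofReal_mul, inv_pow, Real.sq_sqrt hq.le,
        inv_mul_cancel₀ hq.ne', Complex.ofReal_one]
    have hσC : (σ : ℂ) ^ 2 = 1 := by exact_mod_cast hσ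
    have hp : ∀ j, projSym n i j y = (if i = j then 1 else 0) -
        (freq n y i : ℂ) * (freq n y j : ℂ) / (freqSq n y : ℂ) := fun j => by
      rw [projSym]; push_cast; split_ifs <;> simp
    simp_rw [h1, hp]
    rw [sum_proj_crossHat hqC hqs (sum_mul_polarVec h2), cross_polarVec hσC hr hqs h2, dispersion]
    have h3 : freq n y 2 = n := rfl
    rw [h3]
    field_simp
    push_cast
    ring

theorem eLpNorm_coeFn_sum_le {ι : Type*} (s : Finset ι) (f : ι → L2Field) :
    eLpNorm (∑ i ∈ s, f i : L2Field) ⊤ (volume : Measure Layer) ≤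
      ∑ i ∈ s, eLpNorm (f i) ⊤ volume := by
  classical
  induction s using Finset.induction_on with
  | empty =>
    rw [Finset.sum_empty, Finset.sum_empty, eLpNorm_congr_ae (Lp.coeFn_zero _ _ _), eLpNorm_zero]
  | insert a s ha ih =>
    rw [Finset.sum_insert ha, Finset.sum_insert ha, eLpNorm_congr_ae (Lp.coeFn_add _ _)]
    exact (eLpNorm_add_le (Lp.aestronglyMeasurable _) (Lp.aestronglyMeasurable _) le_top).trans
      (add_le_add le_rfl ih)

/-- A measurable majorant `w` of the sup norm is produced, so that sums and time integrals can later
be exchanged without measurability of the norm itself. Since `|n| ≥ 1`, the power of `|β|` is at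
most that of `|Ω|`. The factor `9/2` is three components times the `3/2` of `norm_polar_le`. -/
theorem lintegral_eLpNorm_polarWave_le {Ω N σ B : ℝ} (hΩ : Ω ≠ 0) (hσ : |σ| = 1) {n : ℤ}
    (hn : n ≠ 0) {v : Fin 3 → Lp ℂ 2 (volume : Measure Plane)}
    (hv : ∀ᵐ y, N < ‖y‖ → ∀ i, v i y = 0) (hB : ∀ i, ‖v i‖ ≤ B) :
    ∃ w : ℝ → ℝ≥0∞, Measurable w ∧
      (∀ t, eLpNorm (polarWave Ω N σ n v t) ⊤ (volume : Measure Layer) ≤ w t) ∧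
      ∫⁻ t in Ici (0 : ℝ), w t ≤ ENNReal.ofReal
        (9 / 2 * dispersiveConst ((n : ℝ) ^ 2) N * (|Ω| ^ (-(1 / 4) : ℝ) * B)) := by
  set β := σ * Ω * n with hβ
  have hnR : (1 : ℝ) ≤ |(n : ℝ)| := by exact_mod_cast Int.one_le_abs hn
  have hM : (1 : ℝ) ≤ (n : ℝ) ^ 2 := by rw [← sq_abs]; exact one_le_pow₀ hnR
  have hΩ0 : 0 < |Ω| := abs_pos.2 hΩ
  have hβΩ : |Ω| ≤ |β| := by
    rw [hβ, abs_mul, abs_mul, hσ, one_mul]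
    exact le_mul_of_one_le_right hΩ0.le hnR
  have hβ0 : β ≠ 0 := abs_pos.1 (hΩ0.trans_le hβΩ)
  have hs : ∀ i, ∀ᵐ y, N < ‖y‖ → polar σ n v i y = 0 := fun i =>
    (polar_support σ n hv).mono fun y h hy => h hy i
  have hB0 : 0 ≤ B := (norm_nonneg _).trans (hB 0)
  refine ⟨fun t => ∑ i, waveSup β ((n : ℝ) ^ 2) (polar σ n v i) t,
    Finset.measurable_sum _ fun i _ => measurable_waveSup _ _ _, fun t => ?_, ?_⟩
  · exact (eLpNorm_coeFn_sum_le _ _).trans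
      (Finset.sum_le_sum fun i _ => eLpNorm_embed_wave_le hn (hs i) i t)
  · rw [lintegral_finsetSum _ fun i _ => measurable_waveSup _ _ _]
    have h1 : ∀ i, ∫⁻ t in Ici (0 : ℝ), waveSup β ((n : ℝ) ^ 2) (polar σ n v i) t ≤
        ENNReal.ofReal
          (dispersiveConst ((n : ℝ) ^ 2) N * |Ω| ^ (-(1 / 4) : ℝ) * (3 / 2 * B)) := fun i => by
      refine (lintegral_waveSup_le hβ0 hM _ (hs i)).trans (ENNReal.ofReal_le_ofReal ?_)
      have h2 : |β| ^ (-(1 / 4) : ℝ) ≤ |Ω| ^ (-(1 / 4) : ℝ) :=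
        Real.rpow_le_rpow_of_nonpos hΩ0 hβΩ (by norm_num)
      have h3 := norm_polar_le hσ.le n hB i
      have h4 := dispersiveConst_nonneg ((n : ℝ) ^ 2) N
      gcongr
    refine (Finset.sum_le_sum fun i _ => h1 i).trans (le_of_eq ?_)
    rw [Finset.sum_const, Finset.card_univ, Fintype.card_fin, nsmul_eq_mul,
      show ((3 : ℕ) : ℝ≥0∞) = ENNReal.ofReal 3 by simp, ← ENNReal.ofReal_mul (by norm_num)]
    congr 1
    ring

/-! ### Decomposition of the initial data -/

theorem hat_zero_of_verticalAverage {u : L2Field} (h : verticalAverage u =ᵐ[volume] 0)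
    (i : Fin 3) : hat 0 i u = 0 := by
  have h0 : verticalMode (component i u) 0 = 0 := by
    ext1
    have hae : ∀ᵐ x : Plane, ∀ᵐ z : UnitAddCircle,
        component i u (x, z) = ((u (x, z) i : ℝ) : ℂ) :=
      Measure.ae_ae_of_ae_prod (component_ae i u)
    filter_upwards [(memLp_fourierCoeff (component i u) 0).coeFn_toLp, h, hae,
      ae_memLp_section (Lp.memLp u), Lp.coeFn_zero ℂ 2 (volume : Measure Plane)]
      with x h1 h2 h3 h4 h5
    have hint : Integrable (fun z : UnitAddCircle => u (x, z)) := h4.integrable one_le_two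
    have hproj := (EuclideanSpace.proj i : Vec3 →L[ℝ] ℝ).integral_comp_comm hint
    rw [verticalMode, h1, h5, fourierCoeff, ← volume_unitAddCircle]
    simp only [neg_zero, fourier_zero, one_smul, Pi.zero_apply]
    rw [integral_congr_ae h3, integral_complex_ofReal, Complex.ofReal_eq_zero]
    refine hproj.trans ?_
    change EuclideanSpace.proj i (verticalAverage u x) = 0
    rw [h2, Pi.zero_apply, map_zero]
  rw [hat, h0, FourierTransform.fourier_zero]

/-- The substitution `k = 2πy` is a dilation, which preserves null sets, so the almost-everywhere
condition transfers. -/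
theorem FourierSupportedIn.hat_eq_zero {R : ℝ} {u : L2Field} (h : FourierSupportedIn R u)
    (n : ℤ) : ∀ᵐ y : Plane, ∀ i, R < √((2 * Real.pi * ‖y‖) ^ 2 + 4 * Real.pi ^ 2 * (n : ℝ) ^ 2) →
      hat n i u y = 0 := by
  rw [ae_all_iff]
  intro i
  have hpi : (2 * Real.pi) ≠ 0 := by positivity
  have hq : Measure.QuasiMeasurePreserving (fun y : Plane => (2 * Real.pi) • y) volume volume := by
    refine ⟨measurable_const_smul _, ?_⟩
    rw [Measure.map_addHaar_smul _ hpi]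
    exact Measure.smul_absolutelyContinuous
  filter_upwards [hq.ae (h i n)] with y hy hR
  have h1 := hy (by
    rw [fourierBall, mem_ofPred_eq, not_le, norm_smul, Real.norm_of_nonneg (by positivity)]
    exact hR)
  rw [layerFourier, smul_smul, inv_mul_cancel₀ hpi, one_smul] at h1
  exact (mul_eq_zero.1 h1).resolve_left (by exact_mod_cast inv_ne_zero hpi)

theorem FourierSupportedIn.hat_support {R : ℝ} {u : L2Field} (h : FourierSupportedIn R u)
    (n : ℤ) : ∀ᵐ y : Plane, R / (2 * Real.pi) < ‖y‖ → ∀ i, hat n i u y = 0 := by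
  filter_upwards [h.hat_eq_zero n] with y hy hR i
  refine hy i ?_
  rw [div_lt_iff₀ (by positivity)] at hR
  refine lt_of_lt_of_le ?_ (Real.le_sqrt_of_sq_le (x := 2 * Real.pi * ‖y‖)
    (le_add_of_nonneg_right (by positivity)))
  linarith

theorem FourierSupportedIn.hat_eq_zero_of_lt {R : ℝ} {u : L2Field} (h : FourierSupportedIn R u)
    {n : ℤ} (hn : R < |(n : ℝ)|) (i : Fin 3) : hat n i u = 0 := by
  ext1
  filter_upwards [h.hat_eq_zero n, Lp.coeFn_zero ℂ 2 (volume : Measure Plane)] with y hy h0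
  rw [h0, Pi.zero_apply]
  refine hy i (hn.trans_le (Real.le_sqrt_of_sq_le ?_))
  rw [sq_abs]
  exact (le_four_pi_sq_mul (sq_nonneg _)).trans (le_add_of_nonneg_left (sq_nonneg _))

/-- The nonzero vertical frequencies of size at most `⌈R⌉`. -/
def modes (R : ℝ) : Finset ℤ := (Finset.Icc (-⌈R⌉) ⌈R⌉).erase 0

theorem hat_eq_zero_of_notMem_modes {R : ℝ} {u : L2Field} (h0 : verticalAverage u =ᵐ[volume] 0)
    (h : FourierSupportedIn R u) {n : ℤ} (hn : n ∉ modes R) (i : Fin 3) : hat n i u = 0 := by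
  by_cases hz : n = 0
  · rw [hz]; exact hat_zero_of_verticalAverage h0 i
  · refine h.hat_eq_zero_of_lt ?_ i
    rw [modes, Finset.mem_erase, Finset.mem_Icc, not_and, ← abs_le, not_le] at hn
    have := hn hz
    exact (Int.le_ceil R).trans_lt (by exact_mod_cast this)

theorem sum_polar_eq {u : L2Field} {s : Finset ℤ} (h : ∀ n ∉ s, ∀ i, hat n i u = 0) :
    ∑ n ∈ s, ∑ σ ∈ ({1, -1} : Finset ℝ), ∑ i, embed n i (polar σ n (fun i => hat n i u) i) =
      u := by
  rw [← sum_embed_hat s h]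
  refine Finset.sum_congr rfl fun n _ => ?_
  rw [Finset.sum_pair (by norm_num), ← Finset.sum_add_distrib]
  simp_rw [← map_add, polar_add_polar, sum_embed_hat s h]

end Rossby

end

/-! ### Summation over vertical modes and polarizations. -/

theorem proposition2p3 (R : ℝ) (hR : 0 < R) :
    ∃ C : ℝ, 0 < C ∧ ∀ (Ω : ℝ), Ω ≠ 0 → ∀ u₀ : Rossby.L2Field,
      Rossby.verticalAverage u₀ =ᵐ[volume] 0 →
      Rossby.IsDivFree u₀ →
      Rossby.FourierSupportedIn R u₀ →
      ∃ u : ℝ → Rossby.L2Field,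
        Rossby.IsSolution Ω u₀ u ∧
        (∀ v : ℝ → Rossby.L2Field, Rossby.IsSolution Ω u₀ v → EqOn v u (Ici 0)) ∧
        ∫⁻ t in Ici (0 : ℝ), eLpNorm (u t) ∞ (volume : Measure Rossby.Layer) ≤
          ENNReal.ofReal (C * |Ω| ^ (-(1 / 4) : ℝ) * ‖u₀‖) := by
  -- The radius is that of the support in `y = k/(2π)`.
  set N := R / (2 * Real.pi)
  set c : ℤ → ℝ := fun n => 9 / 2 * Rossby.dispersiveConst ((n : ℝ) ^ 2) N with hc
  have hc0 : ∀ n, 0 ≤ c n := fun n =>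
    mul_nonneg (by norm_num) (Rossby.dispersiveConst_nonneg _ _)
  -- The summand `1` only secures strict positivity of the constant.
  refine ⟨1 + ∑ n ∈ Rossby.modes R, ∑ _σ ∈ ({1, -1} : Finset ℝ), c n, ?_, ?_⟩
  · have : 0 ≤ ∑ n ∈ Rossby.modes R, ∑ _σ ∈ ({1, -1} : Finset ℝ), c n :=
      Finset.sum_nonneg fun n _ => Finset.sum_nonneg fun _ _ => hc0 n
    positivity
  intro Ω hΩ u₀ hav hdiv hsupp
  set v : ℤ → Fin 3 → Lp ℂ 2 (volume : Measure Rossby.Plane) := fun n i => Rossby.hat n i u₀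
  have hmodes := fun n hn => Rossby.hat_eq_zero_of_notMem_modes hav hsupp (n := n) hn
  have hn0 : ∀ n ∈ Rossby.modes R, n ≠ 0 := fun n hn => (Finset.mem_erase.1 hn).1
  have hsol : Rossby.IsSolution Ω u₀ (fun t => ∑ n ∈ Rossby.modes R,
      ∑ σ ∈ ({1, -1} : Finset ℝ), Rossby.polarWave Ω N σ n (v n) t) := by
    have h1 := Rossby.IsSolution.sum (Ω := Ω) (Rossby.modes R) fun n hn =>
      Rossby.IsSolution.sum ({1, -1} : Finset ℝ) fun σ hσ =>
        Rossby.isSolution_polarWave (N := N) (σ := σ)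
          (by rcases Finset.mem_insert.1 hσ with rfl | h
              · norm_num
              · rw [Finset.mem_singleton.1 h]; norm_num)
          (hn0 n hn) (hsupp.hat_support n) (hdiv.sum_freq_mul_hat n)
    rwa [Rossby.sum_polar_eq hmodes] at h1
  refine ⟨_, hsol, fun w hw => hsol.unique hw, ?_⟩
  -- Majorants are chosen for all `n` and `σ`, with the value `0` off the index sets, so that
  -- measurability holds unconditionally.
  have hw : ∀ n σ, ∃ w : ℝ → ℝ≥0∞, Measurable w ∧ (n ∈ Rossby.modes R →
      σ ∈ ({1, -1} : Finset ℝ) →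
      (∀ t, eLpNorm (Rossby.polarWave Ω N σ n (v n) t) ⊤ (volume : Measure Rossby.Layer) ≤ w t) ∧
      ∫⁻ t in Ici (0 : ℝ), w t ≤
        ENNReal.ofReal (c n * (|Ω| ^ (-(1 / 4) : ℝ) * ‖u₀‖))) := fun n σ => by
    by_cases h : n ∈ Rossby.modes R ∧ σ ∈ ({1, -1} : Finset ℝ)
    · have hσ : |σ| = 1 := by
        rcases Finset.mem_insert.1 h.2 with rfl | h
        · norm_num
        · rw [Finset.mem_singleton.1 h]; norm_num
      obtain ⟨w, h1, h2, h3⟩ := Rossby.lintegral_eLpNorm_polarWave_le hΩ hσ (hn0 n h.1)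
        (hsupp.hat_support n) (fun i => Rossby.norm_hat_le n i u₀)
      exact ⟨w, h1, fun _ _ => ⟨h2, h3⟩⟩
    · exact ⟨0, measurable_zero, fun h1 h2 => absurd ⟨h1, h2⟩ h⟩
  choose w hwm hwb using hw
  have hX : 0 ≤ |Ω| ^ (-(1 / 4) : ℝ) * ‖u₀‖ := by positivity
  calc ∫⁻ t in Ici (0 : ℝ), eLpNorm (∑ n ∈ Rossby.modes R, ∑ σ ∈ ({1, -1} : Finset ℝ),
        Rossby.polarWave Ω N σ n (v n) t : Rossby.L2Field) ⊤ (volume : Measure Rossby.Layer)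
      ≤ ∫⁻ t in Ici (0 : ℝ), ∑ n ∈ Rossby.modes R, ∑ σ ∈ ({1, -1} : Finset ℝ), w n σ t :=
        lintegral_mono fun t => (Rossby.eLpNorm_coeFn_sum_le _ _).trans <|
          Finset.sum_le_sum fun n hn => (Rossby.eLpNorm_coeFn_sum_le _ _).trans <|
            Finset.sum_le_sum fun σ hσ => (hwb n σ hn hσ).1 t
    _ = ∑ n ∈ Rossby.modes R, ∑ σ ∈ ({1, -1} : Finset ℝ), ∫⁻ t in Ici (0 : ℝ), w n σ t := by
        rw [lintegral_finsetSum _ fun n _ => Finset.measurable_sum _ fun σ _ => hwm n σ]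
        exact Finset.sum_congr rfl fun n _ => lintegral_finsetSum _ fun σ _ => hwm n σ
    _ ≤ ∑ n ∈ Rossby.modes R, ∑ _σ ∈ ({1, -1} : Finset ℝ),
        ENNReal.ofReal (c n * (|Ω| ^ (-(1 / 4) : ℝ) * ‖u₀‖)) :=
        Finset.sum_le_sum fun n hn => Finset.sum_le_sum fun σ hσ => (hwb n σ hn hσ).2
    _ = ENNReal.ofReal ((∑ n ∈ Rossby.modes R, ∑ _σ ∈ ({1, -1} : Finset ℝ), c n) *
        (|Ω| ^ (-(1 / 4) : ℝ) * ‖u₀‖)) := by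
        rw [Finset.sum_mul, ENNReal.ofReal_sum_of_nonneg fun n _ =>
          mul_nonneg (Finset.sum_nonneg fun _ _ => hc0 n) hX]
        refine Finset.sum_congr rfl fun n _ => ?_
        rw [Finset.sum_mul, ENNReal.ofReal_sum_of_nonneg fun _ _ => mul_nonneg (hc0 n) hX]
    _ ≤ _ := by
        refine ENNReal.ofReal_le_ofReal ?_
        rw [mul_assoc]
        exact mul_le_mul_of_nonneg_right (le_add_of_nonneg_left zero_le_one) hX
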